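/- For integers $m,n,o\ge 1$ let $$I_{m,n,o}=\{f\in C([0,1],M_m\otimes M_n\otimes M_o)\mid f(0)\in M_m\otimes 1\otimes M_o,\ f(1)\in 1\otimes M_n\otimes M_o\}$$ be the stabilised dimension drop algebra. A Cartan subalgebra of a C*-algebra $A$ is a maximal abelian C*-subalgebra $B\subset A$ that contains an approximate unit of $A$, is regular (the set $\{x\in A\mid xBx^*\subset B,\ x^*Bx\subset B\}$ generates $A$ as a C*-algebra), and is the range of a faithful conditional expectation $A\to B$. A Cartan subalgebra $B\subset I_{m,n,o}$ is non-degenerate if $\dim B_0=mo$ and $\dim B_1=no$, where $B_t=\{f(t)\mid f\in B\}$. A C*-diagonal is a Cartan subalgebra $B\subset A$ with the unique extension property: every pure state of $B$ extends uniquely to a state of $A$. Then the following three statements are equivalent for $I_{m,n,o}$: 1. $m,n,o$ are pairwise coprime. 2. Every Cartan subalgebra of $I_{m,n,o}$ is non-degenerate. 3. Every Cartan subalgebra of $I_{m,n,o}$ is a C*-diagonal, that is, it has the unique extension property. -/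

import Mathlib

open scoped Matrix Matrix.Norms.L2Operator ComplexOrder

noncomputable section

namespace CartanDimDrop

section General

variable {A : Type*} [CStarAlgebra A]

/-- The normaliser of `B` in `A`: all `x` with `x B x* ⊆ B` and `x* B x ⊆ B`. -/
def normaliser (B : StarSubalgebra ℂ A) : Set A :=
  {x | ∀ b ∈ B, x * b * star x ∈ B ∧ star x * b * x ∈ B}

/-- `B` is regular in `A`: its normaliser generates `A` as a C*-algebra. -/
def IsRegular (B : StarSubalgebra ℂ A) : Prop :=
  (StarAlgebra.adjoin ℂ (normaliser B)).topologicalClosure = ⊤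

/-- `B` is a maximal abelian C*-subalgebra of `A`. -/
def IsMASA (B : StarSubalgebra ℂ A) : Prop :=
  Maximal (fun C : StarSubalgebra ℂ A =>
    IsClosed (C : Set A) ∧ ∀ x ∈ C, ∀ y ∈ C, x * y = y * x) B

/-- `E` is a conditional expectation of `A` onto `B`: a positive, `B`-bimodular linear projection.
(For commutative `B` these conditions imply that `E` is completely positive and contractive.) -/
structure IsConditionalExpectation (B : StarSubalgebra ℂ A) (E : A →ₗ[ℂ] A) : Prop where
  mem : ∀ x, E x ∈ B
  apply_of_mem : ∀ b ∈ B, E b = b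
  bimodule : ∀ b ∈ B, ∀ c ∈ B, ∀ x, E (b * x * c) = b * E x * c
  positive : ∀ x, ∃ y ∈ B, E (star x * x) = star y * y

/-- `B` is a Cartan subalgebra of the unital C*-algebra `A`: a regular MASA admitting a faithful
conditional expectation. Every MASA of a unital C*-algebra contains its unit, and
a closed subalgebra of `A` contains an approximate unit of `A` exactly when it contains `1`;
hence this condition is part of `B : StarSubalgebra ℂ A`. -/
structure IsCartan (B : StarSubalgebra ℂ A) : Prop where
  masa : IsMASA B
  regular : IsRegular B
  expectation : ∃ E : A →ₗ[ℂ] A, IsConditionalExpectation B E ∧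
    ∀ x, E (star x * x) = 0 → x = 0

end General

/-- The states of a unital C*-algebra `A`: unital positive linear functionals. It is also
used for a closed `*`-subalgebra in place of `A`. -/
def states (A : Type*) [Ring A] [StarRing A] [Algebra ℂ A] : Set (A →ₗ[ℂ] ℂ) :=
  {φ | φ 1 = 1 ∧ ∀ x, 0 ≤ φ (star x * x)}

/-- The pure states: extreme points of the convex set of states. -/
def pureStates (A : Type*) [Ring A] [StarRing A] [Algebra ℂ A] : Set (A →ₗ[ℂ] ℂ) :=
  Set.extremePoints ℝ (states A)

section General

variable {A : Type*} [CStarAlgebra A]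

/-- The unique extension property: every pure state of `B` extends uniquely to a state of `A`. -/
def HasUniqueExtensionProperty (B : StarSubalgebra ℂ A) : Prop :=
  ∀ φ ∈ pureStates B, ∃! ψ : A →ₗ[ℂ] ℂ, ψ ∈ states A ∧ ∀ b : B, ψ (b : A) = φ b

/-- `B` is a C*-diagonal: a Cartan subalgebra with the unique extension property. -/
def IsCStarDiagonal (B : StarSubalgebra ℂ A) : Prop :=
  IsCartan B ∧ HasUniqueExtensionProperty B

end General

section DimensionDrop

/-- The matrix algebra `M_m ⊗ M_n ⊗ M_o`; the matrix units `e_ii' ⊗ e_jj' ⊗ e_kk'` are the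
matrix units at the position `(i, j, k), (i', j', k')`. -/
abbrev Mat3 (m n o : ℕ) : Type :=
  Matrix (Fin m × Fin n × Fin o) (Fin m × Fin n × Fin o) ℂ

/-- The embedding `M_m ⊗ M_o → M_m ⊗ 1 ⊗ M_o`. -/
def embedLeft (m n o : ℕ) : Matrix (Fin m × Fin o) (Fin m × Fin o) ℂ →⋆ₐ[ℂ] Mat3 m n o where
  toFun a := Matrix.of fun p q => if p.2.1 = q.2.1 then a (p.1, p.2.2) (q.1, q.2.2) else 0
  map_one' := by
    ext ⟨i, j, k⟩ ⟨i', j', k'⟩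
    simp only [Matrix.of_apply, Matrix.one_apply, Prod.mk.injEq]
    split_ifs <;> simp_all
  map_mul' a b := by
    ext ⟨i, j, k⟩ ⟨i', j', k'⟩
    simp only [Matrix.of_apply, Matrix.mul_apply, Fintype.sum_prod_type]
    by_cases h : j = j'
    · subst h; simp
    · simp [h]
  map_zero' := by ext; simp
  map_add' a b := by
    ext p q
    simp only [Matrix.of_apply, Matrix.add_apply]
    split_ifs <;> simp
  commutes' r := by
    ext ⟨i, j, k⟩ ⟨i', j', k'⟩
    simp only [Matrix.of_apply, Matrix.algebraMap_matrix_apply, Prod.mk.injEq]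
    split_ifs <;> simp_all
  map_star' a := by
    ext p q
    simp only [Matrix.of_apply, Matrix.star_apply, eq_comm (a := p.2.1)]
    split_ifs <;> simp

/-- The embedding `M_n ⊗ M_o → 1 ⊗ M_n ⊗ M_o`. -/
def embedRight (m n o : ℕ) : Matrix (Fin n × Fin o) (Fin n × Fin o) ℂ →⋆ₐ[ℂ] Mat3 m n o where
  toFun a := Matrix.of fun p q => if p.1 = q.1 then a p.2 q.2 else 0
  map_one' := by
    ext ⟨i, j⟩ ⟨i', j'⟩
    simp only [Matrix.of_apply, Matrix.one_apply, Prod.mk.injEq]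
    split_ifs <;> simp_all
  map_mul' a b := by
    ext ⟨i, j⟩ ⟨i', j'⟩
    simp only [Matrix.of_apply, Matrix.mul_apply, Fintype.sum_prod_type (α₁ := Fin m)]
    by_cases h : i = i'
    · subst h; simp
    · simp [h]
  map_zero' := by ext; simp
  map_add' a b := by
    ext p q
    simp only [Matrix.of_apply, Matrix.add_apply]
    split_ifs <;> simp
  commutes' r := by
    ext ⟨i, j⟩ ⟨i', j'⟩
    simp only [Matrix.of_apply, Matrix.algebraMap_matrix_apply, Prod.mk.injEq]
    split_ifs <;> simp_all
  map_star' a := by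
    ext p q
    simp only [Matrix.of_apply, Matrix.star_apply, eq_comm (a := p.1)]
    split_ifs <;> simp

/-- The stabilised dimension drop algebra `I_{m,n,o}` inside `C([0,1], M_m ⊗ M_n ⊗ M_o)`. -/
def dimDrop (m n o : ℕ) : StarSubalgebra ℂ C(unitInterval, Mat3 m n o) where
  carrier := {f | f 0 ∈ (embedLeft m n o).range ∧ f 1 ∈ (embedRight m n o).range}
  mul_mem' hf hg := ⟨mul_mem hf.1 hg.1, mul_mem hf.2 hg.2⟩
  add_mem' hf hg := ⟨add_mem hf.1 hg.1, add_mem hf.2 hg.2⟩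
  algebraMap_mem' r := ⟨algebraMap_mem _ r, algebraMap_mem _ r⟩
  star_mem' hf := ⟨star_mem hf.1, star_mem hf.2⟩

theorem isClosed_dimDrop (m n o : ℕ) :
    IsClosed (dimDrop m n o : Set C(unitInterval, Mat3 m n o)) := by
  have hcl : ∀ S : StarSubalgebra ℂ (Mat3 m n o), IsClosed (S : Set (Mat3 m n o)) := fun S =>
    Submodule.closed_of_finiteDimensional S.toSubalgebra.toSubmodule
  exact ((hcl _).preimage (continuous_eval_const 0)).inter
    ((hcl _).preimage (continuous_eval_const 1))

/-- `I_{m,n,o}` as a C*-algebra, with the operations and the norm of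
`C([0,1], M_m ⊗ M_n ⊗ M_o)`. -/
instance instCStarAlgebraDimDrop (m n o : ℕ) : CStarAlgebra (dimDrop m n o) :=
  haveI := isClosed_dimDrop m n o
  StarSubalgebra.cstarAlgebra (dimDrop m n o)

/-- The fibre `B_t = {f(t) | f ∈ B}` of a subalgebra `B` of `I_{m,n,o}`. -/
def fibre {m n o : ℕ} (B : StarSubalgebra ℂ (dimDrop m n o)) (t : unitInterval) :
    Submodule ℂ (Mat3 m n o) where
  carrier := {x | ∃ f ∈ B, (f : C(unitInterval, Mat3 m n o)) t = x}
  add_mem' := by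
    rintro _ _ ⟨f, hf, rfl⟩ ⟨g, hg, rfl⟩
    exact ⟨f + g, add_mem hf hg, rfl⟩
  zero_mem' := ⟨0, zero_mem B, rfl⟩
  smul_mem' := by
    rintro c _ ⟨f, hf, rfl⟩
    exact ⟨c • f, B.smul_mem hf c, rfl⟩

/-- `B ⊆ I_{m,n,o}` is non-degenerate: `dim B_0 = mo` and `dim B_1 = no`. -/
def IsNonDegenerate {m n o : ℕ} (B : StarSubalgebra ℂ (dimDrop m n o)) : Prop :=
  Module.finrank ℂ (fibre B 0) = m * o ∧ Module.finrank ℂ (fibre B 1) = n * o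

end DimensionDrop

end CartanDimDrop

end

noncomputable section

namespace CartanDimDrop

/-! At an endpoint the algebra evaluates to `M_K ⊗ 1` inside `M_K ⊗ M_L`, with `(K, L) = (mo, n)` at
`0` and `(no, m)` at `1`. The numbers `m, n, o` are pairwise coprime exactly when `gcd(K, L) = 1` at
both ends.

Coprime implies non-degenerate. At interior points the existence of a conditional expectation `E`
makes the commutant of the fibre `B_t` commutative, so `B_t` consists of all diagonal matrices in
some orthonormal basis. In that basis `E` is compression to the diagonal and normalisers are
monomial matrices. Compactness of the unitary group carries such a basis to the endpoints
(`exists_isFrame`). There the `KL` basis vectors are partitioned in two ways: into classes of size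
`β` that `B_t` does not separate, and into classes of size `ω` generating the same cyclic subspace
under `M_K ⊗ 1`. Computing the dimension of a cyclic subspace in two ways gives `ωL = Kβ`. With
`gcd(K, L) = 1` this forces `β = L`, hence `dim B_t = K` (`finrank_diagFunctions_eq_card`).

Non-degenerate implies unique extension. A pure state of `B` is multiplicative and lives over one
point `t`. By the dimension condition it selects a `p` in `B` whose value at `t` is a minimal
projection of the fibre of the whole algebra. Every extension `ψ` satisfies `ψ(x) = ψ(pxp)`, and
`pxp = cp` at `t` determines this number.

Unique extension implies coprime. If `d = gcd(K, L) > 1`, a basis of maximally entangled vectors is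
compatible with `M_K ⊗ 1`: its compression preserves that algebra and Weyl matrices are monomial in
it. Diagonal elements of `M_K ⊗ 1` in this basis are constant along blocks of length `d`, so they do
not separate certain vector states. A path of unitaries to the standard basis at the other end
yields a Cartan subalgebra without unique extension. -/

/-! ### Simultaneous diagonalisation of commutative matrix algebras. -/

open Module.End in
theorem exists_unitary_isDiag {X : Type*} [Fintype X] [DecidableEq X]
    (S : StarSubalgebra ℂ (Matrix X X ℂ)) (hS : ∀ a ∈ S, ∀ b ∈ S, a * b = b * a) :
    ∃ u ∈ Matrix.unitaryGroup X ℂ, ∀ a ∈ S, (star u * a * u).IsDiag := by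
  classical
  -- The self-adjoint elements of `S` act as commuting symmetric operators; a basis of joint
  -- eigenvectors diagonalises them, and real and imaginary parts reach the rest of `S`.
  let J := {a : Matrix X X ℂ // a ∈ S ∧ a.IsHermitian}
  let T : J → (EuclideanSpace ℂ X →ₗ[ℂ] EuclideanSpace ℂ X) := fun a => Matrix.toEuclideanLin a.1
  have hT : ∀ i, (T i).IsSymmetric := fun i =>
    Matrix.isSymmetric_toEuclideanLin_iff.2 i.2.2
  have hC : Pairwise (Function.onFun Commute T) := by
    intro a b _
    have := hS a.1 a.2.1 b.1 b.2.1
    ext v i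
    have h2 := congrFun (congrArg (fun M => M.mulVec v.ofLp) this) i
    simpa [T, Matrix.toLpLin_apply, Matrix.mulVec_mulVec] using h2
  let V : (J → ℂ) → Submodule ℂ (EuclideanSpace ℂ X) := fun χ => ⨅ j, eigenspace (T j) (χ j)
  have hV := LinearMap.IsSymmetric.orthogonalFamily_iInf_eigenspaces hT
  have hint : DirectSum.IsInternal V :=
    LinearMap.IsSymmetric.directSum_isInternal_of_pairwise_commute hT hC
  -- Only finitely many of the families `χ` have a non-zero joint eigenspace, and the adapted basis
  -- needs a finite index set.
  have hfin : Finite {χ // V χ ≠ ⊥} := WellFoundedGT.finite_ne_bot_of_iSupIndep hV.independent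
  have := Fintype.ofFinite {χ // V χ ≠ ⊥}
  have hint' : DirectSum.IsInternal (fun χ : {χ // V χ ≠ ⊥} => V χ) :=
    (DirectSum.isInternal_ne_bot_iff).2 hint
  have hV' : OrthogonalFamily ℂ (fun χ : {χ // V χ ≠ ⊥} => V χ)
      fun χ => (V χ).subtypeₗᵢ := hV.comp Subtype.val_injective
  let b0 := hint'.subordinateOrthonormalBasis (finrank_euclideanSpace (𝕜 := ℂ) (ι := X)) hV'
  let e := Fintype.equivFin X
  let b := b0.reindex e.symm
  have hb : ∀ a : J, ∀ x, ∃ c : ℂ, T a (b x) = c • b x := by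
    intro a x
    have h := hint'.subordinateOrthonormalBasis_subordinate
      (finrank_euclideanSpace (𝕜 := ℂ) (ι := X)) (e x) hV'
    have h2 := (Submodule.mem_iInf _).1 h a
    exact ⟨_, by simpa [b, b0] using mem_eigenspace_iff.1 h2⟩
  let u : Matrix X X ℂ := (EuclideanSpace.basisFun X ℂ).toBasis.toMatrix b
  have hu : u ∈ Matrix.unitaryGroup X ℂ :=
    (EuclideanSpace.basisFun X ℂ).toMatrix_orthonormalBasis_mem_unitary b
  have hu' : star u * u = 1 := (Matrix.mem_unitaryGroup_iff').1 hu
  have key : ∀ a : J, (star u * a.1 * u).IsDiag := by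
    intro a
    choose c hc using hb a
    have : a.1 * u = u * Matrix.diagonal c := by
      ext i x
      have := congrArg (fun v => v.ofLp i) (hc x)
      simp only [T, Matrix.toLpLin_apply] at this
      rw [Matrix.mul_diagonal, Matrix.mul_apply]
      simpa [Matrix.mulVec, dotProduct, u, Module.Basis.toMatrix_apply, mul_comm (c x)] using this
    rw [mul_assoc, this, ← mul_assoc, hu', one_mul]
    exact Matrix.isDiag_diagonal _
  refine ⟨u, hu, fun a ha => ?_⟩
  have h1 : a = (realPart a : Matrix X X ℂ) + Complex.I • (imaginaryPart a : Matrix X X ℂ) :=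
    (realPart_add_I_smul_imaginaryPart a).symm
  have hre : (realPart a : Matrix X X ℂ) ∈ S := by
    rw [realPart_apply_coe]
    have := S.smul_mem (add_mem ha (star_mem ha)) ((2:ℂ)⁻¹)
    convert this using 1
    ext i j; simp [mul_add]
  have him : (imaginaryPart a : Matrix X X ℂ) ∈ S := by
    rw [imaginaryPart_apply_coe]
    have := S.smul_mem (sub_mem ha (star_mem ha)) (-Complex.I * (2:ℂ)⁻¹)
    convert this using 1
    ext i j; simp [mul_assoc, mul_sub]
  rw [h1, mul_add, add_mul, mul_smul_comm, smul_mul_assoc]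
  exact (key ⟨_, hre, (realPart a).2⟩).add ((key ⟨_, him, (imaginaryPart a).2⟩).smul _)

/-- The indicator is a product of functions in `S`, one for each point `y`, equal to `1` at `x` and
vanishing at `y` if `S` separates `y` from `x`. -/
theorem indicator_mem {X : Type*} [Fintype X] [DecidableEq X] (S : Subalgebra ℂ (X → ℂ)) (x : X)
    [DecidablePred fun y => ∀ f ∈ S, f y = f x] :
    (fun y => if ∀ f ∈ S, f y = f x then (1 : ℂ) else 0) ∈ S := by
  classical
  have hex : ∀ y, ∃ f ∈ S, f x = 1 ∧ ((¬ ∀ f ∈ S, f y = f x) → f y = 0) := by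
    intro y
    by_cases h : ∀ f ∈ S, f y = f x
    · exact ⟨1, one_mem _, rfl, fun h' => (h' h).elim⟩
    · push Not at h
      obtain ⟨f, hf, hne⟩ := h
      refine ⟨(f x - f y)⁻¹ • (f - algebraMap ℂ _ (f y)),
        S.smul_mem (sub_mem hf (S.algebraMap_mem _)) _, ?_, ?_⟩
      · have : f x - f y ≠ 0 := sub_ne_zero.2 (Ne.symm hne)
        simp [this]
      · simp
  choose f hf h1 h2 using hex
  have : (fun y => if ∀ f ∈ S, f y = f x then (1 : ℂ) else 0) = ∏ z, f z := by
    ext y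
    rw [Finset.prod_apply]
    split_ifs with h
    · exact (Finset.prod_eq_one fun z _ => by rw [h _ (hf z), h1 z]).symm
    · exact (Finset.prod_eq_zero (f := fun z => f z y) (Finset.mem_univ y) (h2 y h)).symm
  rw [this]
  exact prod_mem fun z _ => hf z

/-- The diagonal matrices in the orthonormal basis given by the columns of `u`. -/
def diagHom {X : Type*} [Fintype X] [DecidableEq X] (u : Matrix X X ℂ)
    (hu : u ∈ Matrix.unitaryGroup X ℂ) : (X → ℂ) →ₐ[ℂ] Matrix X X ℂ :=
  AlgHom.ofLinearMap
    { toFun := fun f => u * Matrix.diagonal f * star u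
      map_add' := fun f g => by
        rw [show Matrix.diagonal (f + g) = Matrix.diagonal f + Matrix.diagonal g from
          (Matrix.diagonal_add f g).symm, mul_add, add_mul]
      map_smul' := fun c f => by
        rw [Matrix.diagonal_smul, mul_smul_comm, smul_mul_assoc, RingHom.id_apply] }
    (by
      have := (Matrix.mem_unitaryGroup_iff).1 hu
      simp only [LinearMap.coe_mk, AddHom.coe_mk]
      rw [Pi.one_def, Matrix.diagonal_one, mul_one, this])
    (fun f g => by
      have := (Matrix.mem_unitaryGroup_iff').1 hu
      simp only [LinearMap.coe_mk, AddHom.coe_mk]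
      have h : Matrix.diagonal (f * g) = Matrix.diagonal f * Matrix.diagonal g := by
        rw [Matrix.diagonal_mul_diagonal]; rfl
      rw [h]
      calc _ = u * Matrix.diagonal f * (1 * (Matrix.diagonal g * star u)) := by
            simp only [one_mul, mul_assoc]
        _ = _ := by rw [← this]; simp only [mul_assoc])

theorem diagHom_apply {X : Type*} [Fintype X] [DecidableEq X] (u : Matrix X X ℂ)
    (hu : u ∈ Matrix.unitaryGroup X ℂ) (f : X → ℂ) :
    diagHom u hu f = u * Matrix.diagonal f * star u := rfl

theorem conj_conj {X : Type*} [Fintype X] [DecidableEq X] {u : Matrix X X ℂ}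
    (hu : u ∈ Matrix.unitaryGroup X ℂ) (a : Matrix X X ℂ) :
    star u * (u * a * star u) * u = a := by
  have h := (Matrix.mem_unitaryGroup_iff').1 hu
  calc _ = (star u * u) * a * (star u * u) := by simp only [mul_assoc]
    _ = a := by rw [h, one_mul, mul_one]

theorem conj_conj' {X : Type*} [Fintype X] [DecidableEq X] {u : Matrix X X ℂ}
    (hu : u ∈ Matrix.unitaryGroup X ℂ) (a : Matrix X X ℂ) :
    u * (star u * a * u) * star u = a := by
  have h := (Matrix.mem_unitaryGroup_iff).1 hu
  calc _ = (u * star u) * a * (u * star u) := by simp only [mul_assoc]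
    _ = a := by rw [h, one_mul, mul_one]

theorem isDiag_conj_iff {X : Type*} [Fintype X] [DecidableEq X] {u : Matrix X X ℂ}
    (hu : u ∈ Matrix.unitaryGroup X ℂ) (a : Matrix X X ℂ) :
    (star u * a * u).IsDiag ↔ a ∈ (diagHom u hu).range := by
  constructor
  · intro h
    refine ⟨Matrix.diag (star u * a * u), ?_⟩
    change diagHom u hu _ = _
    rw [diagHom_apply, h.diagonal_diag, conj_conj' hu]
  · rintro ⟨f, rfl⟩
    change (star u * (diagHom u hu f) * u).IsDiag
    rw [diagHom_apply, conj_conj hu]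
    exact Matrix.isDiag_diagonal f

theorem diagHom_injective {X : Type*} [Fintype X] [DecidableEq X] {u : Matrix X X ℂ}
    (hu : u ∈ Matrix.unitaryGroup X ℂ) : Function.Injective (diagHom u hu) := by
  intro f g h
  have := congrArg (fun a => star u * a * u) h
  simp only [diagHom_apply, conj_conj hu] at this
  exact Matrix.diagonal_injective this

theorem finrank_range_diagHom {X : Type*} [Fintype X] [DecidableEq X] {u : Matrix X X ℂ}
    (hu : u ∈ Matrix.unitaryGroup X ℂ) :
    Module.finrank ℂ (diagHom u hu).toLinearMap.range = Fintype.card X := by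
  rw [LinearMap.finrank_range_of_inj (diagHom_injective hu), Module.finrank_fintype_fun_eq_card]

/-- A commutative self-adjoint matrix algebra with commutative commutant is conjugate to the
algebra of all diagonal matrices. -/
theorem exists_unitary_mem_iff_of_commutant {X : Type*} [Fintype X] [DecidableEq X]
    (S : StarSubalgebra ℂ (Matrix X X ℂ)) (hS : ∀ a ∈ S, ∀ b ∈ S, a * b = b * a)
    (hS' : ∀ c d : Matrix X X ℂ, (∀ a ∈ S, a * c = c * a) → (∀ a ∈ S, a * d = d * a) →
      c * d = d * c) :
    ∃ u ∈ Matrix.unitaryGroup X ℂ, ∀ a, a ∈ S ↔ (star u * a * u).IsDiag := by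
  classical
  obtain ⟨u, hu, hd⟩ := exists_unitary_isDiag S hS
  refine ⟨u, hu, fun a => ⟨hd a, fun h => ?_⟩⟩
  let T : Subalgebra ℂ (X → ℂ) := S.toSubalgebra.comap (diagHom u hu)
  have hT : ∀ f, f ∈ T ↔ diagHom u hu f ∈ S := fun f => Iff.rfl
  -- If `T` did not separate `x` from `y`, the matrix units at `(x, y)` and `(y, x)` in the basis
  -- `u` would both commute with `S`, but they do not commute with each other.
  have hsep : ∀ x y, (∀ f ∈ T, f y = f x) → y = x := by
    intro x y hxy
    by_contra hne
    have hc : ∀ p q, (p = x ∨ p = y) → (q = x ∨ q = y) →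
        ∀ a ∈ S, a * (u * Matrix.single p q 1 * star u)
          = (u * Matrix.single p q 1 * star u) * a := by
      intro p q hp hq a ha
      obtain ⟨f, rfl⟩ := (isDiag_conj_iff hu a).1 (hd a ha)
      change diagHom u hu f * _ = _ * diagHom u hu f
      have hf : f p = f q := by
        have := hxy f ha
        rcases hp with rfl | rfl <;> rcases hq with rfl | rfl <;> simp [this]
      have huu := (Matrix.mem_unitaryGroup_iff').1 hu
      have h1 : Matrix.diagonal f * Matrix.single p q 1
          = Matrix.single p q 1 * Matrix.diagonal f := by
        ext i j
        rw [Matrix.diagonal_mul, Matrix.mul_diagonal]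
        by_cases hi : p = i ∧ q = j
        · obtain ⟨rfl, rfl⟩ := hi; rw [hf, mul_comm]
        · rw [Matrix.single_apply_of_ne (h := hi)]; simp
      rw [diagHom_apply]
      calc _ = u * Matrix.diagonal f * (star u * u) * Matrix.single p q 1 * star u := by
            simp only [mul_assoc]
        _ = u * (Matrix.diagonal f * Matrix.single p q 1) * star u := by
            rw [huu]; simp only [mul_assoc, mul_one]
        _ = u * Matrix.single p q 1 * (star u * u) * Matrix.diagonal f * star u := by
            rw [h1, huu]; simp only [mul_assoc, one_mul]
        _ = _ := by simp only [mul_assoc]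
    have h1 := hS' _ _ (hc x y (Or.inl rfl) (Or.inr rfl)) (hc y x (Or.inr rfl) (Or.inl rfl))
    have huu := (Matrix.mem_unitaryGroup_iff').1 hu
    have h2 : ∀ c d : Matrix X X ℂ, star u * ((u * c * star u) * (u * d * star u)) * u = c * d := by
      intro c d
      calc _ = (star u * u) * c * (star u * u) * d * (star u * u) := by simp only [mul_assoc]
        _ = _ := by rw [huu]; simp only [mul_one, one_mul]
    have h3 := congrArg (fun a => star u * a * u) h1
    simp only [h2, Matrix.single_mul_single_same] at h3
    have h4 := congrFun (congrFun h3 x) x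
    simp [hne] at h4
  obtain ⟨f, rfl⟩ := (isDiag_conj_iff hu a).1 h
  have hf : f = ∑ x, f x • (fun y => if ∀ g ∈ T, g y = g x then (1 : ℂ) else 0) := by
    ext y
    rw [Finset.sum_apply, Finset.sum_eq_single y]
    · simp
    · intro x _ hx
      have : ¬ ∀ g ∈ T, g y = g x := fun h => hx (hsep _ _ h).symm
      simp [this]
    · simp
  have : f ∈ T := by
    rw [hf]
    exact sum_mem fun x _ => T.smul_mem (indicator_mem T x) _
  exact this

/-- A commutative self-adjoint matrix algebra of maximal dimension is conjugate to the
algebra of all diagonal matrices. -/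
theorem exists_unitary_mem_iff_of_finrank {X : Type*} [Fintype X] [DecidableEq X]
    (S : StarSubalgebra ℂ (Matrix X X ℂ)) (hS : ∀ a ∈ S, ∀ b ∈ S, a * b = b * a)
    (hdim : Module.finrank ℂ S = Fintype.card X) :
    ∃ u ∈ Matrix.unitaryGroup X ℂ, ∀ a, a ∈ S ↔ (star u * a * u).IsDiag := by
  obtain ⟨u, hu, hd⟩ := exists_unitary_isDiag S hS
  refine ⟨u, hu, fun a => ⟨hd a, fun h => ?_⟩⟩
  have hle : Subalgebra.toSubmodule S.toSubalgebra ≤ (diagHom u hu).toLinearMap.range := by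
    intro a ha
    exact (isDiag_conj_iff hu a).1 (hd a ha)
  have := Submodule.eq_of_le_of_finrank_eq hle (by rw [finrank_range_diagHom]; exact hdim)
  have h2 : a ∈ (diagHom u hu).toLinearMap.range := (isDiag_conj_iff hu a).1 h
  rw [← this] at h2
  exact h2

/-! ### Monomial matrices and traces of multiplication operators. -/

/-- Every row and every column of a monomial matrix has at most one non-zero entry. -/
def IsMonomial {X : Type*} (a : Matrix X X ℂ) : Prop :=
  (∀ x y z, a y x ≠ 0 → a z x ≠ 0 → y = z) ∧ ∀ x y z, a x y ≠ 0 → a x z ≠ 0 → y = z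

theorem IsMonomial.star {X : Type*} {a : Matrix X X ℂ} (ha : IsMonomial a) : IsMonomial (star a) := by
  refine ⟨fun x y z h1 h2 => ha.2 x y z ?_ ?_, fun x y z h1 h2 => ha.1 x y z ?_ ?_⟩ <;>
  · simp only [Matrix.star_apply, ne_eq, star_eq_zero] at h1 h2
    assumption

theorem trace_mulRight {Y : Type*} [Fintype Y] [DecidableEq Y] (q : Matrix Y Y ℂ) :
    LinearMap.trace ℂ _ (LinearMap.mulRight ℂ q) = Fintype.card Y * q.trace := by
  rw [LinearMap.trace_eq_matrix_trace ℂ (Matrix.stdBasis ℂ Y Y), Matrix.trace]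
  simp only [Matrix.diag_apply, LinearMap.toMatrix_apply, LinearMap.mulRight_apply]
  have : ∀ p : Y × Y,
      (Matrix.stdBasis ℂ Y Y).repr (Matrix.stdBasis ℂ Y Y p * q) p = q p.2 p.2 := by
    rintro ⟨i, j⟩
    rw [Matrix.stdBasis_eq_single]
    have h : ∀ a : Matrix Y Y ℂ, (Matrix.stdBasis ℂ Y Y).repr a (i, j) = a i j := fun a => rfl
    rw [h]; simp
  rw [Finset.sum_congr rfl fun p _ => this p, Fintype.sum_prod_type]
  simp [Matrix.trace]

/-- Right multiplication by an idempotent is an idempotent operator, so its rank is its trace. -/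
theorem finrank_range_mulRight {Y : Type*} [Fintype Y] [DecidableEq Y] (q : Matrix Y Y ℂ)
    (hq : q * q = q) :
    (Module.finrank ℂ (LinearMap.mulRight ℂ q).range : ℂ) = Fintype.card Y * q.trace := by
  rw [← trace_mulRight]
  refine (LinearMap.IsProj.trace (p := (LinearMap.mulRight ℂ q).range) ⟨fun x => ⟨x, rfl⟩, ?_⟩).symm
  rintro _ ⟨x, rfl⟩
  simp [mul_assoc, hq]

theorem card_eq_mul_of_fibre {X Z : Type*} [Fintype X] [DecidableEq X] [DecidableEq Z] (f : X → Z)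
    (β : ℕ) (h : ∀ x, (Finset.univ.filter fun y => f y = f x).card = β) :
    Fintype.card X = (Finset.univ.image f).card * β := by
  rw [← Finset.card_univ, Finset.card_eq_sum_card_image f, Finset.sum_const_nat]
  intro z hz
  obtain ⟨x, -, rfl⟩ := Finset.mem_image.1 hz
  exact h x

/-! ### The counting argument for compressions that preserve a full matrix algebra. -/

section Commuting

variable {X Y : Type*} [Fintype X] [DecidableEq X] [Fintype Y] [DecidableEq Y]
  (ι : Matrix Y Y ℂ →⋆ₐ[ℂ] Matrix X X ℂ)

/-- The functions whose diagonal matrix is in the range of `ι`. -/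
def diagFunctions : Subalgebra ℂ (X → ℂ) :=
  ι.toAlgHom.range.comap (Matrix.diagonalAlgHom ℂ)

/-- The map `a ↦ ι(a) e_x`. -/
def colMap (x : X) : Matrix Y Y ℂ →ₗ[ℂ] (X → ℂ) where
  toFun a y := ι a y x
  map_add' a b := by ext; simp
  map_smul' c a := by ext; simp

theorem colMap_apply (x : X) (a : Matrix Y Y ℂ) (y : X) : colMap ι x a y = ι a y x := rfl

theorem colMap_mul (x : X) (a b : Matrix Y Y ℂ) :
    colMap ι x (a * b) = (ι a).mulVec (colMap ι x b) := by
  ext y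
  simp [colMap_apply, Matrix.mul_apply, Matrix.mulVec, dotProduct]

/-- The trace is faithful: `ι a = 0` makes the trace of `star a * a` vanish. -/
theorem injective_of_trace (L : ℕ) (hL : L ≠ 0) (htr : ∀ a, (ι a).trace = L * a.trace) :
    Function.Injective ι := by
  rw [injective_iff_map_eq_zero]
  intro a ha
  have h := htr (star a * a)
  rw [map_mul, ha, mul_zero, Matrix.trace_zero] at h
  have h2 : (star a * a).trace = 0 := by
    rcases mul_eq_zero.1 h.symm with h | h
    · exact (hL (by exact_mod_cast h)).elim
    · exact h
  exact Matrix.trace_conjTranspose_mul_self_eq_zero_iff.1 h2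

/-- The squared norm of the column of `ι a` at `y` is a diagonal entry of `ι (star a * a)`. By `hΔ`
it depends only on the class of `y`, so a vanishing column at `x` forces all columns of its class to
vanish. -/
theorem colMap_eq_zero_iff (hΔ : ∀ a, ∃ b, ι b = Matrix.diagonal (Matrix.diag (ι a)))
    (hinj : Function.Injective ι) (x : X) (q : Matrix Y Y ℂ)
    [DecidablePred fun y => ∀ f ∈ diagFunctions ι, f y = f x]
    (hq : ι q = Matrix.diagonal fun y => if ∀ f ∈ diagFunctions ι, f y = f x then (1 : ℂ) else 0)
    (a : Matrix Y Y ℂ) : colMap ι x a = 0 ↔ a * q = 0 := by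
  have hentry : ∀ y, (ι (star a * a)) y y = ∑ z, (Complex.normSq (ι a z y) : ℂ) := by
    intro y
    rw [map_mul, map_star, Matrix.mul_apply]
    refine Finset.sum_congr rfl fun z _ => ?_
    rw [Matrix.star_apply, Complex.normSq_eq_conj_mul_self]; rfl
  constructor
  · intro h
    apply hinj
    rw [map_mul, hq, map_zero]
    ext z y
    rw [Matrix.mul_diagonal]
    split_ifs with hy
    · have h1 : Matrix.diag (ι (star a * a)) ∈ diagFunctions ι := hΔ (star a * a)
      have h2 := hy _ h1
      simp only [Matrix.diag_apply] at h2
      rw [hentry, hentry] at h2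
      have h3 : ∑ z, (Complex.normSq (ι a z x) : ℂ) = 0 :=
        Finset.sum_eq_zero fun z _ => by
          have : ι a z x = 0 := congrFun h z
          simp [this]
      rw [h3] at h2
      have h4 : ∑ z, Complex.normSq (ι a z y) = 0 := by exact_mod_cast h2
      have h5 := (Finset.sum_eq_zero_iff_of_nonneg fun z _ => Complex.normSq_nonneg _).1 h4 z
        (Finset.mem_univ z)
      simp [Complex.normSq_eq_zero.1 h5]
    · simp
  · intro h
    have h1 : ι a * ι q = 0 := by rw [← map_mul, h, map_zero]
    ext z
    have h2 := congrFun (congrFun h1 z) x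
    rw [hq, Matrix.mul_diagonal] at h2
    simpa [colMap_apply] using h2

/-- The map `colMap ι x` has the same kernel as right multiplication by the idempotent `q` of the
class of `x`, hence the same rank `|Y| * tr q`. The trace formula for `ι` turns `tr q` into the
class size over `L`. -/
theorem finrank_range_colMap (hΔ : ∀ a, ∃ b, ι b = Matrix.diagonal (Matrix.diag (ι a)))
    (L : ℕ) (hL : L ≠ 0) (htr : ∀ a, (ι a).trace = L * a.trace) (x : X)
    [DecidablePred fun y => ∀ f ∈ diagFunctions ι, f y = f x] :
    Module.finrank ℂ (colMap ι x).range * L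
      = Fintype.card Y * (Finset.univ.filter fun y => ∀ f ∈ diagFunctions ι, f y = f x).card := by
  have hinj := injective_of_trace ι L hL htr
  obtain ⟨q, hq⟩ : ∃ q, ι q = Matrix.diagonal
      fun y => if ∀ f ∈ diagFunctions ι, f y = f x then (1 : ℂ) else 0 :=
    indicator_mem (diagFunctions ι) x
  have hker : (colMap ι x).ker = (LinearMap.mulRight ℂ q).ker := by
    ext a
    simpa using colMap_eq_zero_iff ι hΔ hinj x q hq a
  have h1 := (colMap ι x).finrank_range_add_finrank_ker
  have h2 := (LinearMap.mulRight ℂ q).finrank_range_add_finrank_ker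
  rw [hker] at h1
  have h3 : Module.finrank ℂ (colMap ι x).range
      = Module.finrank ℂ (LinearMap.mulRight ℂ q).range := by omega
  have hqq : q * q = q := by
    apply hinj
    rw [map_mul, hq, Matrix.diagonal_mul_diagonal]
    congr 1; ext y; split_ifs <;> simp
  have h4 := finrank_range_mulRight q hqq
  have h5 := htr q
  rw [hq, Matrix.trace_diagonal] at h5
  rw [Finset.sum_boole] at h5
  have : ((Module.finrank ℂ (colMap ι x).range * L : ℕ) : ℂ)
      = (Fintype.card Y * (Finset.univ.filter fun y => ∀ f ∈ diagFunctions ι, f y = f x).card : ℕ)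
      := by
    push_cast
    rw [h3, h4, h5]; ring
  exact_mod_cast this

theorem range_colMap_le_of_single_mem {x y : X} (h : Pi.single y 1 ∈ (colMap ι x).range) :
    (colMap ι y).range ≤ (colMap ι x).range := by
  obtain ⟨b, hb⟩ := h
  rintro _ ⟨a, rfl⟩
  refine ⟨a * b, ?_⟩
  rw [colMap_mul, hb]
  ext z; simp [colMap_apply]

theorem single_mem_range_colMap_self (x : X) : Pi.single x 1 ∈ (colMap ι x).range := by
  refine ⟨1, ?_⟩
  ext y
  rw [colMap_apply, map_one, Matrix.one_apply, Pi.single_apply]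

theorem colMap_of_monomial {a : Matrix Y Y ℂ} (ha : IsMonomial (ι a)) {x y : X}
    (h : ι a y x ≠ 0) : colMap ι x a = ι a y x • Pi.single y 1 := by
  ext z
  rw [colMap_apply, Pi.smul_apply, Pi.single_apply]
  split_ifs with hz
  · rw [hz]; simp
  · by_contra hne
    exact hz (ha.1 x z y (by simpa using hne) h)

/-- A monomial `ι a` maps `e_x` to a non-zero multiple of `e_y`, so one cyclic subspace contains the
other; the adjoint gives the reverse inclusion. -/
theorem range_colMap_eq_of_monomial {a : Matrix Y Y ℂ} (ha : IsMonomial (ι a)) {x y : X}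
    (h : ι a y x ≠ 0) : (colMap ι y).range = (colMap ι x).range := by
  have aux : ∀ {a : Matrix Y Y ℂ} (_ : IsMonomial (ι a)) {x y : X} (_ : ι a y x ≠ 0),
      (colMap ι y).range ≤ (colMap ι x).range := by
    intro a ha x y h
    apply range_colMap_le_of_single_mem
    refine ⟨(ι a y x)⁻¹ • a, ?_⟩
    rw [map_smul, colMap_of_monomial ι ha h, smul_smul, inv_mul_cancel₀ h, one_smul]
  refine le_antisymm (aux ha h) (aux (a := star a) ?_ ?_)
  · rw [map_star]; exact ha.star
  · rw [map_star, Matrix.star_apply]; simpa using h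

/-- Monomial elements span the algebra and carry `e_x` to multiples of basis vectors with the same
cyclic subspace. That subspace is therefore a coordinate subspace, and its dimension can be counted.
-/
theorem range_colMap_eq_span (hspan : ⊤ ≤ Submodule.span ℂ {a | IsMonomial (ι a)}) (x : X) :
    (colMap ι x).range = Submodule.span ℂ
      (Set.range fun y : {y // (colMap ι y).range = (colMap ι x).range} =>
        (Pi.single y.1 1 : X → ℂ)) := by
  apply le_antisymm
  · have h1 : (colMap ι x).range
        = Submodule.span ℂ (colMap ι x '' {a | IsMonomial (ι a)}) := by
      rw [LinearMap.range_eq_map, ← top_le_iff.1 hspan, Submodule.map_span]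
    refine h1.trans_le (Submodule.span_le.2 ?_)
    rintro _ ⟨a, ha, rfl⟩
    by_cases h : ∃ y, ι a y x ≠ 0
    · obtain ⟨y, hy⟩ := h
      rw [colMap_of_monomial ι ha hy]
      exact Submodule.smul_mem _ _ (Submodule.subset_span
        ⟨⟨y, range_colMap_eq_of_monomial ι ha hy⟩, rfl⟩)
    · push Not at h
      have : colMap ι x a = 0 := by ext y; exact h y
      rw [this]; exact zero_mem _
  · rw [Submodule.span_le]
    rintro _ ⟨⟨y, hy⟩, rfl⟩
    change Pi.single y 1 ∈ (colMap ι x).range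
    rw [← hy]
    exact single_mem_range_colMap_self ι y

theorem finrank_range_colMap_eq_card [DecidableEq (Submodule ℂ (X → ℂ))]
    (hspan : ⊤ ≤ Submodule.span ℂ {a | IsMonomial (ι a)}) (x : X) :
    Module.finrank ℂ (colMap ι x).range
      = (Finset.univ.filter fun y => (colMap ι y).range = (colMap ι x).range).card := by
  refine (congrArg (fun V : Submodule ℂ (X → ℂ) => Module.finrank ℂ V)
    (range_colMap_eq_span ι hspan x)).trans ?_
  rw [finrank_span_eq_card, Fintype.card_subtype]
  have h := (Pi.basisFun ℂ X).linearIndependent.comp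
    (fun y : {y // (colMap ι y).range = (colMap ι x).range} => y.1) Subtype.val_injective
  convert h using 2
  simp

/-- The two partitions cross: since `M_Y` is simple, the projection of the class of `z` cannot
annihilate the whole cyclic subspace of `e_x`. This makes the size relation available for every pair
of classes. -/
theorem exists_mem_fibre_inter (hspan : ⊤ ≤ Submodule.span ℂ {a | IsMonomial (ι a)}) (x z : X) :
    ∃ y, (∀ f ∈ diagFunctions ι, f y = f z) ∧ (colMap ι y).range = (colMap ι x).range := by
  classical
  obtain ⟨q, hq⟩ : ∃ q, ι q = Matrix.diagonal
      fun y => if ∀ f ∈ diagFunctions ι, f y = f z then (1 : ℂ) else 0 :=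
    indicator_mem (diagFunctions ι) z
  by_contra hcon
  push Not at hcon
  have h0 : ∀ a, colMap ι x (q * a) = 0 := by
    intro a
    have ha : a ∈ Submodule.span ℂ {a | IsMonomial (ι a)} := hspan trivial
    induction ha using Submodule.span_induction with
    | mem a ha =>
      ext y
      rw [colMap_apply, map_mul, hq, Matrix.diagonal_mul]
      split_ifs with hy
      · rw [one_mul]
        by_contra hne
        exact hcon y hy (range_colMap_eq_of_monomial ι ha hne)
      · simp
    | zero => simp
    | add a b _ _ ha hb => rw [mul_add, map_add, ha, hb, add_zero]
    | smul c a _ ha => rw [mul_smul_comm, map_smul, ha, smul_zero]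
  have hq0 : q ≠ 0 := by
    rintro rfl
    have := congrFun (congrFun hq z) z
    simp at this
  obtain ⟨i, j, hij⟩ : ∃ i j, q i j ≠ 0 := by
    by_contra h; push Not at h; exact hq0 (by ext i j; exact h i j)
  -- Simplicity made explicit: a non-zero entry `q i j` produces a multiple of `1` in the ideal
  -- generated by `q`.
  have h1 : ∑ k, Matrix.single k i 1 * (q * Matrix.single j k 1) = q i j • (1 : Matrix Y Y ℂ) := by
    have : ∀ k, Matrix.single k i 1 * (q * Matrix.single j k 1) = Matrix.single k k (q i j) := by
      intro k
      rw [← mul_assoc, Matrix.single_mul_mul_single]; simp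
    simp only [this]
    ext s t
    rw [Matrix.sum_apply]
    simp [Matrix.single_apply, Matrix.one_apply, ite_and]
  have h2 : colMap ι x (q i j • (1 : Matrix Y Y ℂ)) = 0 := by
    rw [← h1, map_sum]
    refine Finset.sum_eq_zero fun k _ => ?_
    rw [colMap_mul, h0]; simp
  have h3 := congrFun h2 x
  rw [map_smul, Pi.smul_apply, colMap_apply, map_one] at h3
  simp [hij] at h3

/-- By `indicator_mem` these are all the functions constant on the classes. The map `f` labels each
class, so the dimension is the number of labels. -/
theorem finrank_diagFunctions (f : X → Finset X)
    (hf : ∀ x y, f x = f y ↔ ∀ g ∈ diagFunctions ι, g y = g x) :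
    Module.finrank ℂ (diagFunctions ι) = (Finset.univ.image f).card := by
  classical
  let T : (↥(Finset.univ.image f) → ℂ) →ₗ[ℂ] (X → ℂ) :=
    LinearMap.funLeft ℂ ℂ fun x => ⟨f x, Finset.mem_image_of_mem f (Finset.mem_univ x)⟩
  have hT : Function.Injective T := by
    apply LinearMap.funLeft_injective_of_surjective
    rintro ⟨_, hz⟩
    obtain ⟨x, -, rfl⟩ := Finset.mem_image.1 hz
    exact ⟨x, rfl⟩
  have hr : T.range = Subalgebra.toSubmodule (diagFunctions ι) := by
    apply le_antisymm
    · rintro _ ⟨g, rfl⟩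
      have hx : ∀ z : ↥(Finset.univ.image f), ∃ x, f x = z.1 := fun z => by
        obtain ⟨x, -, hx⟩ := Finset.mem_image.1 z.2; exact ⟨x, hx⟩
      choose s hs using hx
      have : T g = ∑ z, g z •
          (fun y => if ∀ h ∈ diagFunctions ι, h y = h (s z) then (1 : ℂ) else 0) := by
        ext y
        rw [Finset.sum_apply,
          Finset.sum_eq_single ⟨f y, Finset.mem_image_of_mem f (Finset.mem_univ y)⟩]
        · have h1 : ∀ h ∈ diagFunctions ι,
              h y = h (s ⟨f y, Finset.mem_image_of_mem f (Finset.mem_univ y)⟩) :=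
            (hf _ _).1 (hs _)
          rw [Pi.smul_apply, if_pos h1]
          simp [T, LinearMap.funLeft_apply]
        · intro z _ hz
          have h1 : ¬ ∀ h ∈ diagFunctions ι, h y = h (s z) := by
            intro h
            apply hz
            apply Subtype.ext
            rw [← hs z]
            exact (hf _ _).2 h
          rw [Pi.smul_apply, if_neg h1, smul_zero]
        · simp
      rw [this]
      exact sum_mem fun z _ => (diagFunctions ι).smul_mem (indicator_mem _ _) _
    · intro g hg
      have hx : ∀ z : ↥(Finset.univ.image f), ∃ x, f x = z.1 := fun z => by
        obtain ⟨x, -, hx⟩ := Finset.mem_image.1 z.2; exact ⟨x, hx⟩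
      choose s hs using hx
      refine ⟨fun z => g (s z), ?_⟩
      ext y
      exact ((hf _ _).1 (hs ⟨f y, Finset.mem_image_of_mem f (Finset.mem_univ y)⟩) g hg).symm
  change Module.finrank ℂ (Subalgebra.toSubmodule (diagFunctions ι)) = _
  rw [← hr, LinearMap.finrank_range_of_inj hT, Module.finrank_fintype_fun_eq_card,
    Fintype.card_coe]

/-- If the compression to the diagonal preserves the range of `ι`, this range is spanned by
monomial matrices, and `M_Y` has multiplicity `L` prime to its size, then the diagonal matrices
in the range of `ι` form a subspace of maximal dimension. -/
theorem finrank_diagFunctions_eq_card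
    (hΔ : ∀ a, ∃ b, ι b = Matrix.diagonal (Matrix.diag (ι a)))
    (hspan : ⊤ ≤ Submodule.span ℂ {a | IsMonomial (ι a)})
    (L : ℕ) (hL : L ≠ 0) (htr : ∀ a, (ι a).trace = L * a.trace)
    (hX : Fintype.card X = Fintype.card Y * L) [Nonempty X]
    (hcop : Nat.Coprime (Fintype.card Y) L) :
    Module.finrank ℂ (diagFunctions ι) = Fintype.card Y := by
  classical
  let f : X → Finset X := fun x => Finset.univ.filter fun y => ∀ g ∈ diagFunctions ι, g y = g x
  have hf : ∀ x y, f x = f y ↔ ∀ g ∈ diagFunctions ι, g y = g x := by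
    intro x y
    constructor
    · intro h
      have : y ∈ f x := by rw [h]; simp [f]
      simpa [f] using this
    · intro h
      ext z
      simp only [f, Finset.mem_filter, Finset.mem_univ, true_and]
      exact forall₂_congr fun g hg => by rw [h g hg]
  let V : X → Submodule ℂ (X → ℂ) := fun x => (colMap ι x).range
  -- The dimension of a cyclic subspace, computed once by counting basis vectors and once by the
  -- trace. Since `x` and `z` are independent, all classes of each partition have equal size.
  have hrel : ∀ x z, (Finset.univ.filter fun y => V y = V x).card * L
      = Fintype.card Y * (f z).card := by
    intro x z
    obtain ⟨y, hy1, hy2⟩ := exists_mem_fibre_inter ι hspan x z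
    have h1 := finrank_range_colMap ι hΔ L hL htr y
    rw [finrank_range_colMap_eq_card ι hspan y] at h1
    have h2 : f z = f y := (hf z y).2 hy1
    rw [h2]
    simp only [V]
    simp only [hy2] at h1
    exact h1
  have hK : Fintype.card Y ≠ 0 := by
    intro h; rw [h, zero_mul] at hX; exact Fintype.card_ne_zero hX
  obtain ⟨x0⟩ := ‹Nonempty X›
  set β := (f x0).card with hβ
  set ω := (Finset.univ.filter fun y => V y = V x0).card with hω
  have hβx : ∀ x, (f x).card = β := fun x =>
    Nat.eq_of_mul_eq_mul_left (Nat.pos_of_ne_zero hK) ((hrel x0 x).symm.trans (hrel x0 x0))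
  have hωx : ∀ x, (Finset.univ.filter fun y => V y = V x).card = ω := fun x =>
    Nat.eq_of_mul_eq_mul_right (Nat.pos_of_ne_zero hL) ((hrel x x0).trans (hrel x0 x0).symm)
  have hk := card_eq_mul_of_fibre f β fun x => by
    rw [← hβx x]
    congr 1
    ext y
    simp only [Finset.mem_filter, Finset.mem_univ, true_and, f]
    exact eq_comm.trans (hf x y)
  have hc := card_eq_mul_of_fibre V ω hωx
  rw [finrank_diagFunctions ι f hf]
  have h0 := hrel x0 x0
  rw [hX] at hk hc
  change ω * L = _ * β at h0
  generalize (Finset.univ.image f).card = k at *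
  generalize (Finset.univ.image V).card = c at *
  generalize Fintype.card Y = K at *
  -- From `ω * L = K * β` and coprimality, `β = L * r`. The class counts then give `K = k * r` and
  -- `L = c * r`, so `r` divides the gcd and equals `1`.
  obtain ⟨r, hr⟩ : L ∣ β := hcop.symm.dvd_of_dvd_mul_left (h0 ▸ Dvd.intro_left ω rfl)
  have h1 : K = k * r :=
    Nat.eq_of_mul_eq_mul_right (Nat.pos_of_ne_zero hL) (by rw [hk, hr]; ring)
  have h2 : ω = K * r :=
    Nat.eq_of_mul_eq_mul_right (Nat.pos_of_ne_zero hL) (by rw [h0, hr]; ring)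
  have h3 : L = c * r :=
    Nat.eq_of_mul_eq_mul_left (Nat.pos_of_ne_zero hK) (by rw [hc, h2]; ring)
  have h4 : r ∣ Nat.gcd K L := Nat.dvd_gcd ⟨k, by rw [h1]; ring⟩ ⟨c, by rw [h3]; ring⟩
  rw [hcop] at h4
  rw [h1, Nat.dvd_one.1 h4, mul_one]

end Commuting

open scoped unitInterval

/-! ### Maximal abelian subalgebras contain their relative commutant. -/

section MASA

variable {A : Type*} [CStarAlgebra A] {B : StarSubalgebra ℂ A}

theorem IsMASA.mul_comm (hB : IsMASA B) {a b : A} (ha : a ∈ B) (hb : b ∈ B) : a * b = b * a :=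
  hB.1.2 a ha b hb

theorem IsMASA.isClosed (hB : IsMASA B) : IsClosed (B : Set A) := hB.1.1

/-- The bicommutant of `B ∪ {h}` is a closed commutative star subalgebra, so maximality puts it
inside `B`. -/
theorem IsMASA.mem_of_isSelfAdjoint (hB : IsMASA B) {h : A} (hh : IsSelfAdjoint h)
    (hc : ∀ b ∈ B, b * h = h * b) : h ∈ B := by
  let s : Set A := B ∪ {h}
  have hs : ∀ a ∈ s, ∀ b ∈ s, a * b = b * a := by
    rintro a (ha | rfl) b (hb | rfl)
    · exact hB.mul_comm ha hb
    · exact hc a ha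
    · exact (hc b hb).symm
    · rfl
  have hstar : star s = s := by
    ext a
    simp only [s, Set.mem_star, Set.mem_union, SetLike.mem_coe, Set.mem_singleton_iff, star_mem_iff]
    exact or_congr_right ⟨fun h' => by rw [← star_star a, h', hh.star_eq],
      fun h' => by rw [h', hh.star_eq]⟩
  let C : StarSubalgebra ℂ A :=
    StarSubalgebra.centralizer ℂ (StarSubalgebra.centralizer ℂ s : Set A)
  have hsC : s ⊆ C := fun a ha => by
    rw [SetLike.mem_coe, StarSubalgebra.mem_centralizer_iff]
    intro g hg
    rw [SetLike.mem_coe, StarSubalgebra.mem_centralizer_iff] at hg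
    exact ⟨((hg a ha).1).symm, by
      have := congrArg star (hg a ha).2
      simpa using this⟩
  have hCs : ∀ c ∈ C, ∀ d ∈ C, c * d = d * c := by
    have h1 : ∀ c ∈ C, c ∈ StarSubalgebra.centralizer ℂ s := by
      intro c hc'
      rw [StarSubalgebra.mem_centralizer_iff] at hc' ⊢
      intro g hg
      apply hc'
      rw [SetLike.mem_coe, StarSubalgebra.mem_centralizer_iff]
      intro k hk
      have hg' : star g ∈ s := by rw [← Set.mem_star, hstar]; exact hg
      have hk' : star k ∈ s := by rw [← Set.mem_star, hstar]; exact hk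
      exact ⟨hs _ hk _ hg, hs _ hk' _ hg⟩
    intro c hc' d hd
    rw [StarSubalgebra.mem_centralizer_iff] at hd
    exact (hd c (h1 c hc')).1
  have hclosed : IsClosed (C : Set A) := by
    rw [StarSubalgebra.coe_centralizer]
    exact Set.isClosed_centralizer _
  exact hB.2 ⟨hclosed, hCs⟩ (fun b hb => hsC (Or.inl hb)) (hsC (Or.inr rfl))

theorem IsMASA.mem_of_commute (hB : IsMASA B) {x : A} (hc : ∀ b ∈ B, b * x = x * b) : x ∈ B := by
  have hc' : ∀ b ∈ B, b * star x = star x * b := fun b hb => by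
    have := congrArg star (hc (star b) (star_mem hb))
    simpa using this.symm
  rw [← realPart_add_I_smul_imaginaryPart x]
  refine add_mem (hB.mem_of_isSelfAdjoint (realPart x).2 fun b hb => ?_)
    (B.smul_mem (hB.mem_of_isSelfAdjoint (imaginaryPart x).2 fun b hb => ?_) _)
  · rw [realPart_apply_coe, mul_smul_comm, smul_mul_assoc, mul_add, add_mul, hc b hb, hc' b hb]
  · rw [imaginaryPart_apply_coe, mul_smul_comm, mul_smul_comm, smul_mul_assoc, smul_mul_assoc,
      mul_sub, sub_mul, hc b hb, hc' b hb]

end MASA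

/-! ### Evaluations, scalar functions and matrix entries. -/

section Functions

variable {m n o : ℕ}

/-- The evaluation of `I_{m,n,o}` at a point. -/
def evalHom (m n o : ℕ) (t : I) : dimDrop m n o →⋆ₐ[ℂ] Mat3 m n o where
  toFun f := f.1 t
  map_one' := rfl
  map_mul' _ _ := rfl
  map_zero' := rfl
  map_add' _ _ := rfl
  commutes' _ := rfl
  map_star' _ := rfl

theorem evalHom_apply (t : I) (f : dimDrop m n o) : evalHom m n o t f = f.1 t := rfl

theorem continuous_evalHom (t : I) : Continuous (evalHom m n o t) :=
  (continuous_eval_const t).comp continuous_subtype_val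

@[ext]
theorem dimDrop_ext {f g : dimDrop m n o} (h : ∀ t, evalHom m n o t f = evalHom m n o t g) :
    f = g :=
  Subtype.ext (ContinuousMap.ext h)

/-- The scalar functions, which form the centre of `I_{m,n,o}`. -/
def scalarHom (m n o : ℕ) : C(I, ℂ) →ₐ[ℂ] dimDrop m n o where
  toFun g := ⟨⟨fun t => algebraMap ℂ (Mat3 m n o) (g t), by fun_prop⟩,
    ⟨algebraMap_mem _ (g 0), algebraMap_mem _ (g 1)⟩⟩
  map_one' := by ext t : 1; exact (algebraMap ℂ (Mat3 m n o)).map_one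
  map_mul' f g := by ext t : 1; exact (algebraMap ℂ (Mat3 m n o)).map_mul _ _
  map_zero' := by ext t : 1; exact (algebraMap ℂ (Mat3 m n o)).map_zero
  map_add' f g := by ext t : 1; exact (algebraMap ℂ (Mat3 m n o)).map_add _ _
  commutes' c := by ext t : 1; rfl

@[simp]
theorem evalHom_scalarHom (t : I) (g : C(I, ℂ)) :
    evalHom m n o t (scalarHom m n o g) = algebraMap ℂ _ (g t) := rfl

theorem scalarHom_comm (g : C(I, ℂ)) (f : dimDrop m n o) :
    scalarHom m n o g * f = f * scalarHom m n o g := by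
  ext t : 1
  simp only [map_mul, evalHom_scalarHom]
  exact Algebra.commutes _ _

theorem evalHom_scalarHom_mul (t : I) (g : C(I, ℂ)) (f : dimDrop m n o) :
    evalHom m n o t (scalarHom m n o g * f) = g t • evalHom m n o t f := by
  rw [map_mul, evalHom_scalarHom, Algebra.smul_def]

/-- The function `t (1 - t)`. -/
def bump : C(I, ℂ) := ⟨fun t => ((t : ℝ) : ℂ) * (1 - ((t : ℝ) : ℂ)), by fun_prop⟩

theorem bump_apply (t : I) : bump t = ((t : ℝ) : ℂ) * (1 - ((t : ℝ) : ℂ)) := rfl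

@[simp] theorem bump_zero : bump 0 = 0 := by simp [bump_apply]

@[simp] theorem bump_one : bump 1 = 0 := by simp [bump_apply]

theorem bump_ne_zero {t : I} (h0 : t ≠ 0) (h1 : t ≠ 1) : bump t ≠ 0 := by
  rw [bump_apply]
  refine mul_ne_zero ?_ ?_
  · simpa using h0
  · rw [sub_ne_zero]
    intro h
    apply h1
    have : (1 : ℝ) = t := by exact_mod_cast h
    exact Subtype.ext this.symm

/-- A continuous matrix-valued function that vanishes at the end points. -/
def ofVanishing (G : C(I, Mat3 m n o)) (h0 : G 0 = 0) (h1 : G 1 = 0) : dimDrop m n o :=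
  ⟨G, by rw [h0]; exact zero_mem _, by rw [h1]; exact zero_mem _⟩

/-- The function `t ↦ t (1 - t) x`. -/
def bumpConst (x : Mat3 m n o) : dimDrop m n o :=
  ofVanishing ⟨fun t => bump t • x, by fun_prop⟩ (by simp) (by simp)

@[simp]
theorem evalHom_bumpConst (t : I) (x : Mat3 m n o) :
    evalHom m n o t (bumpConst x) = bump t • x := rfl

/-- The matrix entries of a function. -/
def entryFun (f : dimDrop m n o) (p q : Fin m × Fin n × Fin o) : C(I, ℂ) :=
  ⟨fun t => evalHom m n o t f p q, by
    have : Continuous fun t => evalHom m n o t f := f.1.continuous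
    exact this.matrix_elem p q⟩

theorem entryFun_apply (f : dimDrop m n o) (p q : Fin m × Fin n × Fin o) (t : I) :
    entryFun f p q t = evalHom m n o t f p q := rfl

/-- The fibre of a subalgebra, as a subalgebra. -/
def fibreAlg (B : StarSubalgebra ℂ (dimDrop m n o)) (t : I) : StarSubalgebra ℂ (Mat3 m n o) :=
  B.map (evalHom m n o t)

theorem scalarHom_mem {B : StarSubalgebra ℂ (dimDrop m n o)} (hB : IsMASA B) (g : C(I, ℂ)) :
    scalarHom m n o g ∈ B :=
  hB.mem_of_commute fun b _ => (scalarHom_comm g b).symm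

theorem fibreAlg_comm {B : StarSubalgebra ℂ (dimDrop m n o)} (hB : IsMASA B) (t : I) :
    ∀ a ∈ fibreAlg B t, ∀ b ∈ fibreAlg B t, a * b = b * a := by
  rintro _ ⟨a, ha, rfl⟩ _ ⟨b, hb, rfl⟩
  change evalHom m n o t a * evalHom m n o t b = evalHom m n o t b * evalHom m n o t a
  rw [← map_mul, hB.mul_comm ha hb, map_mul]

theorem single_expansion (x : Mat3 m n o) :
    x = ∑ p, ∑ q, x p q • Matrix.single p q (1 : ℂ) := by
  conv_lhs => rw [Matrix.matrix_eq_sum_single x]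
  refine Finset.sum_congr rfl fun p _ => Finset.sum_congr rfl fun q _ => ?_
  rw [Matrix.smul_single, smul_eq_mul, mul_one]

/-- Constant matrix units need not satisfy the boundary conditions, but their multiples by `bump`
do. Up to a factor invertible in the interior, every element is thus a combination of finitely many
fixed elements with scalar functions as coefficients. -/
theorem bump_sq_mul (f : dimDrop m n o) :
    scalarHom m n o bump * (scalarHom m n o bump * f)
      = ∑ p, ∑ q, scalarHom m n o (bump * entryFun f p q) * bumpConst (Matrix.single p q 1) := by
  ext t : 1
  simp only [evalHom_scalarHom_mul, map_sum, evalHom_bumpConst, ContinuousMap.mul_apply,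
    entryFun_apply]
  conv_lhs => rw [single_expansion (evalHom m n o t f)]
  simp only [Finset.smul_sum, smul_smul]
  refine Finset.sum_congr rfl fun p _ => Finset.sum_congr rfl fun q _ => ?_
  congr 1; ring

end Functions

/-! ### The conditional expectation at interior points. -/

section Expectation

variable {m n o : ℕ} {B : StarSubalgebra ℂ (dimDrop m n o)}
  {E : dimDrop m n o →ₗ[ℂ] dimDrop m n o}

theorem IsConditionalExpectation.mul_left {A : Type*} [CStarAlgebra A] {B : StarSubalgebra ℂ A}
    {E : A →ₗ[ℂ] A} (hE : IsConditionalExpectation B E) {b : A} (hb : b ∈ B) (x : A) :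
    E (b * x) = b * E x := by
  have := hE.bimodule b hb 1 (one_mem B) x
  simpa using this

theorem bump_sq_smul_evalHom (hB : IsMASA B) (hE : IsConditionalExpectation B E)
    (f : dimDrop m n o) (t : I) :
    (bump t * bump t) • evalHom m n o t (E f)
      = ∑ p, ∑ q, (bump t * evalHom m n o t f p q) •
          evalHom m n o t (E (bumpConst (Matrix.single p q 1))) := by
  have h := congrArg (fun g => evalHom m n o t (E g)) (bump_sq_mul f)
  simp only [map_sum, hE.mul_left (scalarHom_mem hB _), evalHom_scalarHom_mul, smul_smul,
    ContinuousMap.mul_apply, entryFun_apply] at h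
  exact h

/-- `E` is linear over the scalar functions, which lie in `B`; by `bump_sq_mul` it acts fibrewise in
the interior. -/
theorem expectation_congr (hB : IsMASA B) (hE : IsConditionalExpectation B E)
    {f g : dimDrop m n o} {t : I} (h0 : t ≠ 0) (h1 : t ≠ 1)
    (h : evalHom m n o t f = evalHom m n o t g) :
    evalHom m n o t (E f) = evalHom m n o t (E g) := by
  have hf := bump_sq_smul_evalHom hB hE f t
  rw [h, ← bump_sq_smul_evalHom hB hE g t] at hf
  exact smul_right_injective _ (mul_ne_zero (bump_ne_zero h0 h1) (bump_ne_zero h0 h1)) hf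

/-- A function with values in the relative commutant of `B`, obtained by contracting the
conditional expectation with the flip. -/
def flipSum (E : dimDrop m n o →ₗ[ℂ] dimDrop m n o) (x : Mat3 m n o) : dimDrop m n o :=
  ∑ p, ∑ q, E (bumpConst (Matrix.single p q 1)) * bumpConst (x * Matrix.single q p 1)

/-- The entries of `b` are scalar functions and pass through `E`. Multiplying by `b` on either side
gives the same triple sum up to exchanging `p` and `c`, so the sum commutes with `B` and maximality
applies. -/
theorem flipSum_mem (hB : IsMASA B) (hE : IsConditionalExpectation B E) (x : Mat3 m n o) :
    flipSum E x ∈ B := by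
  apply hB.mem_of_commute
  intro b hb
  have h1 : ∀ p q, b * bumpConst (Matrix.single p q 1)
      = ∑ c, scalarHom m n o (entryFun b c p) * bumpConst (Matrix.single c q 1) := by
    intro p q
    ext t : 1
    simp only [map_mul, evalHom_bumpConst, map_sum, evalHom_scalarHom, entryFun_apply,
      ← Algebra.smul_def, mul_smul_comm]
    simp only [← Finset.smul_sum]
    congr 1
    ext i j
    simp [Matrix.mul_apply, Matrix.sum_apply, Matrix.single_apply, ite_and, Finset.sum_ite_eq]
  have h2 : ∀ p q, bumpConst (x * Matrix.single q p 1) * b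
      = ∑ c, scalarHom m n o (entryFun b p c) * bumpConst (x * Matrix.single q c 1) := by
    intro p q
    ext t : 1
    simp only [map_mul, evalHom_bumpConst, map_sum, evalHom_scalarHom, entryFun_apply,
      ← Algebra.smul_def, smul_mul_assoc]
    simp only [smul_comm (_ : ℂ) (bump t), ← Finset.smul_sum]
    congr 1
    simp only [← mul_smul_comm, ← Finset.mul_sum, mul_assoc]
    congr 1
    ext i j
    simp [Matrix.mul_apply, Matrix.sum_apply, Matrix.single_apply, ite_and, Finset.sum_ite_eq]
  have h3 : b * flipSum E x = ∑ p, ∑ q, ∑ c, scalarHom m n o (entryFun b c p) *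
      (E (bumpConst (Matrix.single c q 1)) * bumpConst (x * Matrix.single q p 1)) := by
    simp only [flipSum, Finset.mul_sum]
    refine Finset.sum_congr rfl fun p _ => Finset.sum_congr rfl fun q _ => ?_
    rw [← mul_assoc, ← hE.mul_left hb, h1, map_sum, Finset.sum_mul]
    refine Finset.sum_congr rfl fun c _ => ?_
    rw [hE.mul_left (scalarHom_mem hB _), mul_assoc]
  have h4 : flipSum E x * b = ∑ p, ∑ q, ∑ c, scalarHom m n o (entryFun b p c) *
      (E (bumpConst (Matrix.single p q 1)) * bumpConst (x * Matrix.single q c 1)) := by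
    simp only [flipSum, Finset.sum_mul]
    refine Finset.sum_congr rfl fun p _ => Finset.sum_congr rfl fun q _ => ?_
    rw [mul_assoc, h2, Finset.mul_sum]
    refine Finset.sum_congr rfl fun c _ => ?_
    rw [← mul_assoc, ← scalarHom_comm, mul_assoc]
  rw [h3, h4]
  calc _ = ∑ p, ∑ c, ∑ q, scalarHom m n o (entryFun b c p) *
      (E (bumpConst (Matrix.single c q 1)) * bumpConst (x * Matrix.single q p 1)) :=
        Finset.sum_congr rfl fun p _ => Finset.sum_comm
    _ = ∑ c, ∑ p, ∑ q, scalarHom m n o (entryFun b c p) *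
      (E (bumpConst (Matrix.single c q 1)) * bumpConst (x * Matrix.single q p 1)) :=
        Finset.sum_comm
    _ = _ := Finset.sum_congr rfl fun c _ => Finset.sum_comm

/-- Write `F` for `flipSum E` at `t`. Since `c` commutes with the values of `E`, `c F(x) = F(c x)`;
since `d` commutes with the values of `F`, `(cd - dc) F(x) = 0` for all `x`. The values of `F` are
rich enough to force `cd = dc`. -/
theorem commutant_fibre_comm (hB : IsMASA B) (hE : IsConditionalExpectation B E) {t : I}
    (h0 : t ≠ 0) (h1 : t ≠ 1) (c d : Mat3 m n o) (hc : ∀ a ∈ fibreAlg B t, a * c = c * a)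
    (hd : ∀ a ∈ fibreAlg B t, a * d = d * a) : c * d = d * c := by
  have hw := bump_ne_zero h0 h1
  have hF : ∀ x, evalHom m n o t (flipSum E x) ∈ fibreAlg B t := fun x =>
    ⟨_, flipSum_mem hB hE x, rfl⟩
  have hval : ∀ x, evalHom m n o t (flipSum E x) = bump t • ∑ p, ∑ q,
      evalHom m n o t (E (bumpConst (Matrix.single p q 1))) * (x * Matrix.single q p 1) := by
    intro x
    simp only [flipSum, map_sum, map_mul, evalHom_bumpConst, mul_smul_comm, Finset.smul_sum]
  have hEF : ∀ x, evalHom m n o t (E x) ∈ fibreAlg B t := fun x => ⟨_, hE.mem x, rfl⟩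
  have hcx : ∀ x, c * evalHom m n o t (flipSum E x) = evalHom m n o t (flipSum E (c * x)) := by
    intro x
    rw [hval, hval, mul_smul_comm, Finset.mul_sum]
    congr 1
    refine Finset.sum_congr rfl fun p _ => ?_
    rw [Finset.mul_sum]
    refine Finset.sum_congr rfl fun q _ => ?_
    rw [← mul_assoc, ← hc _ (hEF _), mul_assoc, mul_assoc]
  have hzero : ∀ x, (c * d - d * c) * evalHom m n o t (flipSum E x) = 0 := by
    intro x
    rw [sub_mul, mul_assoc, mul_assoc, ← hd _ (hF x), hcx, ← hd _ (hF (c * x)), ← hcx, mul_assoc,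
      sub_self]
  -- With `x` the matrix unit at `(g, h)`, column `a` of the flip sum is, up to `bump t`, column `g`
  -- of `E` applied to the unit at `(a, h)`.
  have hzero' : ∀ a h, (c * d - d * c) *
      evalHom m n o t (E (bumpConst (Matrix.single a h 1))) = 0 := by
    intro a h
    ext i g
    have h2 := hzero (Matrix.single g h 1)
    rw [hval, mul_smul_comm] at h2
    have h3 := (smul_eq_zero_iff_right hw).1 h2
    have h4 := congrFun (congrFun h3 i) a
    simp only [Finset.mul_sum, ← mul_assoc, Matrix.sum_apply] at h4
    rw [Finset.sum_eq_single a, Finset.sum_eq_single h] at h4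
    · rwa [Matrix.mul_single_apply_same, mul_one, Matrix.mul_single_apply_same, mul_one] at h4
    · intro q _ hq
      rw [mul_assoc, Matrix.single_mul_single_of_ne _ _ _ _ (Ne.symm hq)]; simp
    · simp
    · intro p _ hp
      refine Finset.sum_eq_zero fun q _ => ?_
      rw [Matrix.mul_single_apply_of_ne]
      exact Ne.symm hp
    · simp
  have hone : ∑ p, E (bumpConst (Matrix.single p p 1)) = scalarHom m n o bump := by
    have : ∑ p, bumpConst (Matrix.single p p 1) = scalarHom m n o bump := by
      ext t : 1
      rw [map_sum, evalHom_scalarHom, Algebra.algebraMap_eq_smul_one, ← Matrix.sum_single_one,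
        Finset.smul_sum]
      rfl
    rw [← map_sum, this, hE.apply_of_mem _ (scalarHom_mem hB _)]
  have h5 : (c * d - d * c) * evalHom m n o t (scalarHom m n o bump) = 0 := by
    rw [← hone, map_sum, Finset.mul_sum]
    exact Finset.sum_eq_zero fun p _ => hzero' p p
  rw [evalHom_scalarHom, Algebra.algebraMap_eq_smul_one, mul_smul_comm, mul_one] at h5
  exact sub_eq_zero.1 ((smul_eq_zero_iff_right hw).1 h5)

theorem exists_unitary_fibre_interior (hB : IsMASA B) (hE : IsConditionalExpectation B E) {t : I}
    (h0 : t ≠ 0) (h1 : t ≠ 1) :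
    ∃ u ∈ Matrix.unitaryGroup (Fin m × Fin n × Fin o) ℂ,
      ∀ a, a ∈ fibreAlg B t ↔ (star u * a * u).IsDiag :=
  exists_unitary_mem_iff_of_commutant _ (fibreAlg_comm hB t)
    (commutant_fibre_comm hB hE h0 h1)

end Expectation

/-! ### Adapted orthonormal bases, including the endpoints. -/

section Frames

theorem IsMonomial.mul {X : Type*} [Fintype X] {a b : Matrix X X ℂ} (ha : IsMonomial a)
    (hb : IsMonomial b) : IsMonomial (a * b) := by
  have h : ∀ x y, (a * b) y x ≠ 0 → ∃ k, a y k ≠ 0 ∧ b k x ≠ 0 := by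
    intro x y h
    rw [Matrix.mul_apply] at h
    obtain ⟨k, -, hk⟩ := Finset.exists_ne_zero_of_sum_ne_zero h
    exact ⟨k, mul_ne_zero_iff.1 hk⟩
  refine ⟨fun x y z h1 h2 => ?_, fun x y z h1 h2 => ?_⟩
  · obtain ⟨k, hk1, hk2⟩ := h _ _ h1
    obtain ⟨l, hl1, hl2⟩ := h _ _ h2
    obtain rfl := hb.1 _ _ _ hk2 hl2
    exact ha.1 _ _ _ hk1 hl1
  · obtain ⟨k, hk1, hk2⟩ := h _ _ h1
    obtain ⟨l, hl1, hl2⟩ := h _ _ h2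
    obtain rfl := ha.2 _ _ _ hk1 hl1
    exact hb.2 _ _ _ hk2 hl2

theorem isMonomial_one {X : Type*} [DecidableEq X] : IsMonomial (1 : Matrix X X ℂ) := by
  refine ⟨fun x y z h1 h2 => ?_, fun x y z h1 h2 => ?_⟩ <;>
  · rw [Matrix.one_apply, Ne, ite_eq_right_iff, Classical.not_imp] at h1 h2
    first
    | exact h1.1.trans h2.1.symm
    | exact h1.1.symm.trans h2.1

theorem isCompact_unitaryGroup (X : Type*) [Fintype X] [DecidableEq X] :
    IsCompact (Matrix.unitaryGroup X ℂ : Set (Matrix X X ℂ)) := by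
  have : ProperSpace (Matrix X X ℂ) := FiniteDimensional.proper ℂ _
  refine Metric.isCompact_of_isClosed_isBounded ?_ ?_
  · have : (Matrix.unitaryGroup X ℂ : Set (Matrix X X ℂ)) = {u | u * star u = 1} := by
      ext u; exact Matrix.mem_unitaryGroup_iff
    rw [this]
    exact isClosed_eq (by fun_prop) continuous_const
  · refine (Metric.isBounded_iff_subset_closedBall 0).2 ⟨1, fun u hu => ?_⟩
    rw [mem_closedBall_zero_iff]
    have h : ‖u‖ * ‖u‖ = ‖(1 : Matrix X X ℂ)‖ := by
      rw [← CStarRing.norm_star_mul_self, (Matrix.mem_unitaryGroup_iff').1 hu]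
    have h1 : ‖(1 : Matrix X X ℂ)‖ ≤ 1 := by
      rcases subsingleton_or_nontrivial (Matrix X X ℂ) with h | h
      · rw [Subsingleton.elim (1 : Matrix X X ℂ) 0, norm_zero]; exact zero_le_one
      · exact le_of_eq CStarRing.norm_one
    nlinarith [norm_nonneg u]

variable {m n o : ℕ} {B : StarSubalgebra ℂ (dimDrop m n o)}
  {E : dimDrop m n o →ₗ[ℂ] dimDrop m n o}

/-- The columns of `u` form an orthonormal basis adapted to `B`, its normaliser and its
conditional expectation at the point `t`. -/
structure IsFrame (B : StarSubalgebra ℂ (dimDrop m n o))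
    (E : dimDrop m n o →ₗ[ℂ] dimDrop m n o) (t : I) (u : Mat3 m n o) : Prop where
  unitary : u ∈ Matrix.unitaryGroup (Fin m × Fin n × Fin o) ℂ
  expectation : ∀ f, star u * evalHom m n o t (E f) * u
    = Matrix.diagonal (Matrix.diag (star u * evalHom m n o t f * u))
  monomial : ∀ f ∈ normaliser B, IsMonomial (star u * evalHom m n o t f * u)

/-- The matrix `a e_ii a*` is formed from column `i` of `a` alone, and is diagonal only if that
column has at most one non-zero entry; `a* e_ii a` does the same for rows. -/
theorem isMonomial_of_isDiag {X : Type*} [Fintype X] [DecidableEq X] {a : Matrix X X ℂ}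
    (h1 : ∀ i, (a * Matrix.single i i 1 * star a).IsDiag)
    (h2 : ∀ i, (star a * Matrix.single i i 1 * a).IsDiag) : IsMonomial a := by
  refine ⟨fun x y z hy hz => ?_, fun x y z hy hz => ?_⟩ <;> by_contra hne
  · have : (a * Matrix.single x x 1 * star a : Matrix X X ℂ) y z = 0 := h1 x hne
    rw [Matrix.mul_apply, Finset.sum_eq_single x, Matrix.mul_single_apply_same,
      Matrix.star_apply] at this
    · simp [hy, hz] at this
    · intro k _ hk
      rw [Matrix.mul_single_apply_of_ne _ _ _ _ _ hk, zero_mul]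
    · simp
  · have : (star a * Matrix.single x x 1 * a : Matrix X X ℂ) y z = 0 := h2 x hne
    rw [Matrix.mul_apply, Finset.sum_eq_single x, Matrix.mul_single_apply_same,
      Matrix.star_apply] at this
    · simp [hy, hz] at this
    · intro k _ hk
      rw [Matrix.mul_single_apply_of_ne _ _ _ _ _ hk, zero_mul]
    · simp

/-- The minimal projections of `B_t` lift to elements `b` of `B`. Compressing by them, `E (b * f *
b) = b * E f * b` reads off the diagonal of `f`, and conjugating them by a normaliser stays
diagonal. -/
theorem exists_isFrame_interior (hB : IsMASA B) (hE : IsConditionalExpectation B E) {t : I}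
    (h0 : t ≠ 0) (h1 : t ≠ 1) : ∃ u, IsFrame B E t u := by
  obtain ⟨u, hu, hF⟩ := exists_unitary_fibre_interior hB hE h0 h1
  have huu := (Matrix.mem_unitaryGroup_iff').1 hu
  have huu' := (Matrix.mem_unitaryGroup_iff).1 hu
  have hproj : ∀ i, ∃ b ∈ B, evalHom m n o t b = u * Matrix.single i i 1 * star u := by
    intro i
    have : u * Matrix.single i i 1 * star u ∈ fibreAlg B t := by
      rw [hF, conj_conj hu]
      intro p q hpq
      exact Matrix.single_apply_of_ne _ _ _ _ _ (by rintro ⟨rfl, rfl⟩; exact hpq rfl)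
    exact this
  refine ⟨u, hu, fun f => ?_, fun f hf => ?_⟩
  · have hd : (star u * evalHom m n o t (E f) * u).IsDiag := (hF _).1 ⟨_, hE.mem f, rfl⟩
    rw [← hd.diagonal_diag]
    congr 1
    ext i
    obtain ⟨b, hb, hbt⟩ := hproj i
    have hconj : ∀ x : Mat3 m n o, (u * Matrix.single i i 1 * star u) * x *
        (u * Matrix.single i i 1 * star u)
        = (star u * x * u) i i • (u * Matrix.single i i 1 * star u) := by
      intro x
      calc _ = u * (Matrix.single i i 1 * (star u * x * u) * Matrix.single i i 1) * star u := by
            simp only [mul_assoc]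
        _ = _ := by
            rw [Matrix.single_mul_mul_single, one_mul, mul_one, ← smul_mul_assoc,
              ← mul_smul_comm, Matrix.smul_single, smul_eq_mul, mul_one]
    have e1 := expectation_congr hB hE h0 h1 (f := b * f * b)
      (g := (star u * evalHom m n o t f * u) i i • b) (by
        rw [map_mul, map_mul, hbt, hconj, map_smul, hbt])
    rw [hE.bimodule b hb b hb, map_smul, hE.apply_of_mem b hb, map_mul, map_mul, hbt, hconj,
      map_smul, hbt] at e1
    have e2 := congrArg (fun x => (star u * x * u) i i) e1
    simp only [mul_smul_comm, smul_mul_assoc, conj_conj hu] at e2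
    simpa using e2
  · have key : ∀ g ∈ normaliser B, ∀ i, ((star u * evalHom m n o t g * u) * Matrix.single i i 1 *
        star (star u * evalHom m n o t g * u)).IsDiag := by
      intro g hg i
      obtain ⟨b, hb, hbt⟩ := hproj i
      have h2 := (hF _).1 ⟨_, (hg b hb).1, rfl⟩
      change (star u * evalHom m n o t (g * b * star g) * u).IsDiag at h2
      rw [map_mul, map_mul, hbt, map_star] at h2
      convert h2 using 1
      simp only [star_mul, star_star, mul_assoc]
    refine isMonomial_of_isDiag (key f hf) fun i => ?_
    have h3 := key (star f) (fun b hb => by rw [star_star]; exact (hf b hb).symm) i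
    convert h3 using 1
    simp only [map_star, star_mul, star_star, mul_assoc]

theorem mem_closure_interior (t : I) : t ∈ closure {s : I | s ≠ 0 ∧ s ≠ 1} := by
  have h : Dense (Set.univ \ {0, 1} : Set I) := dense_univ.sdiff_finite (Set.toFinite _)
  have : ({s : I | s ≠ 0 ∧ s ≠ 1}) = Set.univ \ {0, 1} := by ext s; simp
  rw [this]
  exact h t

/-- Frames at interior points accumulate at every `t` because the unitary group is compact. The
identity for `E` is a closed condition and passes to the limit. -/
theorem exists_isFrame (hB : IsMASA B) (hE : IsConditionalExpectation B E) (t : I) :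
    ∃ u, IsFrame B E t u := by
  obtain ⟨G, hG, hGt⟩ := mem_closure_iff_ultrafilter.1 (mem_closure_interior t)
  have hex : ∀ s : I, ∃ u ∈ Matrix.unitaryGroup (Fin m × Fin n × Fin o) ℂ,
      (s ≠ 0 ∧ s ≠ 1 → IsFrame B E s u) := by
    intro s
    by_cases hs : s ≠ 0 ∧ s ≠ 1
    · obtain ⟨u, hu⟩ := exists_isFrame_interior hB hE hs.1 hs.2
      exact ⟨u, hu.unitary, fun _ => hu⟩
    · exact ⟨1, one_mem _, fun h => (hs h).elim⟩
  choose U hU hF using hex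
  obtain ⟨u, hu, hlim⟩ := (isCompact_unitaryGroup (Fin m × Fin n × Fin o)).ultrafilter_le_nhds
    (G.map U) (by
      rw [Filter.le_principal_iff]
      exact Filter.mem_map.2 (Filter.Eventually.of_forall hU))
  have hlim' : Filter.Tendsto U G (nhds u) := hlim
  have hf : ∀ f : dimDrop m n o, Filter.Tendsto (fun s => star (U s) * evalHom m n o s f * U s) G
      (nhds (star u * evalHom m n o t f * u)) := by
    intro f
    have h1 : Filter.Tendsto (fun s => evalHom m n o s f) G (nhds (evalHom m n o t f)) :=
      (f.1.continuous.tendsto t).mono_left hGt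
    exact (hlim'.star.mul h1).mul hlim'
  have hent : ∀ (f : dimDrop m n o) i j, Filter.Tendsto
      (fun s => (star (U s) * evalHom m n o s f * U s) i j) G
      (nhds ((star u * evalHom m n o t f * u) i j)) := by
    intro f i j
    exact ((continuous_id.matrix_elem i j).tendsto _).comp (hf f)
  refine ⟨u, hu, fun f => ?_, fun f hf' => ?_⟩
  · ext i j
    rw [Matrix.diagonal_apply]
    split_ifs with hij
    · subst hij
      refine tendsto_nhds_unique_of_eventuallyEq (hent (E f) i i) (hent f i i) ?_
      filter_upwards [hG] with s hs
      rw [(hF s hs).expectation f]; simp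
    · refine tendsto_nhds_unique_of_eventuallyEq (hent (E f) i j) tendsto_const_nhds ?_
      filter_upwards [hG] with s hs
      rw [(hF s hs).expectation f, Matrix.diagonal_apply_ne _ hij]
  -- Non-vanishing of an entry is an open condition: two non-zero entries of the limit are already
  -- non-zero at some nearby interior point.
  · refine ⟨fun x y z h1 h2 => ?_, fun x y z h1 h2 => ?_⟩
    · obtain ⟨s, hs1, hs2, hs⟩ := (((hent f y x).eventually_ne h1).and
        (((hent f z x).eventually_ne h2).and hG)).exists
      exact ((hF s hs).monomial f hf').1 x y z hs1 hs2
    · obtain ⟨s, hs1, hs2, hs⟩ := (((hent f x y).eventually_ne h1).and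
        (((hent f x z).eventually_ne h2).and hG)).exists
      exact ((hF s hs).monomial f hf').2 x y z hs1 hs2

/-- Conjugation by a unitary matrix. -/
def conjHom {X : Type*} [Fintype X] [DecidableEq X] (u : Matrix X X ℂ)
    (hu : u ∈ Matrix.unitaryGroup X ℂ) : Matrix X X ℂ →⋆ₐ[ℂ] Matrix X X ℂ where
  toFun a := star u * a * u
  map_one' := by rw [mul_one]; exact (Matrix.mem_unitaryGroup_iff').1 hu
  map_mul' a b := by
    have h := (Matrix.mem_unitaryGroup_iff).1 hu
    calc _ = star u * a * 1 * b * u := by simp only [mul_assoc, one_mul]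
      _ = _ := by rw [← h]; simp only [mul_assoc]
  map_zero' := by simp
  map_add' a b := by rw [mul_add, add_mul]
  commutes' c := by
    rw [Algebra.algebraMap_eq_smul_one, mul_smul_comm, mul_one, smul_mul_assoc,
      (Matrix.mem_unitaryGroup_iff').1 hu]
  map_star' a := by simp only [star_mul, star_star, mul_assoc]

theorem conjHom_apply {X : Type*} [Fintype X] [DecidableEq X] (u : Matrix X X ℂ)
    (hu : u ∈ Matrix.unitaryGroup X ℂ) (a : Matrix X X ℂ) :
    conjHom u hu a = star u * a * u := rfl

/-- Monomial matrices are closed under products and adjoints and include `1`, so their linear span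
is already a star algebra. -/
theorem star_adjoin_le_span_monomial {X Y : Type*} [Fintype X] [DecidableEq X] [Fintype Y]
    [DecidableEq Y] (ι : Matrix Y Y ℂ →⋆ₐ[ℂ] Matrix X X ℂ) {a : Matrix Y Y ℂ}
    (ha : a ∈ StarAlgebra.adjoin ℂ {a | IsMonomial (ι a)}) :
    a ∈ Submodule.span ℂ {a | IsMonomial (ι a)} := by
  induction ha using StarAlgebra.adjoin_induction with
  | mem a ha => exact Submodule.subset_span ha
  | algebraMap c =>
    rw [Algebra.algebraMap_eq_smul_one]
    refine Submodule.smul_mem _ _ (Submodule.subset_span ?_)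
    rw [Set.mem_ofPred_eq, map_one]
    exact isMonomial_one
  | add a b _ _ ha hb => exact add_mem ha hb
  | mul a b _ _ ha hb =>
    have := Submodule.mul_mem_mul ha hb
    rw [Submodule.span_mul_span] at this
    refine Submodule.span_mono ?_ this
    rintro _ ⟨c, hc, d, hd, rfl⟩
    simp only [Set.mem_ofPred_eq, map_mul]
    exact IsMonomial.mul hc hd
  | star a h ha =>
    clear h
    induction ha using Submodule.span_induction with
    | mem a ha =>
      refine Submodule.subset_span ?_
      rw [Set.mem_ofPred_eq, map_star]
      exact IsMonomial.star ha
    | zero => rw [star_zero]; exact zero_mem _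
    | add a b _ _ ha hb => rw [star_add]; exact add_mem ha hb
    | smul c a _ ha => rw [star_smul]; exact Submodule.smul_mem _ _ ha

/-- At a point where the algebra is a full matrix algebra of multiplicity prime to its size,
the fibre of a Cartan subalgebra has maximal dimension. -/
theorem finrank_fibre_eq_card (hB : IsCartan B) (t : I) {Y : Type*} [Fintype Y] [DecidableEq Y]
    (ι : Matrix Y Y ℂ →⋆ₐ[ℂ] Mat3 m n o) (hι : ∀ f, ∃ a, ι a = evalHom m n o t f)
    (hι' : ∀ a, ∃ f, evalHom m n o t f = ι a) (L : ℕ) (hL : L ≠ 0)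
    (htr : ∀ a, (ι a).trace = L * a.trace)
    (hX : Fintype.card (Fin m × Fin n × Fin o) = Fintype.card Y * L)
    [Nonempty (Fin m × Fin n × Fin o)] (hcop : Nat.Coprime (Fintype.card Y) L) :
    Module.finrank ℂ (fibre B t) = Fintype.card Y := by
  obtain ⟨E, hE, -⟩ := hB.expectation
  obtain ⟨u, hu⟩ := exists_isFrame hB.masa hE t
  let κ : Matrix Y Y ℂ →⋆ₐ[ℂ] Mat3 m n o := (conjHom u hu.unitary).comp ι
  have hκ : ∀ a, κ a = star u * ι a * u := fun a => rfl
  have huu := (Matrix.mem_unitaryGroup_iff).1 hu.unitary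
  have htr' : ∀ a, (κ a).trace = L * a.trace := by
    intro a
    rw [hκ, Matrix.trace_mul_comm, ← mul_assoc, huu, one_mul, htr]
  have hinj := injective_of_trace ι L hL htr
  have hΔ : ∀ a, ∃ b, κ b = Matrix.diagonal (Matrix.diag (κ a)) := by
    intro a
    obtain ⟨f, hf⟩ := hι' a
    obtain ⟨b, hb⟩ := hι (E f)
    exact ⟨b, by rw [hκ, hκ, hb, hu.expectation, hf]⟩
  have hspan : ⊤ ≤ Submodule.span ℂ {a | IsMonomial (κ a)} := by
    let W : StarSubalgebra ℂ (Matrix Y Y ℂ) := StarAlgebra.adjoin ℂ {a | IsMonomial (κ a)}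
    -- Regularity evaluated at `t`: the target is finite-dimensional, so the image generated by
    -- monomial elements is closed and no closure survives.
    have hW : (StarAlgebra.adjoin ℂ (normaliser B)).topologicalClosure
        ≤ (W.map ι).comap (evalHom m n o t) := by
      apply StarSubalgebra.topologicalClosure_minimal
      · rw [StarAlgebra.adjoin_le_iff]
        intro f hf
        obtain ⟨a, ha⟩ := hι f
        refine ⟨a, StarAlgebra.subset_adjoin ℂ _ ?_, ha⟩
        rw [Set.mem_ofPred_eq, hκ, ha]
        exact hu.monomial f hf
      · have : IsClosed (W.map ι : Set (Mat3 m n o)) :=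
          Submodule.closed_of_finiteDimensional (W.map ι).toSubalgebra.toSubmodule
        exact this.preimage (continuous_evalHom t)
    rw [hB.regular] at hW
    intro a _
    obtain ⟨f, hf⟩ := hι' a
    obtain ⟨b, hb, hba⟩ := hW (x := f) trivial
    change ι b = evalHom m n o t f at hba
    rw [hf] at hba
    rw [← hinj hba]
    exact star_adjoin_le_span_monomial κ hb
  have hmain := finrank_diagFunctions_eq_card κ hΔ hspan L hL htr' hX hcop
  rw [← hmain]
  -- Rotated back by `u`, the diagonal matrices in the range of `κ` are exactly the fibre, because
  -- `E` maps onto `B` and acts as compression.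
  have hmap : (Subalgebra.toSubmodule (diagFunctions κ)).map (diagHom u hu.unitary).toLinearMap
      = fibre B t := by
    ext x
    constructor
    · rintro ⟨g, ⟨a, ha⟩, rfl⟩
      change κ a = Matrix.diagonal g at ha
      obtain ⟨f, hf⟩ := hι' a
      refine ⟨E f, hE.mem f, ?_⟩
      change evalHom m n o t (E f) = u * Matrix.diagonal g * star u
      rw [← conj_conj' hu.unitary (evalHom m n o t (E f)), hu.expectation, hf, ← hκ, ha,
        Matrix.diag_diagonal]
    · rintro ⟨b, hb, rfl⟩
      obtain ⟨a, ha⟩ := hι b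
      have h1 := hu.expectation b
      rw [hE.apply_of_mem b hb] at h1
      refine ⟨Matrix.diag (star u * evalHom m n o t b * u), ⟨a, ?_⟩, ?_⟩
      · change κ a = Matrix.diagonal _
        rw [hκ, ha, ← h1]
      · change u * Matrix.diagonal _ * star u = evalHom m n o t b
        rw [← h1, conj_conj' hu.unitary]
  rw [← hmap]
  exact (Submodule.equivMapOfInjective _ (diagHom_injective hu.unitary) _).finrank_eq.symm

theorem trace_embedLeft (a : Matrix (Fin m × Fin o) (Fin m × Fin o) ℂ) :
    (embedLeft m n o a).trace = n * a.trace := by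
  have : ∀ p q, embedLeft m n o a p q = if p.2.1 = q.2.1 then a (p.1, p.2.2) (q.1, q.2.2) else 0 :=
    fun _ _ => rfl
  simp [Matrix.trace, this, Fintype.sum_prod_type, Finset.mul_sum]

theorem trace_embedRight (a : Matrix (Fin n × Fin o) (Fin n × Fin o) ℂ) :
    (embedRight m n o a).trace = m * a.trace := by
  have : ∀ p q, embedRight m n o a p q = if p.1 = q.1 then a p.2 q.2 else 0 := fun _ _ => rfl
  simp [Matrix.trace, this, Fintype.sum_prod_type]

theorem exists_evalHom_zero (a : Matrix (Fin m × Fin o) (Fin m × Fin o) ℂ) :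
    ∃ f, evalHom m n o 0 f = embedLeft m n o a :=
  ⟨⟨⟨fun t => (1 - ((t : ℝ) : ℂ)) • embedLeft m n o a, by fun_prop⟩,
    ⟨a, by simp⟩, by simp [zero_mem]⟩, by simp [evalHom_apply]⟩

theorem exists_evalHom_one (a : Matrix (Fin n × Fin o) (Fin n × Fin o) ℂ) :
    ∃ f, evalHom m n o 1 f = embedRight m n o a :=
  ⟨⟨⟨fun t => ((t : ℝ) : ℂ) • embedRight m n o a, by fun_prop⟩,
    by simp [zero_mem], ⟨a, by simp⟩⟩, by simp [evalHom_apply]⟩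

/-- For pairwise coprime parameters every Cartan subalgebra is non-degenerate. -/
theorem isNonDegenerate_of_coprime (hm : 1 ≤ m) (hn : 1 ≤ n) (ho : 1 ≤ o) (hmn : Nat.Coprime m n)
    (hmo : Nat.Coprime m o) (hno : Nat.Coprime n o) (hB : IsCartan B) : IsNonDegenerate B := by
  have : Nonempty (Fin m × Fin n × Fin o) := ⟨⟨0, hm⟩, ⟨0, hn⟩, ⟨0, ho⟩⟩
  constructor
  · have := finrank_fibre_eq_card hB 0 (embedLeft m n o) (fun f => f.2.1) exists_evalHom_zero n
      (by omega) trace_embedLeft (by simp; ring) (by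
        simpa using Nat.Coprime.mul_left hmn hno.symm)
    simpa using this
  · have := finrank_fibre_eq_card hB 1 (embedRight m n o) (fun f => f.2.2) exists_evalHom_one m
      (by omega) trace_embedRight (by simp; ring) (by
        simpa using Nat.Coprime.mul_left hmn.symm hmo.symm)
    simpa using this

end Frames

/-! ### States, pure states and multiplicativity. -/

section States

theorem eq_zero_of_forall_nonneg {K z : ℂ} (h : ∀ t : ℝ, 0 ≤ K + t * z) : z = 0 := by
  have him : ∀ t : ℝ, K.im + t * z.im = 0 := fun t => by
    have := (Complex.le_def.1 (h t)).2
    simpa using this.symm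
  have hre : ∀ t : ℝ, 0 ≤ K.re + t * z.re := fun t => by
    have := (Complex.le_def.1 (h t)).1
    simpa using this
  apply Complex.ext
  · by_contra hne
    have := hre (-(K.re + 1) / z.re)
    rw [div_mul_cancel₀ _ hne] at this
    linarith
  · have h0 := him 0
    have h1 := him 1
    simp at h0 h1 ⊢
    linarith

variable {A : Type*} [Ring A] [StarRing A] [Algebra ℂ A] [StarModule ℂ A]

/-- The degenerate case of the Cauchy–Schwarz inequality: positivity on `y + c • x` is affine in `c`
and `star c`, and testing `c = t` and `c = t * I` removes the linear part. -/
theorem state_mul_eq_zero {φ : A →ₗ[ℂ] ℂ} (hφ : φ ∈ states A) {x : A} (hx : φ (star x * x) = 0)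
    (y : A) : φ (star x * y) = 0 ∧ φ (star y * x) = 0 := by
  have h : ∀ c : ℂ, 0 ≤ φ (star y * y) + (c * φ (star y * x) + star c * φ (star x * y)) := by
    intro c
    have h1 := hφ.2 (y + c • x)
    have h2 : star (y + c • x) * (y + c • x) = star y * y + (c • (star y * x) +
        star c • (star x * y)) + (star c * c) • (star x * x) := by
      rw [star_add, star_smul, add_mul, mul_add, mul_add, smul_mul_assoc, smul_mul_assoc,
        mul_smul_comm, mul_smul_comm, smul_smul]
      abel
    rw [h2] at h1
    simpa [hx] using h1
  have h1 := eq_zero_of_forall_nonneg (K := φ (star y * y))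
    (z := φ (star y * x) + φ (star x * y)) fun t => by
      have := h t
      simpa [mul_add] using this
  have h2 := eq_zero_of_forall_nonneg (K := φ (star y * y))
    (z := Complex.I * (φ (star y * x) - φ (star x * y))) fun t => by
      have := h (t * Complex.I)
      convert this using 2
      simp
      ring
  have h3 := (mul_eq_zero.1 h2).resolve_left Complex.I_ne_zero
  constructor
  · linear_combination (1 / 2 : ℂ) * h1 - (1 / 2 : ℂ) * h3
  · linear_combination (1 / 2 : ℂ) * h1 + (1 / 2 : ℂ) * h3

end States

section CStar

variable {A : Type*} [CStarAlgebra A]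

theorem exists_algebraMap_sub_eq_star_mul_self {h : A} (hh : IsSelfAdjoint h) {r : ℝ}
    (hr : ‖h‖ ≤ r) : ∃ c : A, algebraMap ℝ A r - h = star c * c := by
  let _ := CStarAlgebra.spectralOrder A
  let _ := CStarAlgebra.spectralOrderedRing A
  have h1 : h ≤ algebraMap ℝ A r :=
    hh.le_algebraMap_norm_self.trans (algebraMap_mono A hr)
  exact CStarAlgebra.nonneg_iff_eq_star_mul_self.1 (sub_nonneg.2 h1)

theorem state_star_mul_self_le {φ : A →ₗ[ℂ] ℂ} (hφ : φ ∈ states A) (x : A) {r : ℝ}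
    (hr : ‖x‖ ≤ r) : φ (star x * x) ≤ (r * r : ℝ) := by
  have h1 : ‖star x * x‖ ≤ r * r := by
    rw [CStarRing.norm_star_mul_self]
    exact mul_self_le_mul_self (norm_nonneg x) hr
  obtain ⟨c, hc⟩ := exists_algebraMap_sub_eq_star_mul_self (IsSelfAdjoint.star_mul_self x) h1
  have h2 := hφ.2 c
  rw [← hc, map_sub, IsScalarTower.algebraMap_apply ℝ ℂ A, Algebra.algebraMap_eq_smul_one, map_smul,
    hφ.1] at h2
  simpa using h2

/-- The functional `x ↦ φ(d* d x) / φ(d* d)`. -/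
def cutState (φ : A →ₗ[ℂ] ℂ) (d : A) : A →ₗ[ℂ] ℂ :=
  (φ (star d * d))⁻¹ • φ ∘ₗ LinearMap.mulLeft ℂ (star d * d)

theorem cutState_apply (φ : A →ₗ[ℂ] ℂ) (d x : A) :
    cutState φ d x = (φ (star d * d))⁻¹ * φ (star d * d * x) := rfl

theorem cutState_mem {φ : A →ₗ[ℂ] ℂ} (hφ : φ ∈ states A) (hcomm : ∀ x y : A, x * y = y * x) (d : A)
    (hd : φ (star d * d) ≠ 0) : cutState φ d ∈ states A := by
  refine ⟨?_, fun x => ?_⟩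
  · rw [cutState_apply, mul_one, inv_mul_cancel₀ hd]
  · rw [cutState_apply]
    have h1 : star d * d * (star x * x) = star (d * x) * (d * x) := by
      rw [star_mul, mul_assoc, ← mul_assoc d, hcomm d (star x), ← mul_assoc, ← mul_assoc,
        hcomm (star d) (star x)]
      simp only [mul_assoc]
    rw [h1]
    exact mul_nonneg (inv_nonneg.2 (hφ.2 d)) (hφ.2 _)

/-- `φ` is the convex combination of its two cut states with weights `φ(d* d)` and `φ(e* e)`, so
extremality identifies it with the first. Vanishing weights fall to `state_mul_eq_zero`. -/
theorem pureState_mul_aux {φ : A →ₗ[ℂ] ℂ} (hφ : φ ∈ pureStates A)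
    (hcomm : ∀ x y : A, x * y = y * x) {d e : A} (hde : star d * d + star e * e = 1) (x : A) :
    φ (star d * d * x) = φ (star d * d) * φ x := by
  have hs : φ ∈ states A := hφ.1
  have hsum : φ (star d * d) + φ (star e * e) = 1 := by rw [← map_add, hde, hs.1]
  have hx : φ (star d * d * x) + φ (star e * e * x) = φ x := by
    rw [← map_add, ← add_mul, hde, one_mul]
  by_cases hd : φ (star d * d) = 0
  · rw [hd, zero_mul, mul_assoc]
    exact (state_mul_eq_zero hs hd _).1
  by_cases he : φ (star e * e) = 0
  · rw [he, add_zero] at hsum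
    rw [mul_assoc (star e), (state_mul_eq_zero hs he _).1, add_zero] at hx
    rw [hsum, one_mul, hx]
  have hdp := hs.2 d
  have hep := hs.2 e
  have h1 : φ ∈ openSegment ℝ (cutState φ d) (cutState φ e) := by
    have e1 : ((φ (star d * d)).re : ℂ) = φ (star d * d) :=
      Complex.ext rfl (Complex.le_def.1 hdp).2
    have e2 : ((φ (star e * e)).re : ℂ) = φ (star e * e) :=
      Complex.ext rfl (Complex.le_def.1 hep).2
    refine ⟨(φ (star d * d)).re, (φ (star e * e)).re, ?_, ?_, ?_, ?_⟩
    · exact lt_of_le_of_ne (Complex.le_def.1 hdp).1 fun h => hd (by rw [← e1, ← h]; simp)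
    · exact lt_of_le_of_ne (Complex.le_def.1 hep).1 fun h => he (by rw [← e2, ← h]; simp)
    · rw [← Complex.add_re, hsum, Complex.one_re]
    · ext y
      have hy : φ (star d * d * y) + φ (star e * e * y) = φ y := by
        rw [← map_add, ← add_mul, hde, one_mul]
      rw [LinearMap.add_apply, LinearMap.smul_apply, LinearMap.smul_apply, cutState_apply,
        cutState_apply, Complex.real_smul, Complex.real_smul, e1, e2, mul_inv_cancel_left₀ hd,
        mul_inv_cancel_left₀ he, hy]
  have h2 := hφ.2 (cutState_mem hs hcomm d hd) (cutState_mem hs hcomm e he) h1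
  have h3 := congrArg (fun f : A →ₗ[ℂ] ℂ => f x) h2
  simp only [cutState_apply] at h3
  rw [← h3, mul_inv_cancel_left₀ hd]

/-- The pure states of a commutative C*-algebra are multiplicative. -/
theorem pureState_mul {φ : A →ₗ[ℂ] ℂ} (hφ : φ ∈ pureStates A) (hcomm : ∀ x y : A, x * y = y * x)
    (x y : A) : φ (x * y) = φ x * φ y := by
  -- For such `h` both `1/2 - h` and `1/2 + h` are of the form `d* d`, and they add up to `1`.
  have h1 : ∀ h : A, IsSelfAdjoint h → ‖h‖ ≤ 1 / 2 → φ (h * y) = φ h * φ y := by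
    intro h hh hn
    obtain ⟨d, hd⟩ := exists_algebraMap_sub_eq_star_mul_self hh hn
    obtain ⟨e, he⟩ := exists_algebraMap_sub_eq_star_mul_self (r := 1 / 2) hh.neg
      (by rwa [norm_neg])
    have hde : star d * d + star e * e = 1 := by
      rw [← hd, ← he, sub_neg_eq_add, sub_add_add_cancel, ← map_add]
      norm_num
    have h2 := pureState_mul_aux hφ hcomm hde y
    have h3 : φ 1 = 1 := hφ.1.1
    rw [← hd, IsScalarTower.algebraMap_apply ℝ ℂ A, Algebra.algebraMap_eq_smul_one, sub_mul,
      smul_mul_assoc, one_mul, map_sub, map_sub, map_smul, map_smul, h3] at h2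
    simp only [smul_eq_mul, mul_one, sub_mul] at h2
    exact sub_right_injective h2
  have h2 : ∀ h : A, IsSelfAdjoint h → φ (h * y) = φ h * φ y := by
    intro h hh
    let r : ℝ := 2 * ‖h‖ + 1
    have hr : 0 < r := by positivity
    have h3 := h1 ((r⁻¹ : ℝ) • h) ((IsSelfAdjoint.all (r⁻¹ : ℝ)).smul hh) (by
      rw [norm_smul, norm_inv, Real.norm_of_nonneg hr.le, inv_mul_le_iff₀ hr]
      simp only [r]; linarith [norm_nonneg h])
    have hc : ((r⁻¹ : ℝ) : ℂ) ≠ 0 := by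
      exact_mod_cast inv_ne_zero hr.ne'
    rw [← Complex.coe_smul, smul_mul_assoc, map_smul, map_smul, smul_eq_mul, smul_eq_mul,
      mul_assoc] at h3
    exact mul_left_cancel₀ hc h3
  conv_lhs => rw [← realPart_add_I_smul_imaginaryPart x]
  conv_rhs => rw [← realPart_add_I_smul_imaginaryPart x]
  rw [add_mul, smul_mul_assoc, map_add, map_smul, map_add, map_smul, h2 _ (realPart x).2,
    h2 _ (imaginaryPart x).2, add_mul, smul_eq_mul, smul_eq_mul, mul_assoc]

end CStar

/-! ### Unique extension for non-degenerate Cartan subalgebras. -/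

section Extension

variable {m n o : ℕ} {B : StarSubalgebra ℂ (dimDrop m n o)}

/-- The difference `g - g(t)` lies in the null space of `ψ`, so it may be replaced by zero inside
products. -/
theorem state_scalarHom_mul {ψ : dimDrop m n o →ₗ[ℂ] ℂ} (hψ : ψ ∈ states (dimDrop m n o)) {t : I}
    (ht : ∀ g, ψ (scalarHom m n o g) = g t) (g : C(I, ℂ)) (x : dimDrop m n o) :
    ψ (scalarHom m n o g * x) = g t * ψ x := by
  let k : C(I, ℂ) := star (g - ContinuousMap.const I (g t))
  have h1 : star (scalarHom m n o k) = scalarHom m n o (g - ContinuousMap.const I (g t)) := by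
    ext s : 1
    rw [map_star, evalHom_scalarHom, evalHom_scalarHom, ← algebraMap_star_comm]
    simp [k]
  have h0 : ψ (star (scalarHom m n o k) * scalarHom m n o k) = 0 := by
    rw [h1, ← map_mul, ht]; simp
  have h2 := (state_mul_eq_zero hψ h0 x).1
  have h3 : scalarHom m n o (ContinuousMap.const I (g t)) = algebraMap ℂ _ (g t) := by
    ext s : 1
    rfl
  rw [h1, map_sub, h3, sub_mul, map_sub, ← Algebra.smul_def, map_smul, smul_eq_mul] at h2
  exact sub_eq_zero.1 h2

/-- A state that restricts to the evaluation at `t` on scalar functions vanishes on all functions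
that vanish at `t`. -/
theorem state_eq_zero_of_evalHom_eq_zero {ψ : dimDrop m n o →ₗ[ℂ] ℂ}
    (hψ : ψ ∈ states (dimDrop m n o)) {t : I} (ht : ∀ g, ψ (scalarHom m n o g) = g t)
    {y : dimDrop m n o} (hy : evalHom m n o t y = 0) : ψ y = 0 := by
  have hε : ∀ ε : ℝ, 0 < ε → ψ (star y * y) ≤ (ε * ε : ℝ) := by
    intro ε hε
    -- A cut-off equal to `1` at `t`, where `y` vanishes, that pushes the norm of `y` below `ε`
    -- everywhere. Since `ψ` sees only its value at `t`, `ψ(y* y)` is at most `ε²`.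
    let G : C(I, ℝ) := ⟨fun s => ε / max ε ‖evalHom m n o s y‖, by
      have : Continuous fun s => evalHom m n o s y := y.1.continuous
      exact continuous_const.div (continuous_const.max this.norm)
        fun s => (lt_max_of_lt_left hε).ne'⟩
    let g : C(I, ℂ) := ⟨fun s => (G s : ℂ), by fun_prop⟩
    have hg : g t = 1 := by simp [g, G, hy, hε.le, hε.ne']
    have hstar : star (scalarHom m n o g) = scalarHom m n o g := by
      ext s : 1
      rw [map_star, evalHom_scalarHom, ← algebraMap_star_comm]
      simp [g]
    have hnorm : ‖scalarHom m n o g * y‖ ≤ ε := by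
      change ‖((scalarHom m n o g * y : dimDrop m n o) : C(I, Mat3 m n o))‖ ≤ ε
      rw [ContinuousMap.norm_le _ hε.le]
      intro s
      change ‖evalHom m n o s (scalarHom m n o g * y)‖ ≤ ε
      have hpos : 0 < max ε ‖evalHom m n o s y‖ := lt_max_of_lt_left hε
      rw [evalHom_scalarHom_mul, norm_smul]
      change ‖((ε / max ε ‖evalHom m n o s y‖ : ℝ) : ℂ)‖ * _ ≤ ε
      rw [Complex.norm_real, Real.norm_of_nonneg (by positivity), div_mul_eq_mul_div,
        div_le_iff₀ hpos]
      exact mul_le_mul_of_nonneg_left (le_max_right _ _) hε.le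
    have h1 := state_star_mul_self_le hψ _ hnorm
    have h2 : star (scalarHom m n o g * y) * (scalarHom m n o g * y)
        = scalarHom m n o g * (scalarHom m n o g * (star y * y)) := by
      rw [star_mul, hstar, ← scalarHom_comm, mul_assoc, ← mul_assoc (star y), ← scalarHom_comm,
        mul_assoc]
    rw [h2, state_scalarHom_mul hψ ht, state_scalarHom_mul hψ ht, hg, one_mul, one_mul] at h1
    exact h1
  have h0 : ψ (star y * y) = 0 := by
    have h1 := hψ.2 y
    refine Complex.ext ?_ (Complex.le_def.1 h1).2.symm
    refine le_antisymm (le_of_forall_pos_le_add fun δ hδ => ?_) (Complex.le_def.1 h1).1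
    have := (Complex.le_def.1 (hε (Real.sqrt δ) (Real.sqrt_pos.2 hδ))).1
    rw [Real.mul_self_sqrt hδ.le] at this
    simpa using this
  have := (state_mul_eq_zero hψ h0 1).2
  simpa using this

/-- A multiplicative functional on a masa is supported at a point of the interval. -/
theorem exists_point_of_mul (hB : IsMASA B) {φ : B →ₗ[ℂ] ℂ} (h1 : φ 1 = 1)
    (hmul : ∀ x y, φ (x * y) = φ x * φ y) :
    ∃ t : I, ∀ g, φ ⟨scalarHom m n o g, scalarHom_mem hB g⟩ = g t := by
  let χ : C(I, ℂ) →ₐ[ℂ] ℂ := AlgHom.ofLinearMap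
    { toFun := fun g => φ ⟨scalarHom m n o g, scalarHom_mem hB g⟩
      map_add' := fun f g => by rw [← map_add]; congr 1; exact Subtype.ext (map_add _ _ _)
      map_smul' := fun c g => by
        rw [RingHom.id_apply, ← map_smul]; congr 1; exact Subtype.ext (map_smul _ _ _) }
    (by
      change φ _ = 1
      exact (congrArg φ (Subtype.ext (map_one _))).trans h1)
    (fun f g => by
      change φ _ = φ _ * φ _
      rw [← hmul]; exact congrArg φ (Subtype.ext (map_mul _ _ _)))
  obtain ⟨t, ht⟩ := (WeakDual.CharacterSpace.continuousMapEval_bijective (X := I) (𝕜 := ℂ)).2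
    (WeakDual.CharacterSpace.equivAlgHom.symm χ)
  refine ⟨t, fun g => ?_⟩
  have := congrArg (fun f => f g) ht
  exact this.symm

/-- If the fibre of `B` at `t` is of maximal dimension in a full matrix algebra, then every
pure state over `t` is determined by an element of `B` that is a minimal projection at `t`. -/
theorem exists_minimal_of_finrank (hB : IsMASA B) (t : I) {Y : Type*} [Fintype Y] [DecidableEq Y]
    (ι : Matrix Y Y ℂ →⋆ₐ[ℂ] Mat3 m n o) (hinj : Function.Injective ι)
    (hι : ∀ f, ∃ a, ι a = evalHom m n o t f)
    (hdim : Module.finrank ℂ (fibre B t) = Fintype.card Y) :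
    ∃ b : Y → B, evalHom m n o t (∑ y, (b y : dimDrop m n o)) = 1 ∧
      (∀ y, evalHom m n o t (b y * b y) = evalHom m n o t (b y)) ∧
      ∀ y (x : dimDrop m n o), ∃ c : ℂ,
        evalHom m n o t (b y * x * b y) = evalHom m n o t (c • (b y : dimDrop m n o)) := by
  let S : StarSubalgebra ℂ (Matrix Y Y ℂ) := (fibreAlg B t).comap ι
  have hS : ∀ a ∈ S, ∀ b ∈ S, a * b = b * a := by
    intro a ha b hb
    apply hinj
    rw [map_mul, map_mul]
    exact fibreAlg_comm hB t _ ha _ hb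
  have hmap : (Subalgebra.toSubmodule S.toSubalgebra).map ι.toAlgHom.toLinearMap = fibre B t := by
    ext x
    constructor
    · rintro ⟨a, ha, rfl⟩
      exact ha
    · rintro ⟨b, hb, rfl⟩
      obtain ⟨a, ha⟩ := hι b
      exact ⟨a, ⟨b, hb, ha.symm⟩, ha⟩
  have hdimS : Module.finrank ℂ S = Fintype.card Y := by
    rw [← hdim, ← hmap]
    exact (Submodule.equivMapOfInjective ι.toAlgHom.toLinearMap hinj
      (Subalgebra.toSubmodule S.toSubalgebra)).finrank_eq
  obtain ⟨u, hu, hSu⟩ := exists_unitary_mem_iff_of_finrank S hS hdimS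
  have huu := (Matrix.mem_unitaryGroup_iff').1 hu
  have huu' := (Matrix.mem_unitaryGroup_iff).1 hu
  let q : Y → Matrix Y Y ℂ := fun y => u * Matrix.single y y 1 * star u
  have hq : ∀ y, q y ∈ S := by
    intro y
    rw [hSu, conj_conj hu]
    intro i j hij
    exact Matrix.single_apply_of_ne _ _ _ _ _ (by rintro ⟨rfl, rfl⟩; exact hij rfl)
  have hqx : ∀ y x, q y * x * q y = (star u * x * u) y y • q y := by
    intro y x
    calc _ = u * (Matrix.single y y 1 * (star u * x * u) * Matrix.single y y 1) * star u := by
          simp only [q, mul_assoc]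
      _ = _ := by
          simp only [q]
          rw [Matrix.single_mul_mul_single, one_mul, mul_one, ← smul_mul_assoc,
            ← mul_smul_comm, Matrix.smul_single, smul_eq_mul, mul_one]
  have hb : ∀ y, ∃ b : B, evalHom m n o t b = ι (q y) := fun y => by
    obtain ⟨b, hb, hbt⟩ := hq y
    exact ⟨⟨b, hb⟩, hbt⟩
  choose b hb using hb
  refine ⟨b, ?_, fun y => ?_, fun y x => ?_⟩
  · rw [map_sum]
    simp only [hb]
    rw [← map_sum, ← map_one ι]
    congr 1
    simp only [q]
    rw [← Finset.sum_mul, ← Finset.mul_sum, Matrix.sum_single_one, mul_one, huu']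
  · rw [map_mul, hb, ← map_mul]
    congr 1
    have := hqx y 1
    rw [mul_one, mul_one, huu, Matrix.one_apply_eq, one_smul] at this
    exact this
  · obtain ⟨a, ha⟩ := hι x
    refine ⟨(star u * a * u) y y, ?_⟩
    rw [map_mul, map_mul, hb, ← ha, ← map_mul, ← map_mul, hqx, map_smul, map_smul, hb]

theorem IsMASA.pureState_mul {A : Type*} [CStarAlgebra A] {B : StarSubalgebra ℂ A} (hB : IsMASA B)
    {φ : B →ₗ[ℂ] ℂ} (hφ : φ ∈ pureStates B) (x y : B) : φ (x * y) = φ x * φ y := by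
  have := hB.isClosed
  let _ : CStarAlgebra B := StarSubalgebra.cstarAlgebra B
  exact CartanDimDrop.pureState_mul (A := B) hφ
    (fun x y => Subtype.ext (hB.mul_comm x.2 y.2)) x y

theorem exists_minimal_of_isNonDegenerate (hm : 1 ≤ m) (hn : 1 ≤ n) (hB : IsMASA B)
    {E : dimDrop m n o →ₗ[ℂ] dimDrop m n o} (hE : IsConditionalExpectation B E)
    (hnd : IsNonDegenerate B) (t : I) : ∃ (Y : Type) (_ : Fintype Y) (b : Y → B),
      evalHom m n o t (∑ y, (b y : dimDrop m n o)) = 1 ∧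
      (∀ y, evalHom m n o t (b y * b y) = evalHom m n o t (b y)) ∧
      ∀ y (x : dimDrop m n o), ∃ c : ℂ,
        evalHom m n o t (b y * x * b y) = evalHom m n o t (c • (b y : dimDrop m n o)) := by
  by_cases h0 : t = 0
  · subst h0
    exact ⟨_, _, exists_minimal_of_finrank hB 0 (embedLeft m n o)
      (injective_of_trace _ n (by omega) trace_embedLeft) (fun f => f.2.1) (by simpa using hnd.1)⟩
  by_cases h1 : t = 1
  · subst h1
    exact ⟨_, _, exists_minimal_of_finrank hB 1 (embedRight m n o)
      (injective_of_trace _ m (by omega) trace_embedRight) (fun f => f.2.2) (by simpa using hnd.2)⟩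
  refine ⟨_, _, exists_minimal_of_finrank hB t (StarAlgHom.id ℂ (Mat3 m n o))
    Function.injective_id (fun f => ⟨_, rfl⟩) ?_⟩
  obtain ⟨u, hu, hF⟩ := exists_unitary_fibre_interior hB hE h0 h1
  have : fibre B t = (diagHom u hu).toLinearMap.range := by
    ext x
    exact (hF x).trans (isDiag_conj_iff hu x)
  rw [this, finrank_range_diagHom]

/-- Multiplicativity puts the kernel of `φ`, in particular `1 - b`, into the left and right null
spaces of `ψ`. -/
theorem state_mul_of_apply_eq_one {φ : B →ₗ[ℂ] ℂ} (h1 : φ 1 = 1)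
    (hmul : ∀ x y, φ (x * y) = φ x * φ y) {b : B} (hb : φ b = 1)
    {ψ : dimDrop m n o →ₗ[ℂ] ℂ} (hψ : ψ ∈ states (dimDrop m n o)) (hψB : ∀ b : B, ψ b = φ b)
    (x : dimDrop m n o) : ψ (b * x * b) = ψ x := by
  have hz : ∀ z : B, φ z = 0 → ∀ y : dimDrop m n o, ψ (z * y) = 0 ∧ ψ (y * z) = 0 := by
    intro z hz y
    have h1 : ψ (star (star (z : dimDrop m n o)) * star (z : dimDrop m n o)) = 0 := by
      have := hψB (z * star z)
      rw [hmul, hz, zero_mul] at this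
      rw [star_star]
      exact this
    have h2 : ψ (star (z : dimDrop m n o) * (z : dimDrop m n o)) = 0 := by
      have := hψB (star z * z)
      rw [hmul, hz, mul_zero] at this
      exact this
    have h3 := (state_mul_eq_zero hψ h1 y).1
    have h4 := (state_mul_eq_zero hψ h2 (star y)).2
    rw [star_star] at h3 h4
    exact ⟨h3, h4⟩
  have hb0 : φ (1 - b) = 0 := by rw [map_sub, h1, hb, sub_self]
  have h2 : ψ x = ψ (b * x) := by
    have := (hz _ hb0 x).1
    change ψ ((1 - (b : dimDrop m n o)) * x) = 0 at this
    rw [sub_mul, one_mul, map_sub] at this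
    exact sub_eq_zero.1 this
  have h3 : ψ (b * x) = ψ (b * x * b) := by
    have := (hz _ hb0 (b * x)).2
    change ψ (b * x * (1 - (b : dimDrop m n o))) = 0 at this
    rw [mul_sub, mul_one, map_sub] at this
    exact sub_eq_zero.1 this
  rw [h2, h3]

/-- The composition of a functional on `B` with the conditional expectation. -/
def extendState {E : dimDrop m n o →ₗ[ℂ] dimDrop m n o} (hE : IsConditionalExpectation B E)
    (φ : B →ₗ[ℂ] ℂ) : dimDrop m n o →ₗ[ℂ] ℂ where
  toFun x := φ ⟨E x, hE.mem x⟩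
  map_add' x y := by
    rw [← map_add]; exact congrArg φ (Subtype.ext (E.map_add x y))
  map_smul' c x := by
    rw [RingHom.id_apply, ← map_smul]; exact congrArg φ (Subtype.ext (E.map_smul c x))

theorem extendState_apply_coe {E : dimDrop m n o →ₗ[ℂ] dimDrop m n o}
    (hE : IsConditionalExpectation B E) (φ : B →ₗ[ℂ] ℂ) (b : B) : extendState hE φ b = φ b :=
  congrArg φ (Subtype.ext (hE.apply_of_mem b b.2))

theorem extendState_mem {E : dimDrop m n o →ₗ[ℂ] dimDrop m n o}
    (hE : IsConditionalExpectation B E) {φ : B →ₗ[ℂ] ℂ} (hφ : φ ∈ states B) :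
    extendState hE φ ∈ states (dimDrop m n o) := by
  refine ⟨(extendState_apply_coe hE φ 1).trans hφ.1, fun x => ?_⟩
  obtain ⟨y, hy, hxy⟩ := hE.positive x
  have : extendState hE φ (star x * x) = φ (star ⟨y, hy⟩ * ⟨y, hy⟩) :=
    congrArg φ (Subtype.ext hxy)
  rw [this]
  exact hφ.2 _

/-- Modulo elements vanishing at `t`, the `b y` are idempotents with sum `1`; their values under `φ`
are `0` or `1` and add to `1`. -/
theorem exists_apply_eq_one {φ : B →ₗ[ℂ] ℂ} (h1 : φ 1 = 1) (hmul : ∀ x y, φ (x * y) = φ x * φ y)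
    {t : I} (hvan : ∀ b : B, evalHom m n o t b = 0 → φ b = 0) {Y : Type} [Fintype Y] (b : Y → B)
    (hb1 : evalHom m n o t (∑ y, (b y : dimDrop m n o)) = 1)
    (hb2 : ∀ y, evalHom m n o t (b y * b y) = evalHom m n o t (b y)) : ∃ y, φ (b y) = 1 := by
  have hsum : ∑ y, φ (b y) = 1 := by
    have h2 := hvan (∑ y, b y - 1) (by
      rw [AddSubgroupClass.coe_sub, AddSubmonoidClass.coe_finsetSum, OneMemClass.coe_one, map_sub,
        hb1, map_one, sub_self])
    rw [map_sub, h1, map_sum] at h2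
    exact sub_eq_zero.1 h2
  obtain ⟨y, -, hy⟩ := Finset.exists_ne_zero_of_sum_ne_zero (hsum ▸ one_ne_zero)
  refine ⟨y, ?_⟩
  have h2 := hvan (b y * b y - b y) (by
    rw [AddSubgroupClass.coe_sub, MulMemClass.coe_mul, map_sub, hb2, sub_self])
  rw [map_sub, hmul] at h2
  exact mul_left_cancel₀ hy (by rw [mul_one]; exact sub_eq_zero.1 h2)

/-- A non-degenerate Cartan subalgebra has the unique extension property. -/
theorem uniqueExtension_of_isNonDegenerate (hm : 1 ≤ m) (hn : 1 ≤ n) (hB : IsCartan B)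
    (hnd : IsNonDegenerate B) : HasUniqueExtensionProperty B := by
  intro φ hφ
  obtain ⟨E, hE, -⟩ := hB.expectation
  have hstate : φ ∈ states B := hφ.1
  have hmul := hB.masa.pureState_mul hφ
  have hψ₀B := extendState_apply_coe hE φ
  have hψ₀ := extendState_mem hE hstate
  obtain ⟨t, ht⟩ := exists_point_of_mul hB.masa hstate.1 hmul
  have hscal : ∀ ψ : dimDrop m n o →ₗ[ℂ] ℂ, (∀ b : B, ψ b = φ b) →
      ∀ g, ψ (scalarHom m n o g) = g t := fun ψ hψ g =>
    (hψ ⟨scalarHom m n o g, scalarHom_mem hB.masa g⟩).trans (ht g)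
  have hvan : ∀ b : B, evalHom m n o t b = 0 → φ b = 0 := fun b hb => by
    rw [← hψ₀B]
    exact state_eq_zero_of_evalHom_eq_zero hψ₀ (hscal _ hψ₀B) hb
  obtain ⟨Y, _, b, hb1, hb2, hb3⟩ := exists_minimal_of_isNonDegenerate hm hn hB.masa hE hnd t
  obtain ⟨y, hbφ⟩ := exists_apply_eq_one hstate.1 hmul hvan b hb1 hb2
  -- The scalar `c` depends on `x` and the minimal projection only, so all extensions of `φ` agree.
  have hval : ∀ ψ ∈ states (dimDrop m n o), (∀ b : B, ψ b = φ b) → ∀ x (c : ℂ),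
      evalHom m n o t (b y * x * b y) = evalHom m n o t (c • (b y : dimDrop m n o)) → ψ x = c := by
    intro ψ hψ hψB x c hc
    have h3 := state_eq_zero_of_evalHom_eq_zero hψ (hscal ψ hψB)
      (y := b y * x * b y - c • (b y : dimDrop m n o)) (by rw [map_sub, hc, sub_self])
    rw [map_sub, map_smul, hψB, hbφ, smul_eq_mul, mul_one,
      state_mul_of_apply_eq_one hstate.1 hmul hbφ hψ hψB] at h3
    exact sub_eq_zero.1 h3
  refine ⟨extendState hE φ, ⟨hψ₀, hψ₀B⟩, ?_⟩
  rintro ψ ⟨hψ, hψB⟩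
  ext x
  obtain ⟨c, hc⟩ := hb3 y x
  rw [hval ψ hψ hψB x c hc, hval _ hψ₀ hψ₀B x c hc]

end Extension

/-! ### Bases in good position to a matrix subalgebra. -/

section Compression

variable {X : Type*} [Fintype X] [DecidableEq X]

/-- The compression to the diagonal with respect to the columns of `u`. -/
def compress (u : Matrix X X ℂ) : Matrix X X ℂ →ₗ[ℂ] Matrix X X ℂ where
  toFun x := u * Matrix.diagonal (Matrix.diag (star u * x * u)) * star u
  map_add' x y := by
    rw [mul_add, add_mul, Matrix.diag_add]
    have : Matrix.diagonal (Matrix.diag (star u * x * u) + Matrix.diag (star u * y * u))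
        = Matrix.diagonal (Matrix.diag (star u * x * u))
          + Matrix.diagonal (Matrix.diag (star u * y * u)) := (Matrix.diagonal_add _ _).symm
    rw [this, mul_add, add_mul]
  map_smul' c x := by
    rw [mul_smul_comm, smul_mul_assoc, Matrix.diag_smul, Matrix.diagonal_smul, mul_smul_comm,
      smul_mul_assoc, RingHom.id_apply]

theorem compress_apply (u x : Matrix X X ℂ) :
    compress u x = u * Matrix.diagonal (Matrix.diag (star u * x * u)) * star u := rfl

/-- A subalgebra `R` and the diagonal algebra of the columns of `u` are in good position: the
compression preserves `R`, and `R` is spanned by normalisers. -/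
structure IsGood (R : StarSubalgebra ℂ (Matrix X X ℂ)) (u : Matrix X X ℂ) : Prop where
  unitary : u ∈ Matrix.unitaryGroup X ℂ
  compress_mem : ∀ x ∈ R, compress u x ∈ R
  le_span : ∀ x ∈ R, x ∈ Submodule.span ℂ {x | x ∈ R ∧ IsMonomial (star u * x * u)}

/-- On the finitely many values of `d` any function `g` is a polynomial. This keeps square roots of
compressed elements inside the boundary algebras. -/
theorem diagHom_comp_mem (R : Subalgebra ℂ (Matrix X X ℂ)) {u : Matrix X X ℂ}
    (hu : u ∈ Matrix.unitaryGroup X ℂ) (g : ℂ → ℂ) {d : X → ℂ} (hd : diagHom u hu d ∈ R) :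
    diagHom u hu (g ∘ d) ∈ R := by
  classical
  let P := Lagrange.interpolate (Finset.univ.image d) id g
  have hP : Polynomial.aeval d P = g ∘ d := by
    ext i
    have h1 : (Polynomial.aeval d P) i = P.eval (d i) := by simp
    rw [h1]
    exact Lagrange.eval_interpolate_at_node (v := id) g (Function.injective_id.injOn)
      (Finset.mem_image_of_mem d (Finset.mem_univ i))
  rw [← hP, ← Polynomial.aeval_algHom_apply]
  have : Polynomial.aeval (diagHom u hu d) P
      = ((Polynomial.aeval (⟨diagHom u hu d, hd⟩ : R) P : R) : Matrix X X ℂ) := by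
    rw [← Subalgebra.coe_val, ← Polynomial.aeval_algHom_apply]; rfl
  rw [this]
  exact Subtype.prop _

theorem isDiag_mul {a b : Matrix X X ℂ} (ha : a.IsDiag) (hb : b.IsDiag) : (a * b).IsDiag := by
  rw [← ha.diagonal_diag, ← hb.diagonal_diag, Matrix.diagonal_mul_diagonal]
  exact Matrix.isDiag_diagonal _

theorem isDiag_conj_of_isMonomial {a d : Matrix X X ℂ} (ha : IsMonomial a) (hd : d.IsDiag) :
    (a * d * star a).IsDiag := by
  intro i j hij
  rw [← hd.diagonal_diag, Matrix.mul_apply]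
  refine Finset.sum_eq_zero fun k _ => ?_
  rw [Matrix.mul_diagonal, Matrix.star_apply]
  by_contra hne
  obtain ⟨h1, h2⟩ := mul_ne_zero_iff.1 hne
  exact hij (ha.1 k i j (left_ne_zero_of_mul h1) (by simpa using h2))

end Compression

/-! ### Cartan subalgebras from paths of orthonormal bases. -/

section PathAlgebra

variable {m n o : ℕ} (u : C(I, Mat3 m n o))
  (hu : ∀ t, u t ∈ Matrix.unitaryGroup (Fin m × Fin n × Fin o) ℂ)

/-- The functions that are diagonal with respect to the columns of `u t` at each point `t`. -/
def pathAlg : StarSubalgebra ℂ (dimDrop m n o) where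
  carrier := {f | ∀ t, (conjHom (u t) (hu t) (evalHom m n o t f)).IsDiag}
  mul_mem' hf hg t := by rw [map_mul, map_mul]; exact isDiag_mul (hf t) (hg t)
  add_mem' hf hg t := by rw [map_add, map_add]; exact (hf t).add (hg t)
  algebraMap_mem' r t := by
    rw [AlgHomClass.commutes, AlgHomClass.commutes, Algebra.algebraMap_eq_smul_one]
    exact Matrix.isDiag_one.smul r
  star_mem' hf t := by rw [map_star, map_star]; exact (hf t).conjTranspose

theorem continuous_evalHom_left (f : dimDrop m n o) : Continuous fun t => evalHom m n o t f :=
  f.1.continuous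

/-- The pointwise compression to the diagonal. -/
def pathExp (h0 : IsGood (embedLeft m n o).range (u 0)) (h1 : IsGood (embedRight m n o).range (u 1)) :
    dimDrop m n o →ₗ[ℂ] dimDrop m n o where
  toFun f := ⟨⟨fun t => compress (u t) (evalHom m n o t f), by
      have hf := continuous_evalHom_left f
      have h : Continuous fun t => star (u t) * evalHom m n o t f * u t := by fun_prop
      have h2 : Continuous fun t =>
          Matrix.diagonal (Matrix.diag (star (u t) * evalHom m n o t f * u t)) :=
        h.matrix_diag.matrix_diagonal
      simp only [compress_apply]
      fun_prop⟩,
    h0.compress_mem _ f.2.1, h1.compress_mem _ f.2.2⟩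
  map_add' f g := by
    ext t : 1
    exact (congrArg (compress (u t)) (map_add (evalHom m n o t) f g)).trans (map_add _ _ _)
  map_smul' c f := by
    ext t : 1
    exact (congrArg (compress (u t)) (map_smul (evalHom m n o t) c f)).trans (map_smul _ _ _)

variable {u}

theorem evalHom_pathExp (h0 : IsGood (embedLeft m n o).range (u 0))
    (h1 : IsGood (embedRight m n o).range (u 1)) (f : dimDrop m n o) (t : I) :
    evalHom m n o t (pathExp u h0 h1 f) = compress (u t) (evalHom m n o t f) := rfl

theorem isConditionalExpectation_pathExp (h0 : IsGood (embedLeft m n o).range (u 0))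
    (h1 : IsGood (embedRight m n o).range (u 1)) :
    IsConditionalExpectation (pathAlg u hu) (pathExp u h0 h1) where
  mem x t := by
    rw [evalHom_pathExp, compress_apply, conjHom_apply, conj_conj (hu t)]
    exact Matrix.isDiag_diagonal _
  apply_of_mem b hb := by
    ext t : 1
    have h := (hb t).diagonal_diag
    rw [conjHom_apply] at h
    rw [evalHom_pathExp, compress_apply, h, conj_conj' (hu t)]
  bimodule b hb c hc x := by
    ext t : 1
    have key : ∀ y, conjHom (u t) (hu t) (compress (u t) y)
        = Matrix.diagonal (Matrix.diag (conjHom (u t) (hu t) y)) := fun y => by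
      rw [compress_apply, conjHom_apply, conj_conj (hu t)]; rfl
    have hinj : Function.Injective (conjHom (u t) (hu t)) := fun x y h => by
      have := congrArg (fun a => u t * a * star (u t)) h
      simpa only [conjHom_apply, conj_conj' (hu t)] using this
    apply hinj
    rw [evalHom_pathExp, key, map_mul, map_mul, map_mul, map_mul, map_mul, map_mul, map_mul,
      map_mul, evalHom_pathExp, key, ← (hb t).diagonal_diag, ← (hc t).diagonal_diag,
      Matrix.diagonal_mul_diagonal, Matrix.diagonal_mul_diagonal]
    congr 1
    ext i
    simp [Matrix.mul_diagonal, Matrix.diagonal_mul]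
  positive x := by
    let d : I → (Fin m × Fin n × Fin o) → ℂ :=
      fun t => Matrix.diag (star (u t) * evalHom m n o t (star x * x) * u t)
    -- The witness is the square root of the compressed `star x * x`, taken entrywise in the frame;
    -- these diagonal entries are sums of squares, so taking the real part loses nothing.
    let g : ℂ → ℂ := fun z => (Real.sqrt z.re : ℂ)
    have hx := continuous_evalHom_left (star x * x)
    have h : Continuous fun t => star (u t) * evalHom m n o t (star x * x) * u t := by fun_prop
    have hg : Continuous g := by fun_prop
    have hd : Continuous d := h.matrix_diag
    have hcont : Continuous fun t => u t * Matrix.diagonal (g ∘ d t) * star (u t) := by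
      have h2 : Continuous fun t => g ∘ d t :=
        continuous_pi fun i => hg.comp (continuous_pi_iff.1 hd i)
      have h3 := h2.matrix_diagonal
      fun_prop
    let y : dimDrop m n o := ⟨⟨fun t => u t * Matrix.diagonal (g ∘ d t) * star (u t), hcont⟩,
      diagHom_comp_mem (embedLeft m n o).range.toSubalgebra (hu 0) g
        (h0.compress_mem _ (star x * x).2.1),
      diagHom_comp_mem (embedRight m n o).range.toSubalgebra (hu 1) g
        (h1.compress_mem _ (star x * x).2.2)⟩
    have hyt : ∀ t, evalHom m n o t y = diagHom (u t) (hu t) (g ∘ d t) := fun t => rfl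
    refine ⟨y, fun t => ?_, ?_⟩
    · rw [hyt]
      exact (isDiag_conj_iff (hu t) _).2 ⟨_, rfl⟩
    · ext t : 1
      have hdi : ∀ i, star (g (d t i)) * g (d t i) = d t i := by
        intro i
        have hnn : d t i
            = ((∑ k, Complex.normSq ((evalHom m n o t x * u t) k i) : ℝ) : ℂ) := by
          have : star (u t) * evalHom m n o t (star x * x) * u t
              = star (evalHom m n o t x * u t) * (evalHom m n o t x * u t) := by
            rw [map_mul, map_star, star_mul]; simp only [mul_assoc]
          simp only [d]
          rw [this, Matrix.diag_apply, Matrix.mul_apply]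
          push_cast
          refine Finset.sum_congr rfl fun k _ => ?_
          rw [Matrix.star_apply, Complex.normSq_eq_conj_mul_self]; rfl
        have hpos : 0 ≤ ∑ k, Complex.normSq ((evalHom m n o t x * u t) k i) :=
          Finset.sum_nonneg fun k _ => Complex.normSq_nonneg _
        rw [hnn]
        simp only [g, Complex.ofReal_re]
        rw [Complex.star_def, Complex.conj_ofReal, ← Complex.ofReal_mul, Real.mul_self_sqrt hpos]
      rw [evalHom_pathExp, compress_apply, map_mul (evalHom m n o t) (star y), map_star, hyt,
        diagHom_apply]
      have huu := (Matrix.mem_unitaryGroup_iff').1 (hu t)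
      have e1 : star (u t * Matrix.diagonal (g ∘ d t) * star (u t))
          * (u t * Matrix.diagonal (g ∘ d t) * star (u t))
          = u t * (star (Matrix.diagonal (g ∘ d t)) * Matrix.diagonal (g ∘ d t)) * star (u t) := by
        simp only [star_mul, star_star]
        calc _ = u t * star (Matrix.diagonal (g ∘ d t)) * (star (u t) * u t)
              * Matrix.diagonal (g ∘ d t) * star (u t) := by simp only [mul_assoc]
          _ = _ := by rw [huu]; simp only [mul_assoc, one_mul]
      rw [e1, Matrix.star_eq_conjTranspose (Matrix.diagonal _), Matrix.diagonal_conjTranspose,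
        Matrix.diagonal_mul_diagonal]
      congr 3
      ext i
      exact (hdi i).symm

/-- The diagonal of `star x * x` in the frame carries its trace, which vanishes only for `x = 0`. -/
theorem pathExp_faithful (hu : ∀ t, u t ∈ Matrix.unitaryGroup (Fin m × Fin n × Fin o) ℂ)
    (h0 : IsGood (embedLeft m n o).range (u 0))
    (h1 : IsGood (embedRight m n o).range (u 1)) (x : dimDrop m n o)
    (hx : pathExp u h0 h1 (star x * x) = 0) : x = 0 := by
  ext t : 1
  have h2 := congrArg (fun f => conjHom (u t) (hu t) (evalHom m n o t f)) hx
  simp only [map_zero] at h2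
  rw [evalHom_pathExp, compress_apply, conjHom_apply, conj_conj (hu t)] at h2
  have h3 : star (u t) * evalHom m n o t (star x * x) * u t
      = (evalHom m n o t x * u t)ᴴ * (evalHom m n o t x * u t) := by
    rw [map_mul, map_star, ← Matrix.star_eq_conjTranspose, star_mul]; simp only [mul_assoc]
  have h4 : ((evalHom m n o t x * u t)ᴴ * (evalHom m n o t x * u t)).trace = 0 := by
    rw [← h3]
    refine Finset.sum_eq_zero fun i _ => ?_
    have := congrFun (congrFun h2 i) i
    rwa [Matrix.diagonal_apply_eq] at this
  have h5 := Matrix.trace_conjTranspose_mul_self_eq_zero_iff.1 h4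
  have h6 := congrArg (fun a => a * star (u t)) h5
  simpa only [mul_assoc, (Matrix.mem_unitaryGroup_iff).1 (hu t), mul_one, zero_mul,
    map_zero] using h6

/-- A matrix with scalar coefficients in the moving frame. -/
def frameFun (u : C(I, Mat3 m n o)) (c : C(I, ℂ)) (h0 : c 0 = 0) (h1 : c 1 = 0)
    (x : Mat3 m n o) : dimDrop m n o :=
  ofVanishing ⟨fun t => c t • (u t * x * star (u t)), by fun_prop⟩ (by simp [h0]) (by simp [h1])

theorem evalHom_frameFun (c : C(I, ℂ)) (h0 : c 0 = 0) (h1 : c 1 = 0)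
    (x : Mat3 m n o) (t : I) :
    evalHom m n o t (frameFun u c h0 h1 x) = c t • (u t * x * star (u t)) := rfl

theorem conj_frameFun (hu : ∀ t, u t ∈ Matrix.unitaryGroup (Fin m × Fin n × Fin o) ℂ)
    (c : C(I, ℂ)) (h0 : c 0 = 0) (h1 : c 1 = 0)
    (x : Mat3 m n o) (t : I) :
    star (u t) * evalHom m n o t (frameFun u c h0 h1 x) * u t = c t • x := by
  rw [evalHom_frameFun, mul_smul_comm, smul_mul_assoc, conj_conj (hu t)]

theorem isMASA_pathAlg : IsMASA (pathAlg u hu) := by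
  refine ⟨⟨?_, ?_⟩, ?_⟩
  · have : (pathAlg u hu : Set (dimDrop m n o)) = ⋂ t, ⋂ i, ⋂ j, ⋂ (_ : i ≠ j),
        {f | (star (u t) * evalHom m n o t f * u t) i j = 0} := by
      ext f
      simp only [Set.mem_iInter]
      rfl
    rw [this]
    refine isClosed_iInter fun t => isClosed_iInter fun i => isClosed_iInter fun j =>
      isClosed_iInter fun _ => ?_
    have h := continuous_evalHom (m := m) (n := n) (o := o) t
    have h2 : Continuous fun f => star (u t) * evalHom m n o t f * u t := by fun_prop
    exact isClosed_eq (h2.matrix_elem i j) continuous_const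
  · intro x hx y hy
    ext t : 1
    obtain ⟨f, hf⟩ := (isDiag_conj_iff (hu t) _).1 (hx t)
    obtain ⟨g, hg⟩ := (isDiag_conj_iff (hu t) _).1 (hy t)
    rw [map_mul, map_mul, ← hf, ← hg]
    change diagHom _ _ f * diagHom _ _ g = diagHom _ _ g * diagHom _ _ f
    rw [← map_mul, ← map_mul, mul_comm]
  · rintro C ⟨-, hC⟩ hle c hc t i j hij
    have hcl : IsClosed {t : I | (star (u t) * evalHom m n o t c * u t) i j = 0} := by
      have h := continuous_evalHom_left c
      have h2 : Continuous fun t => star (u t) * evalHom m n o t c * u t := by fun_prop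
      exact isClosed_eq (h2.matrix_elem i j) continuous_const
    -- In the interior, commuting with `bump` times the projection onto a frame vector kills
    -- off-diagonal entries; continuity extends this to the endpoints.
    refine closure_minimal ?_ hcl (mem_closure_interior t)
    rintro s ⟨hs0, hs1⟩
    let b := frameFun u bump bump_zero bump_one (Matrix.single i i 1)
    have hb : b ∈ pathAlg u hu := by
      intro r
      rw [conjHom_apply, conj_frameFun hu]
      refine Matrix.IsDiag.smul _ ?_
      intro p q hpq
      exact Matrix.single_apply_of_ne _ _ _ _ _ (by rintro ⟨rfl, rfl⟩; exact hpq rfl)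
    have h1 := congrArg (fun f => conjHom (u s) (hu s) (evalHom m n o s f)) (hC _ (hle hb) _ hc)
    simp only [map_mul] at h1
    rw [conjHom_apply (u s) (hu s) (evalHom m n o s b), conj_frameFun hu, smul_mul_assoc,
      mul_smul_comm] at h1
    have h2 := congrFun (congrFun (smul_right_injective _ (bump_ne_zero hs0 hs1) h1) i) j
    rw [Matrix.single_mul_apply_same, Matrix.mul_single_apply_of_ne _ _ _ _ _ hij.symm,
      one_mul] at h2
    exact h2

theorem mem_normaliser_of_isMonomial {f : dimDrop m n o}
    (hf : ∀ t, IsMonomial (star (u t) * evalHom m n o t f * u t)) :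
    f ∈ normaliser (pathAlg u hu) := by
  intro b hb
  constructor <;> intro t
  · rw [map_mul, map_mul, map_mul, map_mul, map_star, map_star]
    exact isDiag_conj_of_isMonomial (hf t) (hb t)
  · rw [map_mul, map_mul, map_mul, map_mul, map_star, map_star]
    have := isDiag_conj_of_isMonomial (IsMonomial.star (hf t)) (hb t)
    rw [star_star] at this
    exact this

theorem IsMonomial.smul {X : Type*} {a : Matrix X X ℂ} (ha : IsMonomial a) (c : ℂ) :
    IsMonomial (c • a) := by
  refine ⟨fun x y z h1 h2 => ha.1 x y z ?_ ?_, fun x y z h1 h2 => ha.2 x y z ?_ ?_⟩ <;>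
  · rw [Matrix.smul_apply] at h1 h2
    first
    | exact right_ne_zero_of_mul h1
    | exact right_ne_zero_of_mul h2

theorem isMonomial_single {X : Type*} [DecidableEq X] (i j : X) :
    IsMonomial (Matrix.single i j (1 : ℂ)) := by
  have h : ∀ x y, Matrix.single i j (1 : ℂ) x y ≠ 0 → i = x ∧ j = y := by
    intro x y h
    by_contra hne
    exact h (Matrix.single_apply_of_ne _ _ _ _ _ hne)
  exact ⟨fun x y z h1 h2 => (h _ _ h1).1.symm.trans (h _ _ h2).1,
    fun x y z h1 h2 => (h _ _ h1).2.symm.trans (h _ _ h2).2⟩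

/-- A monomial element at `0` is transported with constant coefficients along the moving frame and
damped by `1 - t`, which gives a normaliser of the path algebra. -/
theorem exists_mem_adjoin_zero (h0 : IsGood (embedLeft m n o).range (u 0)) (x : Mat3 m n o)
    (hx : x ∈ (embedLeft m n o).range) :
    ∃ f ∈ StarAlgebra.adjoin ℂ (normaliser (pathAlg u hu)),
      evalHom m n o 0 f = x ∧ evalHom m n o 1 f = 0 := by
  have hs := h0.le_span x hx
  clear hx
  induction hs using Submodule.span_induction with
  | mem x hx =>
    let G : C(I, Mat3 m n o) := ⟨fun t => (1 - ((t : ℝ) : ℂ)) •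
      (u t * (star (u 0) * x * u 0) * star (u t)), by fun_prop⟩
    have hG0 : G 0 = x := by simp [G, conj_conj' (hu 0)]
    have hG1 : G 1 = 0 := by simp [G]
    refine ⟨⟨G, by rw [hG0]; exact hx.1, by rw [hG1]; exact zero_mem _⟩,
      StarAlgebra.subset_adjoin ℂ _ (mem_normaliser_of_isMonomial hu fun t => ?_), hG0, hG1⟩
    change IsMonomial (star (u t) * ((1 - ((t : ℝ) : ℂ)) •
      (u t * (star (u 0) * x * u 0) * star (u t))) * u t)
    rw [mul_smul_comm, smul_mul_assoc, conj_conj (hu t)]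
    exact hx.2.smul _
  | zero => exact ⟨0, zero_mem _, map_zero _, map_zero _⟩
  | add x y _ _ hx hy =>
    obtain ⟨f, hf, hf0, hf1⟩ := hx
    obtain ⟨g, hg, hg0, hg1⟩ := hy
    exact ⟨f + g, add_mem hf hg, by rw [map_add, hf0, hg0], by rw [map_add, hf1, hg1, add_zero]⟩
  | smul c x _ hx =>
    obtain ⟨f, hf, hf0, hf1⟩ := hx
    exact ⟨c • f, StarSubalgebra.smul_mem _ hf c, by rw [map_smul, hf0],
      by rw [map_smul, hf1, smul_zero]⟩

theorem exists_mem_adjoin_one (h1 : IsGood (embedRight m n o).range (u 1)) (x : Mat3 m n o)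
    (hx : x ∈ (embedRight m n o).range) :
    ∃ f ∈ StarAlgebra.adjoin ℂ (normaliser (pathAlg u hu)),
      evalHom m n o 0 f = 0 ∧ evalHom m n o 1 f = x := by
  have hs := h1.le_span x hx
  clear hx
  induction hs using Submodule.span_induction with
  | mem x hx =>
    let G : C(I, Mat3 m n o) := ⟨fun t => ((t : ℝ) : ℂ) •
      (u t * (star (u 1) * x * u 1) * star (u t)), by fun_prop⟩
    have hG0 : G 0 = 0 := by simp [G]
    have hG1 : G 1 = x := by simp [G, conj_conj' (hu 1)]
    refine ⟨⟨G, by rw [hG0]; exact zero_mem _, by rw [hG1]; exact hx.1⟩,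
      StarAlgebra.subset_adjoin ℂ _ (mem_normaliser_of_isMonomial hu fun t => ?_), hG0, hG1⟩
    change IsMonomial (star (u t) * (((t : ℝ) : ℂ) •
      (u t * (star (u 1) * x * u 1) * star (u t))) * u t)
    rw [mul_smul_comm, smul_mul_assoc, conj_conj (hu t)]
    exact hx.2.smul _
  | zero => exact ⟨0, zero_mem _, map_zero _, map_zero _⟩
  | add x y _ _ hx hy =>
    obtain ⟨f, hf, hf0, hf1⟩ := hx
    obtain ⟨g, hg, hg0, hg1⟩ := hy
    exact ⟨f + g, add_mem hf hg, by rw [map_add, hf0, hg0, add_zero], by rw [map_add, hf1, hg1]⟩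
  | smul c x _ hx =>
    obtain ⟨f, hf, hf0, hf1⟩ := hx
    exact ⟨c • f, StarSubalgebra.smul_mem _ hf c, by rw [map_smul, hf0, smul_zero],
      by rw [map_smul, hf1]⟩

/-- Each matrix coefficient in the moving frame vanishes at both ends, so each summand belongs to
the algebra and is a multiple of a matrix unit in the frame. -/
theorem mem_adjoin_of_vanishing {f : dimDrop m n o} (hf0 : evalHom m n o 0 f = 0)
    (hf1 : evalHom m n o 1 f = 0) : f ∈ StarAlgebra.adjoin ℂ (normaliser (pathAlg u hu)) := by
  let c : (Fin m × Fin n × Fin o) → (Fin m × Fin n × Fin o) → C(I, ℂ) := fun p q =>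
    ⟨fun t => (star (u t) * evalHom m n o t f * u t) p q, by
      have h := continuous_evalHom_left f
      have h2 : Continuous fun t => star (u t) * evalHom m n o t f * u t := by fun_prop
      exact h2.matrix_elem p q⟩
  have hc0 : ∀ p q, c p q 0 = 0 := fun p q => by simp [c, hf0]
  have hc1 : ∀ p q, c p q 1 = 0 := fun p q => by simp [c, hf1]
  have hsum : f = ∑ p, ∑ q, frameFun u (c p q) (hc0 p q) (hc1 p q) (Matrix.single p q 1) := by
    ext t : 1
    simp only [map_sum, evalHom_frameFun]
    have h1 := single_expansion (star (u t) * evalHom m n o t f * u t)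
    have h2 := congrArg (fun x => u t * x * star (u t)) h1
    simp only [conj_conj' (hu t), Finset.mul_sum, Finset.sum_mul, mul_smul_comm,
      smul_mul_assoc] at h2
    exact h2
  rw [hsum]
  refine sum_mem fun p _ => sum_mem fun q _ => StarAlgebra.subset_adjoin ℂ _
    (mem_normaliser_of_isMonomial hu fun t => ?_)
  rw [conj_frameFun hu]
  exact (isMonomial_single p q).smul _

/-- For regularity, subtracting generated elements with the prescribed endpoint values leaves a
function that vanishes at both ends; normalisers generate algebraically, before closure. -/
theorem isCartan_pathAlg (h0 : IsGood (embedLeft m n o).range (u 0))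
    (h1 : IsGood (embedRight m n o).range (u 1)) : IsCartan (pathAlg u hu) where
  masa := isMASA_pathAlg hu
  regular := by
    rw [IsRegular, eq_top_iff]
    refine le_trans ?_ (StarSubalgebra.le_topologicalClosure _)
    intro f _
    obtain ⟨f₀, hf₀, h00, h01⟩ := exists_mem_adjoin_zero hu h0 _ f.2.1
    obtain ⟨f₁, hf₁, h10, h11⟩ := exists_mem_adjoin_one hu h1 _ f.2.2
    have hg : f - f₀ - f₁ ∈ StarAlgebra.adjoin ℂ (normaliser (pathAlg u hu)) :=
      mem_adjoin_of_vanishing hu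
        (by rw [map_sub, map_sub, h00, h10, sub_zero]; exact sub_self _)
        (by rw [map_sub, map_sub, h01, h11, sub_zero]; exact sub_self _)
    have : f = f - f₀ - f₁ + f₁ + f₀ := by abel
    rw [this]
    exact add_mem (add_mem hg hf₁) hf₀
  expectation := ⟨pathExp u h0 h1, isConditionalExpectation_pathExp hu h0 h1,
    pathExp_faithful hu h0 h1⟩

/-- Multiplicative states are pure. -/
theorem mem_pureStates_of_mul {A : Type*} [Ring A] [StarRing A] [Algebra ℂ A] [StarModule ℂ A]
    {φ : A →ₗ[ℂ] ℂ} (hφ : φ ∈ states A) (hmul : ∀ x y, φ (x * y) = φ x * φ y) :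
    φ ∈ pureStates A := by
  refine ⟨hφ, ?_⟩
  intro φ₁ h₁ φ₂ h₂ hseg
  obtain ⟨a, b, ha, hb, hab, hsum⟩ := hseg
  have hker : ∀ z, φ z = 0 → φ₁ z = 0 := by
    intro z hz
    have e1 : φ (star z * z) = 0 := by rw [hmul, hz, mul_zero]
    have e2 : a * φ₁ (star z * z) + b * φ₂ (star z * z) = 0 := by
      rw [← hsum] at e1
      exact e1
    have p1 : (0 : ℂ) ≤ a * φ₁ (star z * z) :=
      mul_nonneg (by exact_mod_cast ha.le) (h₁.2 z)
    have p2 : (0 : ℂ) ≤ b * φ₂ (star z * z) :=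
      mul_nonneg (by exact_mod_cast hb.le) (h₂.2 z)
    have e3 : a * φ₁ (star z * z) = 0 := ((add_eq_zero_iff_of_nonneg p1 p2).1 e2).1
    have e4 : φ₁ (star z * z) = 0 :=
      (mul_eq_zero.1 e3).resolve_left (by exact_mod_cast ha.ne')
    have := (state_mul_eq_zero h₁ e4 1).2
    simpa using this
  ext z
  have h := hker (z - φ z • 1) (by rw [map_sub, map_smul, hφ.1, smul_eq_mul, mul_one, sub_self])
  rw [map_sub, map_smul, h₁.1, smul_eq_mul, mul_one] at h
  exact sub_eq_zero.1 h

/-- If two diagonal entries agree on the fibre of a subalgebra at `t` but not on the whole algebra,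
then the unique extension property fails. -/
theorem not_uniqueExtension {B : StarSubalgebra ℂ (dimDrop m n o)} (t : I)
    (x x' : Fin m × Fin n × Fin o)
    (hxx : ∀ b ∈ B, evalHom m n o t b x x = evalHom m n o t b x' x')
    (hx : ∀ b ∈ B, ∀ z, z ≠ x → evalHom m n o t b x z = 0)
    (hne : ∃ f, evalHom m n o t f x x ≠ evalHom m n o t f x' x') :
    ¬ HasUniqueExtensionProperty B := by
  intro hU
  let ψ : (Fin m × Fin n × Fin o) → (dimDrop m n o →ₗ[ℂ] ℂ) := fun p =>
    { toFun := fun f => evalHom m n o t f p p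
      map_add' := fun f g => by rw [map_add]; rfl
      map_smul' := fun c f => by rw [map_smul]; rfl }
  have hψ : ∀ p, ψ p ∈ states (dimDrop m n o) := by
    intro p
    constructor
    · change evalHom m n o t 1 p p = 1
      rw [map_one, Matrix.one_apply_eq]
    · intro f
      change 0 ≤ evalHom m n o t (star f * f) p p
      rw [map_mul, map_star, Matrix.mul_apply]
      exact Finset.sum_nonneg fun k _ => by
        rw [Matrix.star_apply]; exact star_mul_self_nonneg _
  let φ : B →ₗ[ℂ] ℂ := (ψ x).comp (Subalgebra.toSubmodule B.toSubalgebra).subtype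
  have hφ : ∀ b : B, φ b = evalHom m n o t b x x := fun b => rfl
  have hmul : ∀ a b : B, φ (a * b) = φ a * φ b := by
    intro a b
    rw [hφ, hφ, hφ, MulMemClass.coe_mul, map_mul, Matrix.mul_apply, Finset.sum_eq_single x]
    · intro z _ hz
      rw [hx a a.2 z hz, zero_mul]
    · simp
  have hφs : φ ∈ states B := ⟨(hψ x).1, fun b => (hψ x).2 b⟩
  have hpure := mem_pureStates_of_mul hφs hmul
  obtain ⟨f, hf⟩ := hne
  have h1 : ψ x = ψ x' := (hU φ hpure).unique ⟨hψ x, fun b => rfl⟩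
    ⟨hψ x', fun b => (hxx b b.2).symm⟩
  exact hf (congrArg (fun F : dimDrop m n o →ₗ[ℂ] ℂ => F f) h1)

end PathAlgebra

open scoped Kronecker

/-! ### Connectedness of the unitary group. -/

section Paths

/-- The unitary group of a matrix algebra is path connected. -/
theorem exists_path_unitary {X : Type*} [Fintype X] [DecidableEq X] {v : Matrix X X ℂ}
    (hv : v ∈ Matrix.unitaryGroup X ℂ) :
    ∃ u : C(I, Matrix X X ℂ), (∀ t, u t ∈ Matrix.unitaryGroup X ℂ) ∧ u 0 = 1 ∧ u 1 = v := by
  have hvv := (Matrix.mem_unitaryGroup_iff).1 hv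
  have hvv' := (Matrix.mem_unitaryGroup_iff').1 hv
  have hnorm : IsStarNormal v := ⟨by rw [commute_iff_eq, hvv, hvv']⟩
  obtain ⟨w, hw, hd⟩ := exists_unitary_isDiag (StarAlgebra.adjoin ℂ {v}) fun a ha b hb => by
    have := StarAlgebra.isMulCommutative_adjoin_singleton ℂ v
    exact setLike_mul_comm ha hb
  have hww := (Matrix.mem_unitaryGroup_iff).1 hw
  have hww' := (Matrix.mem_unitaryGroup_iff').1 hw
  have hvd := hd v (StarAlgebra.self_mem_adjoin_singleton ℂ v)
  let d := Matrix.diag (star w * v * w)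
  have hvw : v = diagHom w hw d := by
    rw [diagHom_apply, hvd.diagonal_diag, conj_conj' hw]
  have hstar : ∀ f : X → ℂ, star (diagHom w hw f) = diagHom w hw (star f) := by
    intro f
    rw [diagHom_apply, diagHom_apply, star_mul, star_mul, star_star,
      Matrix.star_eq_conjTranspose (Matrix.diagonal f), Matrix.diagonal_conjTranspose, mul_assoc]
  have hdu : star d * d = 1 := by
    apply diagHom_injective hw
    rw [map_mul, ← hstar, ← hvw, hvv', map_one]
  have hdi : ∀ i, ‖d i‖ = 1 := by
    intro i
    have h1 := congrFun hdu i
    have h2 : ‖star (d i) * d i‖ = 1 := by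
      have : star (d i) * d i = 1 := h1
      rw [this, norm_one]
    rw [norm_mul, norm_star] at h2
    nlinarith [norm_nonneg (d i)]
  -- In an eigenbasis of `v`, each eigenvalue is reached from `1` by scaling its argument.
  let e : I → X → ℂ := fun t i => Complex.exp ((t : ℝ) * Complex.arg (d i) * Complex.I)
  have he : ∀ t, star (e t) * e t = 1 := by
    intro t
    ext i
    change star (e t i) * e t i = 1
    rw [Complex.star_def, ← Complex.normSq_eq_conj_mul_self, Complex.normSq_eq_norm_sq]
    have : ‖e t i‖ = 1 := by
      simp only [e]
      rw [← Complex.ofReal_mul, Complex.norm_exp_ofReal_mul_I]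
    rw [this]; simp
  have hcont : Continuous fun t => diagHom w hw (e t) := by
    have h1 : Continuous e := continuous_pi fun i => by simp only [e]; fun_prop
    have h2 := h1.matrix_diagonal
    simp only [diagHom_apply]
    fun_prop
  refine ⟨⟨fun t => diagHom w hw (e t), hcont⟩, fun t => ?_, ?_, ?_⟩
  · rw [Matrix.mem_unitaryGroup_iff']
    change star (diagHom w hw (e t)) * diagHom w hw (e t) = 1
    rw [hstar, ← map_mul, he, map_one]
  · change diagHom w hw (e 0) = 1
    rw [← map_one (diagHom w hw)]
    congr 1
    ext i
    simp [e]
  · change diagHom w hw (e 1) = v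
    rw [hvw]
    congr 1
    ext i
    simp only [e, Set.Icc.coe_one, Complex.ofReal_one, one_mul]
    have := Complex.norm_mul_exp_arg_mul_I (d i)
    rwa [hdi, Complex.ofReal_one, one_mul] at this

end Paths

/-! ### Product bases for `M_Y ⊗ 1`. -/

section Ampliation

variable {X Y Z : Type*} [DecidableEq Z]

/-- The embedding `a ↦ a ⊗ 1`. -/
def ampl (e : X ≃ Y × Z) (a : Matrix Y Y ℂ) : Matrix X X ℂ :=
  (a ⊗ₖ (1 : Matrix Z Z ℂ)).submatrix e e

theorem ampl_apply (e : X ≃ Y × Z) (a : Matrix Y Y ℂ) (p q : X) :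
    ampl e a p q = if (e p).2 = (e q).2 then a (e p).1 (e q).1 else 0 := by
  simp [ampl, Matrix.one_apply]

/-- In a product basis, compression sends `a ⊗ 1` to `diag(a) ⊗ 1`, and the amplified matrix units
are monomial. -/
theorem isGood_one_of_ampl [Fintype X] [DecidableEq X] [Fintype Y] [DecidableEq Y] (e : X ≃ Y × Z) (R : StarSubalgebra ℂ (Matrix X X ℂ))
    (hR : ∀ x, x ∈ R ↔ ∃ a, x = ampl e a) : IsGood R 1 where
  unitary := one_mem _
  compress_mem x hx := by
    obtain ⟨a, rfl⟩ := (hR x).1 hx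
    refine (hR _).2 ⟨Matrix.diagonal (Matrix.diag a), ?_⟩
    rw [compress_apply, star_one, one_mul, one_mul, mul_one, mul_one]
    ext p q
    rw [Matrix.diagonal_apply, ampl_apply, Matrix.diagonal_apply, Matrix.diag_apply, ampl_apply]
    by_cases hpq : p = q
    · simp [hpq]
    · have : ¬ ((e p).2 = (e q).2 ∧ (e p).1 = (e q).1) := fun h =>
        hpq (e.injective (Prod.ext h.2 h.1))
      rw [if_neg hpq]
      split_ifs with h1 h2
      · exact (this ⟨h1, h2⟩).elim
      · rfl
      · rfl
  le_span x hx := by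
    obtain ⟨a, rfl⟩ := (hR x).1 hx
    have hsum : ampl e a = ∑ i, ∑ j, a i j • ampl e (Matrix.single i j 1) := by
      ext p q
      simp only [Matrix.sum_apply, Matrix.smul_apply, ampl_apply]
      split_ifs <;> simp [Matrix.single_apply, ite_and]
    rw [hsum]
    refine sum_mem fun i _ => sum_mem fun j _ => Submodule.smul_mem _ _
      (Submodule.subset_span ⟨(hR _).2 ⟨_, rfl⟩, ?_⟩)
    rw [star_one, one_mul, mul_one]
    have h : ∀ p q, ampl e (Matrix.single i j 1) p q ≠ 0 →
        (e p).2 = (e q).2 ∧ i = (e p).1 ∧ j = (e q).1 := by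
      intro p q hpq
      rw [ampl_apply, Matrix.single_apply] at hpq
      split_ifs at hpq with h1 h2
      · exact ⟨h1, h2⟩
      all_goals exact (hpq rfl).elim
    refine ⟨fun x y z h1 h2 => e.injective (Prod.ext ?_ ?_),
      fun x y z h1 h2 => e.injective (Prod.ext ?_ ?_)⟩
    · exact (h _ _ h1).2.1.symm.trans (h _ _ h2).2.1
    · exact (h _ _ h1).1.trans (h _ _ h2).1.symm
    · exact (h _ _ h1).2.2.symm.trans (h _ _ h2).2.2
    · exact (h _ _ h1).1.symm.trans (h _ _ h2).1

end Ampliation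

/-! ### Maximally entangled bases and Weyl matrices. -/

section Bell

theorem sqrt_inv_mul_self (d : ℕ) :
    ((Real.sqrt d : ℝ) : ℂ)⁻¹ * ((Real.sqrt d : ℝ) : ℂ)⁻¹ = (d : ℂ)⁻¹ := by
  rw [← mul_inv, ← Complex.ofReal_mul, Real.mul_self_sqrt (Nat.cast_nonneg d),
    Complex.ofReal_natCast]

variable {Y Z : Type*} [DecidableEq Y] [DecidableEq Z] (d : ℕ) [NeZero d]

/-- The unitary matrix whose columns are the maximally entangled vectors
`d^(-1/2) ∑ c, ω^(a c) e_c ⊗ e_(c+b)`, tensored with standard basis vectors. -/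
def bell : Matrix ((Y × ZMod d) × (Z × ZMod d)) ((Y × ZMod d) × (Z × ZMod d)) ℂ :=
  Matrix.of fun p q => if p.1.1 = q.1.1 ∧ p.2.1 = q.2.1 ∧ p.2.2 = p.1.2 + q.2.2 then
    ((Real.sqrt d : ℝ) : ℂ)⁻¹ * ZMod.stdAddChar (p.1.2 * q.1.2) else 0

theorem bell_apply (p q : (Y × ZMod d) × (Z × ZMod d)) : bell d p q =
    if p.1.1 = q.1.1 ∧ p.2.1 = q.2.1 ∧ p.2.2 = p.1.2 + q.2.2 then
      ((Real.sqrt d : ℝ) : ℂ)⁻¹ * ZMod.stdAddChar (p.1.2 * q.1.2) else 0 := rfl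

theorem star_stdAddChar (x : ZMod d) :
    star (ZMod.stdAddChar x : ℂ) = ZMod.stdAddChar (-x) := by
  rw [AddChar.map_neg_eq_conj]; rfl

theorem sum_stdAddChar_mul (b : ZMod d) :
    ∑ c : ZMod d, (ZMod.stdAddChar (c * b) : ℂ) = if b = 0 then (d : ℂ) else 0 := by
  have := AddChar.sum_mulShift (R := ZMod d) b (ZMod.isPrimitive_stdAddChar d)
  rw [ZMod.card] at this
  exact_mod_cast this

/-- The product of a matrix unit and a Weyl matrix. -/
def weyl (y y' : Y) (k l : ZMod d) : Matrix (Y × ZMod d) (Y × ZMod d) ℂ :=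
  Matrix.of fun p q => if y = p.1 ∧ y' = q.1 ∧ q.2 = p.2 + k then ZMod.stdAddChar (l * p.2) else 0

/-- Fourier inversion on `ZMod d`: averaging the phases over `l` isolates one row of the shifted
diagonal. -/
theorem single_eq_sum_weyl (i j : Y × ZMod d) : Matrix.single i j (1 : ℂ)
    = ∑ l, ((d : ℂ)⁻¹ * ZMod.stdAddChar (-(l * i.2))) • weyl d i.1 j.1 (j.2 - i.2) l := by
  have hd : (d : ℂ) ≠ 0 := Nat.cast_ne_zero.2 (NeZero.ne d)
  ext p q
  rw [Matrix.sum_apply]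
  simp only [Matrix.smul_apply, weyl, Matrix.of_apply]
  by_cases h : i.1 = p.1 ∧ j.1 = q.1 ∧ q.2 = p.2 + (j.2 - i.2)
  · have : ∀ l : ZMod d, ((d : ℂ)⁻¹ * ZMod.stdAddChar (-(l * i.2))) • (ZMod.stdAddChar (l * p.2) : ℂ)
        = (d : ℂ)⁻¹ * ZMod.stdAddChar (l * (p.2 - i.2)) := by
      intro l
      rw [smul_eq_mul, mul_assoc, ← AddChar.map_add_eq_mul]
      congr 2; ring
    simp only [if_pos h, this, ← Finset.mul_sum]
    rw [sum_stdAddChar_mul, Matrix.single_apply]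
    by_cases hi : p.2 = i.2
    · have hj : q.2 = j.2 := by rw [h.2.2, hi]; ring
      rw [if_pos (sub_eq_zero.2 hi), inv_mul_cancel₀ hd,
        if_pos ⟨Prod.ext h.1 hi.symm, Prod.ext h.2.1 hj.symm⟩]
    · rw [if_neg (fun h' => hi (sub_eq_zero.1 h')), mul_zero, if_neg]
      rintro ⟨rfl, -⟩
      exact hi rfl
  · simp only [if_neg h, smul_zero, Finset.sum_const_zero]
    refine Matrix.single_apply_of_ne _ _ _ _ _ ?_
    rintro ⟨rfl, rfl⟩
    exact h ⟨rfl, rfl, by ring⟩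

variable [Fintype Y] [Fintype Z]

/-- The matrix coefficients of `a ⊗ 1` in the Bell basis. -/
theorem bell_conj_apply (a : Matrix (Y × ZMod d) (Y × ZMod d) ℂ)
    (p q : (Y × ZMod d) × (Z × ZMod d)) :
    (star (bell d) * (a ⊗ₖ (1 : Matrix (Z × ZMod d) (Z × ZMod d) ℂ)) * bell d
      : Matrix ((Y × ZMod d) × (Z × ZMod d)) ((Y × ZMod d) × (Z × ZMod d)) ℂ) p q
      = if p.2.1 = q.2.1 then (d : ℂ)⁻¹ * ∑ c, ZMod.stdAddChar (-(c * p.1.2)) *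
          ZMod.stdAddChar ((c + p.2.2 - q.2.2) * q.1.2) *
            a (p.1.1, c) (q.1.1, c + p.2.2 - q.2.2) else 0 := by
  have hl : ∀ w, (star (bell d) * (a ⊗ₖ (1 : Matrix (Z × ZMod d) (Z × ZMod d) ℂ))
      : Matrix ((Y × ZMod d) × (Z × ZMod d)) ((Y × ZMod d) × (Z × ZMod d)) ℂ) p w
      = ∑ c, if p.2.1 = w.2.1 ∧ w.2.2 = c + p.2.2 then
        ((Real.sqrt d : ℝ) : ℂ)⁻¹ * ZMod.stdAddChar (-(c * p.1.2)) * a (p.1.1, c) w.1 else 0 := by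
    intro w
    rw [Matrix.mul_apply, Fintype.sum_prod_type, Fintype.sum_prod_type,
      Finset.sum_eq_single p.1.1]
    · refine Finset.sum_congr rfl fun c _ => ?_
      rw [Finset.sum_eq_single w.2]
      · rw [Matrix.star_apply, bell_apply, Matrix.kroneckerMap_apply, Matrix.one_apply_eq, mul_one]
        by_cases h : p.2.1 = w.2.1 ∧ w.2.2 = c + p.2.2
        · rw [if_pos h, if_pos ⟨rfl, h.1.symm, h.2⟩, star_mul', star_stdAddChar, star_inv₀,
            Complex.star_def, Complex.conj_ofReal]
        · rw [if_neg h, if_neg fun h' => h ⟨h'.2.1.symm, h'.2.2⟩, star_zero, zero_mul]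
      · intro k _ hk
        rw [Matrix.kroneckerMap_apply, Matrix.one_apply_ne hk, mul_zero, mul_zero]
      · simp
    · intro y _ hy
      refine Finset.sum_eq_zero fun c _ => Finset.sum_eq_zero fun k _ => ?_
      rw [Matrix.star_apply, bell_apply, if_neg fun h => hy h.1, star_zero, zero_mul]
    · simp
  rw [Matrix.mul_apply]
  simp only [hl, Finset.sum_mul]
  rw [Finset.sum_comm]
  by_cases hz : p.2.1 = q.2.1
  · rw [if_pos hz, Finset.mul_sum]
    refine Finset.sum_congr rfl fun c _ => ?_
    rw [Finset.sum_eq_single ((q.1.1, c + p.2.2 - q.2.2), (q.2.1, c + p.2.2))]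
    · rw [bell_apply, if_pos ⟨hz, rfl⟩, if_pos ⟨rfl, rfl, by simp⟩, ← sqrt_inv_mul_self]
      ring
    · intro w _ hw
      by_cases h1 : p.2.1 = w.2.1 ∧ w.2.2 = c + p.2.2
      · rw [bell_apply, if_neg (c := w.1.1 = q.1.1 ∧ _), mul_zero]
        rintro ⟨h2, h3, h4⟩
        apply hw
        refine Prod.ext (Prod.ext h2 ?_) (Prod.ext h3 h1.2)
        rw [← h1.2, h4]; ring
      · rw [if_neg h1, zero_mul]
    · simp
  · rw [if_neg hz]
    refine Finset.sum_eq_zero fun c _ => Finset.sum_eq_zero fun w _ => ?_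
    by_cases h1 : p.2.1 = w.2.1 ∧ w.2.2 = c + p.2.2
    · rw [bell_apply, if_neg (c := w.1.1 = q.1.1 ∧ _), mul_zero]
      rintro ⟨h2, h3, h4⟩
      exact hz (h1.1.trans h3)
    · rw [if_neg h1, zero_mul]

theorem bell_mem : bell d ∈ Matrix.unitaryGroup ((Y × ZMod d) × (Z × ZMod d)) ℂ := by
  rw [Matrix.mem_unitaryGroup_iff']
  have h := bell_conj_apply (Y := Y) (Z := Z) d 1
  rw [Matrix.one_kronecker_one, mul_one] at h
  ext p q
  rw [h, Matrix.one_apply]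
  have hd : (d : ℂ) ≠ 0 := Nat.cast_ne_zero.2 (NeZero.ne d)
  by_cases hz : p.2.1 = q.2.1
  · rw [if_pos hz]
    by_cases hyb : p.1.1 = q.1.1 ∧ p.2.2 = q.2.2
    · obtain ⟨hy, hb⟩ := hyb
      have : ∀ c : ZMod d, (ZMod.stdAddChar (-(c * p.1.2)) *
          ZMod.stdAddChar ((c + p.2.2 - q.2.2) * q.1.2) *
            (1 : Matrix (Y × ZMod d) (Y × ZMod d) ℂ) (p.1.1, c) (q.1.1, c + p.2.2 - q.2.2) : ℂ)
          = ZMod.stdAddChar (c * (q.1.2 - p.1.2)) := by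
        intro c
        rw [hy, hb, add_sub_cancel_right, Matrix.one_apply_eq, mul_one, ← AddChar.map_add_eq_mul]
        congr 1; ring
      simp only [this]
      rw [sum_stdAddChar_mul]
      by_cases ha : p.1.2 = q.1.2
      · have hpq : p = q := Prod.ext (Prod.ext hy ha) (Prod.ext hz hb)
        rw [if_pos (sub_eq_zero.2 ha.symm), if_pos hpq, inv_mul_cancel₀ hd]
      · have hpq : p ≠ q := fun h => ha (by rw [h])
        rw [if_neg fun h => ha (sub_eq_zero.1 h).symm, if_neg hpq, mul_zero]
    · have hpq : p ≠ q := fun h => hyb (by rw [h]; exact ⟨rfl, rfl⟩)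
      rw [if_neg hpq, Finset.sum_eq_zero, mul_zero]
      intro c _
      rw [Matrix.one_apply_ne, mul_zero]
      intro h
      rw [Prod.mk.injEq] at h
      refine hyb ⟨h.1, ?_⟩
      have h2 := h.2
      rw [add_sub_assoc, left_eq_add, sub_eq_zero] at h2
      exact h2
  · have hpq : p ≠ q := fun h => hz (by rw [h])
    rw [if_neg hz, if_neg hpq]

theorem bell_diag_apply (a : Matrix (Y × ZMod d) (Y × ZMod d) ℂ)
    (p : (Y × ZMod d) × (Z × ZMod d)) :
    (star (bell d) * (a ⊗ₖ (1 : Matrix (Z × ZMod d) (Z × ZMod d) ℂ)) * bell d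
      : Matrix ((Y × ZMod d) × (Z × ZMod d)) ((Y × ZMod d) × (Z × ZMod d)) ℂ) p p
      = (d : ℂ)⁻¹ * ∑ c, a (p.1.1, c) (p.1.1, c) := by
  rw [bell_conj_apply, if_pos rfl]
  congr 1
  refine Finset.sum_congr rfl fun c _ => ?_
  rw [add_sub_cancel_right, ← AddChar.map_add_eq_mul, neg_add_cancel, AddChar.map_zero_eq_one,
    one_mul]

/-- Each Bell vector has the normalised trace as its marginal state on the `ZMod d` factor, so
compression averages the diagonal of `a` over that factor. -/
theorem compress_bell (a : Matrix (Y × ZMod d) (Y × ZMod d) ℂ) :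
    compress (bell d) (a ⊗ₖ (1 : Matrix (Z × ZMod d) (Z × ZMod d) ℂ))
      = Matrix.diagonal (fun i : Y × ZMod d => (d : ℂ)⁻¹ * ∑ c, a (i.1, c) (i.1, c)) ⊗ₖ
        (1 : Matrix (Z × ZMod d) (Z × ZMod d) ℂ) := by
  rw [compress_apply]
  have h1 : Matrix.diag (star (bell d) * (a ⊗ₖ (1 : Matrix (Z × ZMod d) (Z × ZMod d) ℂ)) * bell d)
      = fun p => (d : ℂ)⁻¹ * ∑ c, a (p.1.1, c) (p.1.1, c) := funext fun p => bell_diag_apply d a p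
  have h2 : Matrix.diagonal (fun i : Y × ZMod d => (d : ℂ)⁻¹ * ∑ c, a (i.1, c) (i.1, c)) ⊗ₖ
        (1 : Matrix (Z × ZMod d) (Z × ZMod d) ℂ)
      = Matrix.diagonal fun p => (d : ℂ)⁻¹ * ∑ c, a (p.1.1, c) (p.1.1, c) := by
    rw [← Matrix.diagonal_one, Matrix.diagonal_kronecker_diagonal]
    simp
  -- Bell vectors stay within a fixed `Y`-coordinate, the only one on which this diagonal depends.
  have h3 : bell d * Matrix.diagonal (fun p : (Y × ZMod d) × (Z × ZMod d) =>
        (d : ℂ)⁻¹ * ∑ c, a (p.1.1, c) (p.1.1, c))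
      = Matrix.diagonal (fun p : (Y × ZMod d) × (Z × ZMod d) =>
        (d : ℂ)⁻¹ * ∑ c, a (p.1.1, c) (p.1.1, c)) * bell d := by
    ext p q
    rw [Matrix.mul_diagonal, Matrix.diagonal_mul, bell_apply]
    split_ifs with h
    · rw [h.1, mul_comm]
    · simp
  rw [h1, h2, h3, mul_assoc, (Matrix.mem_unitaryGroup_iff).1 (bell_mem d), mul_one]

/-- A Weyl matrix on one leg permutes the Bell vectors up to phases, translating both labels: `b` by
`k` and `a` by `l`. -/
theorem isMonomial_weyl (y y' : Y) (k l : ZMod d) :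
    IsMonomial (star (bell d) * (weyl d y y' k l ⊗ₖ (1 : Matrix (Z × ZMod d) (Z × ZMod d) ℂ))
      * bell d) := by
  have h : ∀ p q, (star (bell d) * (weyl d y y' k l ⊗ₖ (1 : Matrix (Z × ZMod d) (Z × ZMod d) ℂ))
      * bell d : Matrix ((Y × ZMod d) × (Z × ZMod d)) ((Y × ZMod d) × (Z × ZMod d)) ℂ) p q ≠ 0 → (p.2.1 = q.2.1 ∧ y = p.1.1 ∧ y' = q.1.1) ∧
        p.2.2 = q.2.2 + k ∧ p.1.2 = q.1.2 + l := by
    intro p q hpq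
    rw [bell_conj_apply] at hpq
    by_cases hz : p.2.1 = q.2.1
    swap
    · rw [if_neg hz] at hpq; exact (hpq rfl).elim
    rw [if_pos hz] at hpq
    have hw : ∀ c, weyl d y y' k l (p.1.1, c) (q.1.1, c + p.2.2 - q.2.2)
        = if y = p.1.1 ∧ y' = q.1.1 ∧ p.2.2 = q.2.2 + k then ZMod.stdAddChar (l * c) else 0 := by
      intro c
      have hiff : (c + p.2.2 - q.2.2 = c + k) ↔ p.2.2 = q.2.2 + k := by
        rw [add_sub_assoc, add_right_inj, sub_eq_iff_eq_add, add_comm k]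
      change (if y = p.1.1 ∧ y' = q.1.1 ∧ c + p.2.2 - q.2.2 = c + k then _ else _) = _
      simp only [hiff]
    simp only [hw] at hpq
    by_cases hc : y = p.1.1 ∧ y' = q.1.1 ∧ p.2.2 = q.2.2 + k
    swap
    · simp only [if_neg hc, mul_zero, Finset.sum_const_zero] at hpq
      exact (hpq rfl).elim
    simp only [if_pos hc] at hpq
    refine ⟨⟨hz, hc.1, hc.2.1⟩, hc.2.2, ?_⟩
    by_contra hne
    apply hpq
    have : ∀ c : ZMod d, (ZMod.stdAddChar (-(c * p.1.2)) *
        ZMod.stdAddChar ((c + p.2.2 - q.2.2) * q.1.2) * ZMod.stdAddChar (l * c) : ℂ)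
        = ZMod.stdAddChar ((p.2.2 - q.2.2) * q.1.2) *
          ZMod.stdAddChar (c * (q.1.2 + l - p.1.2)) := by
      intro c
      simp only [← AddChar.map_add_eq_mul]
      congr 1; ring
    simp only [this, ← Finset.mul_sum]
    rw [sum_stdAddChar_mul, if_neg, mul_zero, mul_zero]
    intro h
    exact hne (sub_eq_zero.1 h).symm
  refine ⟨fun x p q h1 h2 => ?_, fun x p q h1 h2 => ?_⟩
  · have e1 := h _ _ h1
    have e2 := h _ _ h2
    exact Prod.ext (Prod.ext (e1.1.2.1.symm.trans e2.1.2.1) (e1.2.2.trans e2.2.2.symm))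
      (Prod.ext (e1.1.1.trans e2.1.1.symm) (e1.2.1.trans e2.2.1.symm))
  · have e1 := h _ _ h1
    have e2 := h _ _ h2
    exact Prod.ext (Prod.ext (e1.1.2.2.symm.trans e2.1.2.2)
        (add_right_cancel (e1.2.2.symm.trans e2.2.2)))
      (Prod.ext (e1.1.1.symm.trans e2.1.1) (add_right_cancel (e1.2.1.symm.trans e2.2.1)))

variable {X : Type*} [Fintype X]

/-- The Bell basis as a unitary matrix over another index set. -/
def bellOf (e : X ≃ (Y × ZMod d) × (Z × ZMod d)) : Matrix X X ℂ := (bell d).submatrix e e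

theorem bellOf_conj (e : X ≃ (Y × ZMod d) × (Z × ZMod d))
    (a : Matrix ((Y × ZMod d) × (Z × ZMod d)) ((Y × ZMod d) × (Z × ZMod d)) ℂ) :
    star (bellOf d e) * a.submatrix e e * bellOf d e
      = (star (bell d) * a * bell d).submatrix e e := by
  rw [bellOf, Matrix.star_eq_conjTranspose, Matrix.conjTranspose_submatrix,
    Matrix.submatrix_mul_equiv, Matrix.submatrix_mul_equiv, Matrix.star_eq_conjTranspose]

theorem bellOf_mem [DecidableEq X] (e : X ≃ (Y × ZMod d) × (Z × ZMod d)) :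
    bellOf d e ∈ Matrix.unitaryGroup X ℂ := by
  rw [Matrix.mem_unitaryGroup_iff']
  have h := bellOf_conj d e 1
  rw [mul_one, (Matrix.mem_unitaryGroup_iff').1 (bell_mem d), Matrix.submatrix_one_equiv,
    mul_one] at h
  exact h

theorem compress_bellOf [DecidableEq X] (e : X ≃ (Y × ZMod d) × (Z × ZMod d))
    (a : Matrix (Y × ZMod d) (Y × ZMod d) ℂ) : compress (bellOf d e) (ampl e a)
      = ampl e (Matrix.diagonal fun i => (d : ℂ)⁻¹ * ∑ c, a (i.1, c) (i.1, c)) := by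
  rw [ampl, ampl, ← compress_bell, compress_apply, compress_apply, bellOf_conj]
  have h1 : ∀ b : Matrix ((Y × ZMod d) × (Z × ZMod d)) ((Y × ZMod d) × (Z × ZMod d)) ℂ,
      Matrix.diagonal (Matrix.diag (b.submatrix e e))
        = (Matrix.diagonal (Matrix.diag b)).submatrix e e := by
    intro b
    ext p q
    simp [Matrix.diagonal_apply]
  rw [h1, bellOf, Matrix.star_eq_conjTranspose ((bell d).submatrix e e),
    Matrix.conjTranspose_submatrix, Matrix.submatrix_mul_equiv, Matrix.submatrix_mul_equiv,
    ← Matrix.star_eq_conjTranspose]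

theorem isGood_bellOf [DecidableEq X] (e : X ≃ (Y × ZMod d) × (Z × ZMod d)) (R : StarSubalgebra ℂ (Matrix X X ℂ))
    (hR : ∀ x, x ∈ R ↔ ∃ a, x = ampl e a) : IsGood R (bellOf d e) where
  unitary := bellOf_mem d e
  compress_mem x hx := by
    obtain ⟨a, rfl⟩ := (hR x).1 hx
    exact (hR _).2 ⟨_, compress_bellOf d e a⟩
  le_span x hx := by
    obtain ⟨a, rfl⟩ := (hR x).1 hx
    let T : Matrix (Y × ZMod d) (Y × ZMod d) ℂ →ₗ[ℂ] Matrix X X ℂ :=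
      { toFun := ampl e
        map_add' := fun a b => by ext; simp only [ampl_apply, Matrix.add_apply]; split_ifs <;> simp
        map_smul' := fun c a => by
          ext; simp only [ampl_apply, Matrix.smul_apply, RingHom.id_apply]; split_ifs <;> simp }
    change T a ∈ _
    rw [Matrix.matrix_eq_sum_single a, map_sum]
    refine sum_mem fun i _ => ?_
    rw [map_sum]
    refine sum_mem fun j _ => ?_
    have hij : Matrix.single i j (a i j) = a i j • Matrix.single i j (1 : ℂ) := by
      rw [Matrix.smul_single, smul_eq_mul, mul_one]
    rw [hij, map_smul, single_eq_sum_weyl, map_sum]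
    refine Submodule.smul_mem _ _ (sum_mem fun l _ => ?_)
    rw [map_smul]
    refine Submodule.smul_mem _ _ (Submodule.subset_span ⟨(hR _).2 ⟨_, rfl⟩, ?_⟩)
    change IsMonomial (star (bellOf d e) * (_ ⊗ₖ _ : Matrix _ _ ℂ).submatrix e e * bellOf d e)
    rw [bellOf_conj]
    have h := isMonomial_weyl (Z := Z) d i.1 j.1 (j.2 - i.2) l
    exact ⟨fun x y z h1 h2 => e.injective (h.1 _ _ _ h1 h2),
      fun x y z h1 h2 => e.injective (h.2 _ _ _ h1 h2)⟩

end Bell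

/-! ### Degenerate Cartan subalgebras in the non-coprime case. -/

section Degenerate

/-- If the sizes of both tensor factors have a common divisor, some basis in good position to
`M_Y ⊗ 1` has a degenerate diagonal. -/
theorem exists_isGood_degenerate {X Y Z : Type*} [Fintype X] [DecidableEq X] [Fintype Y]
    [DecidableEq Y] [Fintype Z] [DecidableEq Z] [Nonempty X] (e : X ≃ Y × Z)
    (R : StarSubalgebra ℂ (Matrix X X ℂ)) (hR : ∀ x, x ∈ R ↔ ∃ a, x = ampl e a)
    (hcop : ¬ Nat.Coprime (Fintype.card Y) (Fintype.card Z)) :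
    ∃ v, IsGood R v ∧ ∃ x x', (∀ b ∈ R, (star v * b * v).IsDiag →
      b x x = b x' x' ∧ ∀ z, z ≠ x → b x z = 0) ∧ ∃ r ∈ R, r x x ≠ r x' x' := by
  obtain ⟨x₀⟩ := ‹Nonempty X›
  have : Nonempty Y := ⟨(e x₀).1⟩
  have : Nonempty Z := ⟨(e x₀).2⟩
  set d := Nat.gcd (Fintype.card Y) (Fintype.card Z) with hd
  have hd0 : 0 < d := Nat.gcd_pos_of_pos_left _ Fintype.card_pos
  have hd1 : 1 < d := lt_of_le_of_ne hd0 (Ne.symm hcop)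
  have : NeZero d := ⟨hd0.ne'⟩
  -- Makes `0` and `1` distinct in `ZMod d`, so that the two chosen indices differ.
  have : Fact (1 < d) := ⟨hd1⟩
  obtain ⟨k, hk⟩ : d ∣ Fintype.card Y := Nat.gcd_dvd_left _ _
  obtain ⟨l, hl⟩ : d ∣ Fintype.card Z := Nat.gcd_dvd_right _ _
  let f : Y ≃ Fin k × ZMod d := Fintype.equivOfCardEq (by
    rw [hk, Fintype.card_prod, Fintype.card_fin, ZMod.card, mul_comm])
  let g : Z ≃ Fin l × ZMod d := Fintype.equivOfCardEq (by
    rw [hl, Fintype.card_prod, Fintype.card_fin, ZMod.card, mul_comm])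
  let e' : X ≃ (Fin k × ZMod d) × (Fin l × ZMod d) := e.trans (f.prodCongr g)
  have hR' : ∀ x, x ∈ R ↔ ∃ a, x = ampl e' a := by
    intro x
    rw [hR]
    constructor
    · rintro ⟨a, rfl⟩
      refine ⟨a.submatrix f.symm f.symm, ?_⟩
      ext p q
      simp [ampl_apply, e']
    · rintro ⟨a, rfl⟩
      refine ⟨a.submatrix f f, ?_⟩
      ext p q
      simp [ampl_apply, e']
  let y₀ := (e' x₀).1.1
  let z₀ := (e' x₀).2
  refine ⟨bellOf d e', isGood_bellOf d e' R hR', e'.symm ((y₀, 0), z₀), e'.symm ((y₀, 1), z₀),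
    fun b hb hdiag => ?_, ampl e' (Matrix.single (y₀, 0) (y₀, 0) 1), (hR' _).2 ⟨_, rfl⟩, ?_⟩
  · obtain ⟨a, rfl⟩ := (hR' b).1 hb
    have hcomp := compress_bellOf d e' a
    -- An element diagonal in the Bell basis equals its own compression. It is therefore diagonal in
    -- the standard basis too, with entries constant along `ZMod d`.
    rw [compress_apply, hdiag.diagonal_diag, conj_conj' (bellOf_mem d e')] at hcomp
    rw [hcomp]
    constructor
    · simp [ampl_apply]
    · intro z hz
      rw [ampl_apply]
      split_ifs with h
      · rw [Matrix.diagonal_apply_ne]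
        intro h2
        apply hz
        rw [Equiv.eq_symm_apply]
        rw [Equiv.apply_symm_apply] at h h2
        exact Prod.ext h2.symm h.symm
      · rfl
  · simp [ampl_apply]

variable {m n o : ℕ}

/-- The decomposition of the index set that corresponds to `M_m ⊗ 1 ⊗ M_o`. -/
def leftEquiv (m n o : ℕ) : Fin m × Fin n × Fin o ≃ (Fin m × Fin o) × Fin n where
  toFun p := ((p.1, p.2.2), p.2.1)
  invFun q := (q.1.1, q.2, q.1.2)

/-- The decomposition of the index set that corresponds to `1 ⊗ M_n ⊗ M_o`. -/
def rightEquiv (m n o : ℕ) : Fin m × Fin n × Fin o ≃ (Fin n × Fin o) × Fin m where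
  toFun p := (p.2, p.1)
  invFun q := (q.2, q.1)

theorem mem_range_embedLeft (x : Mat3 m n o) :
    x ∈ (embedLeft m n o).range ↔ ∃ a, x = ampl (leftEquiv m n o) a := by
  have : ∀ a, embedLeft m n o a = ampl (leftEquiv m n o) a := fun a => by
    ext p q; rw [ampl_apply]; rfl
  exact exists_congr fun a => by rw [← this]; exact eq_comm

theorem mem_range_embedRight (x : Mat3 m n o) :
    x ∈ (embedRight m n o).range ↔ ∃ a, x = ampl (rightEquiv m n o) a := by
  have : ∀ a, embedRight m n o a = ampl (rightEquiv m n o) a := fun a => by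
    ext p q; rw [ampl_apply]; rfl
  exact exists_congr fun a => by rw [← this]; exact eq_comm

/-- The frame is the Bell basis at `0` and the standard basis at `1`; the path is reversed because
`exists_path_unitary` starts at `1`. Two vector states at `0` then agree on the subalgebra but not
on the whole algebra. -/
theorem exists_isCartan_of_not_coprime_left [Nonempty (Fin m × Fin n × Fin o)]
    (hcop : ¬ Nat.Coprime (m * o) n) : ∃ B : StarSubalgebra ℂ (dimDrop m n o),
      IsCartan B ∧ ¬ HasUniqueExtensionProperty B := by
  obtain ⟨v, hv, x, x', hxx, r, hr, hne⟩ := exists_isGood_degenerate (leftEquiv m n o) _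
    mem_range_embedLeft (by simpa using hcop)
  obtain ⟨w, hw, hw0, hw1⟩ := exists_path_unitary hv.unitary
  let u : C(I, Mat3 m n o) := w.comp ⟨unitInterval.symm, unitInterval.continuous_symm⟩
  have hu : ∀ t, u t ∈ Matrix.unitaryGroup (Fin m × Fin n × Fin o) ℂ := fun t => hw _
  have hu0 : u 0 = v := by simp [u, hw1]
  have hu1 : u 1 = 1 := by simp [u, hw0]
  refine ⟨pathAlg u hu, isCartan_pathAlg hu (hu0 ▸ hv)
    (hu1 ▸ isGood_one_of_ampl (rightEquiv m n o) _ mem_range_embedRight), ?_⟩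
  have key : ∀ b ∈ pathAlg u hu, (star v * evalHom m n o 0 b * v).IsDiag := fun b hb => by
    have := hb 0
    rwa [conjHom_apply, hu0] at this
  obtain ⟨a, ha⟩ := hr
  obtain ⟨f, hf⟩ := exists_evalHom_zero a
  exact not_uniqueExtension 0 x x' (fun b hb => (hxx _ b.2.1 (key b hb)).1)
    (fun b hb => (hxx _ b.2.1 (key b hb)).2) ⟨f, by rw [hf]; exact ha ▸ hne⟩

theorem exists_isCartan_of_not_coprime_right [Nonempty (Fin m × Fin n × Fin o)]
    (hcop : ¬ Nat.Coprime (n * o) m) : ∃ B : StarSubalgebra ℂ (dimDrop m n o),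
      IsCartan B ∧ ¬ HasUniqueExtensionProperty B := by
  obtain ⟨v, hv, x, x', hxx, r, hr, hne⟩ := exists_isGood_degenerate (rightEquiv m n o) _
    mem_range_embedRight (by simpa using hcop)
  obtain ⟨u, hu, hu0, hu1⟩ := exists_path_unitary hv.unitary
  refine ⟨pathAlg u hu, isCartan_pathAlg hu
    (hu0 ▸ isGood_one_of_ampl (leftEquiv m n o) _ mem_range_embedLeft) (hu1 ▸ hv), ?_⟩
  have key : ∀ b ∈ pathAlg u hu, (star v * evalHom m n o 1 b * v).IsDiag := fun b hb => by
    have := hb 1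
    rwa [conjHom_apply, hu1] at this
  obtain ⟨a, ha⟩ := hr
  obtain ⟨f, hf⟩ := exists_evalHom_one a
  exact not_uniqueExtension 1 x x' (fun b hb => (hxx _ b.2.2 (key b hb)).1)
    (fun b hb => (hxx _ b.2.2 (key b hb)).2) ⟨f, by rw [hf]; exact ha ▸ hne⟩

end Degenerate

end CartanDimDrop

end

theorem mainTheorem3 (m n o : ℕ) (hm : 1 ≤ m) (hn : 1 ≤ n) (ho : 1 ≤ o) :
    List.TFAE
      [Nat.Coprime m n ∧ Nat.Coprime m o ∧ Nat.Coprime n o,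
       ∀ B : StarSubalgebra ℂ (CartanDimDrop.dimDrop m n o),
         CartanDimDrop.IsCartan B → CartanDimDrop.IsNonDegenerate B,
       ∀ B : StarSubalgebra ℂ (CartanDimDrop.dimDrop m n o),
         CartanDimDrop.IsCartan B → CartanDimDrop.IsCStarDiagonal B] := by
  have hne : Nonempty (Fin m × Fin n × Fin o) := ⟨⟨0, hm⟩, ⟨0, hn⟩, ⟨0, ho⟩⟩
  tfae_have 1 → 2 := fun ⟨hmn, hmo, hno⟩ B hB =>
    CartanDimDrop.isNonDegenerate_of_coprime hm hn ho hmn hmo hno hB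
  tfae_have 2 → 3 := fun h B hB =>
    ⟨hB, CartanDimDrop.uniqueExtension_of_isNonDegenerate hm hn hB (h B hB)⟩
  -- The endpoint conditions `gcd(mo, n) = 1` and `gcd(no, m) = 1` together contain all three
  -- pairwise conditions.
  tfae_have 3 → 1 := by
    intro h
    have hl : Nat.Coprime (m * o) n := by
      by_contra hcop
      obtain ⟨B, hB, hU⟩ := CartanDimDrop.exists_isCartan_of_not_coprime_left hcop
      exact hU (h B hB).2
    have hr : Nat.Coprime (n * o) m := by
      by_contra hcop
      obtain ⟨B, hB, hU⟩ := CartanDimDrop.exists_isCartan_of_not_coprime_right hcop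
      exact hU (h B hB).2
    exact ⟨Nat.Coprime.coprime_mul_right hl, (Nat.Coprime.coprime_mul_left hr).symm,
      (Nat.Coprime.coprime_mul_left hl).symm⟩
  tfae_finish
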